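/- Let $\Omega$ be a smooth, compact, connected, oriented surface without boundary embedded in some $\mathbb{R}^n$, with the induced Riemannian metric and area measure; let $\mathbf v\mapsto \mathbf k\times\mathbf v$ denote rotation by a right angle in the tangent planes and $\nabla^\perp\psi=\mathbf k\times\nabla\psi$. (For example the round sphere in $\mathbb{R}^3$, or the doubly periodic plane, i.e. a rectangle with opposite sides identified, isometrically a product of two circles in $\mathbb{R}^4$.) Let $E\subset H^1(\Omega)$, $S\subset H(\mathrm{div},\Omega)$, $V\subset L^2(\Omega)$ be finite-dimensional subspaces such that $E$ and $V$ contain the constant functions, $\nabla^\perp E\subset S$, $\nabla\cdot S\subset V$, and such that the inf-sup condition holds: there is $\gamma>0$ such that for every nonzero $\phi\in V$ with $\int_\Omega\phi=0$ there is a nonzero $\mathbf v\in S$ with $\int_\Omega\phi\,\nabla\cdot\mathbf v\ge\gamma\|\phi\|_{L^2}\|\mathbf v\|_{H(\mathrm{div})}$. Define the discrete gradient $D:V\to S$ by $\int_\Omega \mathbf w\cdot D\phi=-\int_\Omega(\nabla\cdot\mathbf w)\,\phi$ for all $\mathbf w\in S$, the space of discrete harmonic fields $$H^h=\Big\{\mathbf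 u\in S:\ \nabla\cdot\mathbf u=0,\ \int_\Omega\mathbf u\cdot\nabla^\perp\psi=0\ \ \forall\psi\in E\Big\},$$ and the space of harmonic fields $$H=\Big\{\mathbf u\in H(\mathrm{div},\Omega):\ \nabla\cdot\mathbf u=0,\ \int_\Omega\mathbf u\cdot\nabla^\perp\psi=0\ \ \forall\psi\in H^1(\Omega)\Big\}.$$ 1. $\nabla^\perp:E\to S$, $\nabla\cdot:S\to V$ and $D:V\to S$ are well defined. The kernels of $\nabla^\perp$ on $E$ and of $D$ on $V$ are exactly the constant functions. $S$ is the $L^2$-orthogonal direct sum $S=\nabla^\perp E\oplus D(V)\oplus H^h$, and $\dim S=(\dim E-1)+(\dim V-1)+\dim H^h$. 2. Suppose in addition that there are linear projections $\Pi^E:H^1(\Omega)\to E$, $\Pi^S:H(\mathrm{div},\Omega)\to S$, $\Pi^V:L^2(\Omega)\to V$ onto these spaces with $\Pi^S\nabla^\perp=\nabla^\perp\Pi^E$ and $\nabla\cdot\Pi^S=\Pi^V\nabla\cdot$, where $\Pi^S$ is bounded in the $H(\mathrm{div})$ norm and $\|\mathbf q-\Pi^S\mathbf q\|_{L^2}<\|\mathbf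 q\|_{L^2}$ for every nonzero $\mathbf q\in H$. Then $H$ is finite-dimensional, $\dim H^h=\dim H$, hence $$\dim S=(\dim E-1)+(\dim V-1)+\dim H,\qquad \dim E=\dim S-\dim V+2-\dim H;$$ if $\dim S=2\dim V$ then $\dim E=\dim V+2-\dim H$; $\dim S>2\dim V$ if and only if $\dim E>\dim V+(2-\dim H)$; and $\dim S<2\dim V$ if and only if $\dim E<\dim V+(2-\dim H)$. 3. On the doubly periodic plane (with arbitrary periods), $H$ consists of the constant velocity fields and $\dim H=2$; so, under the assumptions of 2, $\dim S=2\dim V$ implies $\dim E=\dim V$. On the sphere (of any radius), $H=0$; so, under the assumptions of 2, $\dim S=2\dim V$ implies $\dim E=\dim V+2$. -/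

import Mathlib

open MeasureTheory
open scoped ContDiff ENNReal

namespace MixedFE

/-- Euclidean `n`-space. -/
abbrev Euc (n : ℕ) : Type := EuclideanSpace ℝ (Fin n)

section Surfaces

variable {n : ℕ}

/-- `p` restricted to the open set `U ⊆ ℝ²` is a smooth regular parametrization of a relatively
open piece of `Ω`: a smooth immersion which is a homeomorphism onto a relatively open subset. -/
structure IsSurfacePatch (Ω : Set (Euc n)) (U : Set (Euc 2)) (p : Euc 2 → Euc n) : Prop where
  isOpen : IsOpen U
  smooth : ContDiffOn ℝ ∞ p U
  immersion : ∀ y ∈ U, Function.Injective (fderiv ℝ p y)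
  injOn : Set.InjOn p U
  relOpen : ∀ U' : Set (Euc 2), U' ⊆ U → IsOpen U' → ∃ W : Set (Euc n), IsOpen W ∧ p '' U' = Ω ∩ W

/-- A smooth, compact, connected two-dimensional surface without boundary embedded in `ℝⁿ`, with
the Riemannian metric induced from `ℝⁿ`. (The ambient dimension is arbitrary so that the flat,
doubly periodic plane is included.) -/
structure IsClosedSurface (Ω : Set (Euc n)) : Prop where
  isCompact : IsCompact Ω
  isConnected : IsConnected Ω
  exists_patch : ∀ x ∈ Ω, ∃ (U : Set (Euc 2)) (p : Euc 2 → Euc n), IsSurfacePatch Ω U p ∧ x ∈ p '' U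

/-- The tangent plane of `Ω` at `x`. -/
def tangentPlane (Ω : Set (Euc n)) (x : Euc n) : Submodule ℝ (Euc n) :=
  Submodule.span ℝ (tangentConeAt ℝ Ω x)

/-- The surface area measure of `Ω`: two-dimensional Hausdorff measure, normalized so as to agree
with Lebesgue measure on planes, restricted to `Ω`. -/
noncomputable def area (Ω : Set (Euc n)) : Measure (Euc n) :=
  (Measure.euclideanHausdorffMeasure 2).restrict Ω

/-- The map `v ↦ k × v`: a continuous choice `J` of rotation by a right angle in the tangent planes
of `Ω`, i.e. an orientation of `Ω`. For a surface in `ℝ³` with continuous unit normal field `k`,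
this is `J x v = k x × v` on tangent vectors. Only the values on tangent vectors are ever used. -/
structure IsRotationField (Ω : Set (Euc n)) (J : Euc n → Euc n →L[ℝ] Euc n) : Prop where
  continuousOn : ContinuousOn J Ω
  mapsTo : ∀ x ∈ Ω, ∀ v ∈ tangentPlane Ω x, J x v ∈ tangentPlane Ω x
  norm_eq : ∀ x ∈ Ω, ∀ v ∈ tangentPlane Ω x, ‖J x v‖ = ‖v‖
  orthogonal : ∀ x ∈ Ω, ∀ v ∈ tangentPlane Ω x, inner ℝ (J x v) v = 0

/-- The surface divergence of a smooth tangential vector field `X` on `Ω` (given by a smooth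
extension to `ℝⁿ`): the trace over the tangent plane of the tangential part of the derivative. -/
noncomputable def surfaceDiv (Ω : Set (Euc n)) (X : Euc n → Euc n) (x : Euc n) : ℝ :=
  LinearMap.trace ℝ (Euc n)
    (((tangentPlane Ω x).starProjection ∘L fderiv ℝ X x : Euc n →L[ℝ] Euc n) : Euc n →ₗ[ℝ] Euc n)

/-- `L²(Ω)`. -/
abbrev L2 (Ω : Set (Euc n)) : Type := Lp ℝ 2 (area Ω)

/-- Square integrable `ℝⁿ`-valued fields on `Ω`; velocity fields are the tangential ones. -/
abbrev L2Vec (Ω : Set (Euc n)) : Type := Lp (Euc n) 2 (area Ω)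

variable {Ω : Set (Euc n)}

/-- The field `u` is tangential to `Ω`. -/
def IsTangential (u : L2Vec Ω) : Prop := ∀ᵐ x ∂area Ω, u x ∈ tangentPlane Ω x

/-- `u` is a square integrable velocity field with weak divergence `d ∈ L²(Ω)`:
`∫ d φ = - ∫ u · ∇φ` for all smooth `φ`. As `u` is tangential, `u · ∇φ` is the
derivative of `φ` in direction `u`. (The integrability clauses are automatic on closed surfaces.) -/
def HasWeakDiv (u : L2Vec Ω) (d : L2 Ω) : Prop :=
  IsTangential u ∧ ∀ φ : Euc n → ℝ, ContDiff ℝ ∞ φ →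
    Integrable (fun x => d x * φ x) (area Ω) ∧
    Integrable (fun x => fderiv ℝ φ x (u x)) (area Ω) ∧
    ∫ x, d x * φ x ∂area Ω = -∫ x, fderiv ℝ φ x (u x) ∂area Ω

/-- `w` is the weak surface gradient of `ψ ∈ L²(Ω)`: `w` is tangential, square integrable and
`∫ ψ ∇·X = - ∫ w · X` for all smooth tangential fields `X`. -/
def HasWeakGrad (ψ : L2 Ω) (w : L2Vec Ω) : Prop :=
  IsTangential w ∧ ∀ X : Euc n → Euc n, ContDiff ℝ ∞ X → (∀ x ∈ Ω, X x ∈ tangentPlane Ω x) →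
    Integrable (fun x => ψ x * surfaceDiv Ω X x) (area Ω) ∧
    Integrable (fun x => inner ℝ (w x) (X x)) (area Ω) ∧
    ∫ x, ψ x * surfaceDiv Ω X x ∂area Ω = -∫ x, inner ℝ (w x) (X x) ∂area Ω

/-- `u = ∇^⊥ ψ = k × ∇ψ`. -/
def HasCurl (J : Euc n → Euc n →L[ℝ] Euc n) (ψ : L2 Ω) (u : L2Vec Ω) : Prop :=
  ∃ w : L2Vec Ω, HasWeakGrad ψ w ∧ ∀ᵐ x ∂area Ω, u x = J x (w x)

/-- `f` is a constant function. -/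
def IsConst (f : L2 Ω) : Prop := ∃ c : ℝ, ∀ᵐ x ∂area Ω, f x = c

/-! Linearity of these relations. -/

theorem IsTangential.add {u v : L2Vec Ω} (hu : IsTangential u) (hv : IsTangential v) :
    IsTangential (u + v) := by
  filter_upwards [hu, hv, Lp.coeFn_add u v] with x h1 h2 h3
  rw [h3]
  exact Submodule.add_mem _ h1 h2

theorem IsTangential.smul {u : L2Vec Ω} (c : ℝ) (hu : IsTangential u) :
    IsTangential (c • u) := by
  filter_upwards [hu, Lp.coeFn_smul c u] with x h1 h3
  rw [h3]
  exact Submodule.smul_mem _ c h1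

theorem HasWeakDiv.add {u v : L2Vec Ω} {d e : L2 Ω} (hu : HasWeakDiv u d) (hv : HasWeakDiv v e) :
    HasWeakDiv (u + v) (d + e) := by
  refine ⟨hu.1.add hv.1, fun φ hφ => ?_⟩
  obtain ⟨a1, a2, a3⟩ := hu.2 φ hφ
  obtain ⟨b1, b2, b3⟩ := hv.2 φ hφ
  have h1 : (fun x => (d + e : L2 Ω) x * φ x) =ᵐ[area Ω] fun x => d x * φ x + e x * φ x := by
    filter_upwards [Lp.coeFn_add d e] with x hx
    rw [hx, Pi.add_apply, add_mul]
  have h2 : (fun x => fderiv ℝ φ x ((u + v : L2Vec Ω) x)) =ᵐ[area Ω]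
      fun x => fderiv ℝ φ x (u x) + fderiv ℝ φ x (v x) := by
    filter_upwards [Lp.coeFn_add u v] with x hx
    rw [hx, Pi.add_apply, map_add]
  refine ⟨(a1.add b1).congr h1.symm, (a2.add b2).congr h2.symm, ?_⟩
  rw [integral_congr_ae h1, integral_congr_ae h2, integral_add a1 b1, integral_add a2 b2, a3, b3]
  ring

theorem HasWeakDiv.smul {u : L2Vec Ω} {d : L2 Ω} (c : ℝ) (hu : HasWeakDiv u d) :
    HasWeakDiv (c • u) (c • d) := by
  refine ⟨hu.1.smul c, fun φ hφ => ?_⟩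
  obtain ⟨a1, a2, a3⟩ := hu.2 φ hφ
  have h1 : (fun x => (c • d : L2 Ω) x * φ x) =ᵐ[area Ω] fun x => c * (d x * φ x) := by
    filter_upwards [Lp.coeFn_smul c d] with x hx
    rw [hx, Pi.smul_apply, smul_eq_mul, mul_assoc]
  have h2 : (fun x => fderiv ℝ φ x ((c • u : L2Vec Ω) x)) =ᵐ[area Ω]
      fun x => c * fderiv ℝ φ x (u x) := by
    filter_upwards [Lp.coeFn_smul c u] with x hx
    rw [hx, Pi.smul_apply, map_smul, smul_eq_mul]
  refine ⟨(a1.const_mul c).congr h1.symm, (a2.const_mul c).congr h2.symm, ?_⟩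
  rw [integral_congr_ae h1, integral_congr_ae h2, integral_const_mul, integral_const_mul, a3]
  ring

theorem HasWeakDiv.zero : HasWeakDiv (0 : L2Vec Ω) (0 : L2 Ω) := by
  have t : IsTangential (0 : L2Vec Ω) := by
    filter_upwards [Lp.coeFn_zero (Euc n) 2 (area Ω)] with x hx
    rw [hx]
    exact Submodule.zero_mem _
  refine ⟨t, fun φ _ => ?_⟩
  have h1 : (fun x => (0 : L2 Ω) x * φ x) =ᵐ[area Ω] fun _ => 0 := by
    filter_upwards [Lp.coeFn_zero ℝ 2 (area Ω)] with x hx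
    rw [hx, Pi.zero_apply, zero_mul]
  have h2 : (fun x => fderiv ℝ φ x ((0 : L2Vec Ω) x)) =ᵐ[area Ω] fun _ => 0 := by
    filter_upwards [Lp.coeFn_zero (Euc n) 2 (area Ω)] with x hx
    rw [hx, Pi.zero_apply, map_zero]
  refine ⟨(integrable_zero _ _ _).congr h1.symm, (integrable_zero _ _ _).congr h2.symm, ?_⟩
  rw [integral_congr_ae h1, integral_congr_ae h2]
  simp

theorem HasWeakGrad.add {ψ χ : L2 Ω} {w z : L2Vec Ω} (hψ : HasWeakGrad ψ w)
    (hχ : HasWeakGrad χ z) : HasWeakGrad (ψ + χ) (w + z) := by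
  refine ⟨hψ.1.add hχ.1, fun X hX hT => ?_⟩
  obtain ⟨a1, a2, a3⟩ := hψ.2 X hX hT
  obtain ⟨b1, b2, b3⟩ := hχ.2 X hX hT
  have h1 : (fun x => (ψ + χ : L2 Ω) x * surfaceDiv Ω X x) =ᵐ[area Ω]
      fun x => ψ x * surfaceDiv Ω X x + χ x * surfaceDiv Ω X x := by
    filter_upwards [Lp.coeFn_add ψ χ] with x hx
    rw [hx, Pi.add_apply, add_mul]
  have h2 : (fun x => inner ℝ ((w + z : L2Vec Ω) x) (X x)) =ᵐ[area Ω]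
      fun x => inner ℝ (w x) (X x) + inner ℝ (z x) (X x) := by
    filter_upwards [Lp.coeFn_add w z] with x hx
    rw [hx, Pi.add_apply, inner_add_left]
  refine ⟨(a1.add b1).congr h1.symm, (a2.add b2).congr h2.symm, ?_⟩
  rw [integral_congr_ae h1, integral_congr_ae h2, integral_add a1 b1, integral_add a2 b2, a3, b3]
  ring

theorem HasWeakGrad.smul {ψ : L2 Ω} {w : L2Vec Ω} (c : ℝ) (hψ : HasWeakGrad ψ w) :
    HasWeakGrad (c • ψ) (c • w) := by
  refine ⟨hψ.1.smul c, fun X hX hT => ?_⟩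
  obtain ⟨a1, a2, a3⟩ := hψ.2 X hX hT
  have h1 : (fun x => (c • ψ : L2 Ω) x * surfaceDiv Ω X x) =ᵐ[area Ω]
      fun x => c * (ψ x * surfaceDiv Ω X x) := by
    filter_upwards [Lp.coeFn_smul c ψ] with x hx
    rw [hx, Pi.smul_apply, smul_eq_mul, mul_assoc]
  have h2 : (fun x => inner ℝ ((c • w : L2Vec Ω) x) (X x)) =ᵐ[area Ω]
      fun x => c * inner ℝ (w x) (X x) := by
    filter_upwards [Lp.coeFn_smul c w] with x hx
    rw [hx, Pi.smul_apply, real_inner_smul_left]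
  refine ⟨(a1.const_mul c).congr h1.symm, (a2.const_mul c).congr h2.symm, ?_⟩
  rw [integral_congr_ae h1, integral_congr_ae h2, integral_const_mul, integral_const_mul, a3]
  ring

theorem HasWeakGrad.zero : HasWeakGrad (0 : L2 Ω) (0 : L2Vec Ω) := by
  refine ⟨HasWeakDiv.zero.1, fun X _ _ => ?_⟩
  have h1 : (fun x => (0 : L2 Ω) x * surfaceDiv Ω X x) =ᵐ[area Ω] fun _ => 0 := by
    filter_upwards [Lp.coeFn_zero ℝ 2 (area Ω)] with x hx
    rw [hx, Pi.zero_apply, zero_mul]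
  have h2 : (fun x => inner ℝ ((0 : L2Vec Ω) x) (X x)) =ᵐ[area Ω] fun _ => (0 : ℝ) := by
    filter_upwards [Lp.coeFn_zero (Euc n) 2 (area Ω)] with x hx
    rw [hx, Pi.zero_apply, inner_zero_left]
  refine ⟨(integrable_zero _ _ _).congr h1.symm, (integrable_zero _ _ _).congr h2.symm, ?_⟩
  rw [integral_congr_ae h1, integral_congr_ae h2]
  simp

theorem HasCurl.add {J : Euc n → Euc n →L[ℝ] Euc n} {ψ χ : L2 Ω} {u v : L2Vec Ω}
    (hu : HasCurl J ψ u) (hv : HasCurl J χ v) : HasCurl J (ψ + χ) (u + v) := by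
  obtain ⟨w, hw, hw'⟩ := hu
  obtain ⟨z, hz, hz'⟩ := hv
  refine ⟨w + z, hw.add hz, ?_⟩
  filter_upwards [hw', hz', Lp.coeFn_add u v, Lp.coeFn_add w z] with x h1 h2 h3 h4
  rw [h3, h4, Pi.add_apply, Pi.add_apply, map_add, h1, h2]

theorem HasCurl.smul {J : Euc n → Euc n →L[ℝ] Euc n} {ψ : L2 Ω} {u : L2Vec Ω} (c : ℝ)
    (hu : HasCurl J ψ u) : HasCurl J (c • ψ) (c • u) := by
  obtain ⟨w, hw, hw'⟩ := hu
  refine ⟨c • w, hw.smul c, ?_⟩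
  filter_upwards [hw', Lp.coeFn_smul c u, Lp.coeFn_smul c w] with x h1 h3 h4
  rw [h3, h4, Pi.smul_apply, Pi.smul_apply, map_smul, h1]

theorem HasCurl.zero {J : Euc n → Euc n →L[ℝ] Euc n} : HasCurl J (0 : L2 Ω) (0 : L2Vec Ω) := by
  refine ⟨0, HasWeakGrad.zero, ?_⟩
  filter_upwards [Lp.coeFn_zero (Euc n) 2 (area Ω)] with x hx
  rw [hx, Pi.zero_apply, map_zero]

/-! The function spaces. -/

/-- `H¹(Ω)`. -/
def H1 (Ω : Set (Euc n)) : Submodule ℝ (L2 Ω) where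
  carrier := {ψ | ∃ w, HasWeakGrad ψ w}
  add_mem' := fun ⟨w, hw⟩ ⟨z, hz⟩ => ⟨w + z, hw.add hz⟩
  zero_mem' := ⟨0, HasWeakGrad.zero⟩
  smul_mem' := fun c _ ⟨w, hw⟩ => ⟨c • w, hw.smul c⟩

/-- `H(div, Ω)`. -/
def Hdiv (Ω : Set (Euc n)) : Submodule ℝ (L2Vec Ω) where
  carrier := {u | ∃ d, HasWeakDiv u d}
  add_mem' := fun ⟨d, hd⟩ ⟨e, he⟩ => ⟨d + e, hd.add he⟩
  zero_mem' := ⟨0, HasWeakDiv.zero⟩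
  smul_mem' := fun c _ ⟨d, hd⟩ => ⟨c • d, hd.smul c⟩

/-- The `H(div)` norm of a field `u` with divergence `d`. -/
noncomputable def hdivNorm (u : L2Vec Ω) (d : L2 Ω) : ℝ := √(‖u‖ ^ 2 + ‖d‖ ^ 2)

/-- The space of harmonic velocity fields: `u ∈ H(div)` with `∇·u = 0` and `∫ u · ∇^⊥ψ = 0` for all
`ψ ∈ H¹`. -/
def harmonicFields (Ω : Set (Euc n)) (J : Euc n → Euc n →L[ℝ] Euc n) : Submodule ℝ (L2Vec Ω) where
  carrier := {u | HasWeakDiv u 0 ∧ ∀ ψ ∈ H1 Ω, ∀ c, HasCurl J ψ c → inner ℝ u c = 0}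
  add_mem' := fun {u v} ⟨hu, hu'⟩ ⟨hv, hv'⟩ =>
    ⟨by simpa using hu.add hv, fun ψ hψ c hc => by
      rw [inner_add_left, hu' ψ hψ c hc, hv' ψ hψ c hc, add_zero]⟩
  zero_mem' := ⟨HasWeakDiv.zero, fun _ _ _ _ => inner_zero_left _⟩
  smul_mem' := fun c u ⟨hu, hu'⟩ =>
    ⟨by simpa using hu.smul c, fun ψ hψ z hz => by
      rw [real_inner_smul_left, hu' ψ hψ z hz, mul_zero]⟩

/-- The space `H^h` of discrete harmonic velocity fields. -/
def discreteHarmonic (J : Euc n → Euc n →L[ℝ] Euc n) (E : Submodule ℝ (L2 Ω))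
    (S : Submodule ℝ (L2Vec Ω)) : Submodule ℝ (L2Vec Ω) where
  carrier := {u | u ∈ S ∧ HasWeakDiv u 0 ∧ ∀ ψ ∈ E, ∀ c, HasCurl J ψ c → inner ℝ u c = 0}
  add_mem' := fun {u v} ⟨su, hu, hu'⟩ ⟨sv, hv, hv'⟩ =>
    ⟨S.add_mem su sv, by simpa using hu.add hv, fun ψ hψ c hc => by
      rw [inner_add_left, hu' ψ hψ c hc, hv' ψ hψ c hc, add_zero]⟩
  zero_mem' := ⟨S.zero_mem, HasWeakDiv.zero, fun _ _ _ _ => inner_zero_left _⟩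
  smul_mem' := fun c u ⟨su, hu, hu'⟩ =>
    ⟨S.smul_mem c su, by simpa using hu.smul c, fun ψ hψ z hz => by
      rw [real_inner_smul_left, hu' ψ hψ z hz, mul_zero]⟩

/-- `w = D φ`, the discrete gradient of `φ`: `w ∈ S` and `∫ v · w = - ∫ (∇·v) φ` for all
`v ∈ S`. -/
def IsDiscreteGrad (S : Submodule ℝ (L2Vec Ω)) (φ : L2 Ω) (w : L2Vec Ω) : Prop :=
  w ∈ S ∧ ∀ v ∈ S, ∀ d, HasWeakDiv v d → inner ℝ v w = -(inner ℝ d φ : ℝ)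

/-- `∇^⊥ E`. -/
def curlImage (J : Euc n → Euc n →L[ℝ] Euc n) (E : Submodule ℝ (L2 Ω)) :
    Submodule ℝ (L2Vec Ω) where
  carrier := {u | ∃ ψ ∈ E, HasCurl J ψ u}
  add_mem' := fun ⟨ψ, hψ, h⟩ ⟨χ, hχ, k⟩ => ⟨ψ + χ, E.add_mem hψ hχ, h.add k⟩
  zero_mem' := ⟨0, E.zero_mem, HasCurl.zero⟩
  smul_mem' := fun c _ ⟨ψ, hψ, h⟩ => ⟨c • ψ, E.smul_mem c hψ, h.smul c⟩

/-- `D(V)`. -/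
def gradImage (S : Submodule ℝ (L2Vec Ω)) (V : Submodule ℝ (L2 Ω)) :
    Submodule ℝ (L2Vec Ω) where
  carrier := {w | ∃ φ ∈ V, IsDiscreteGrad S φ w}
  add_mem' := fun {w z} ⟨φ, hφ, hw, h⟩ ⟨χ, hχ, hz, k⟩ =>
    ⟨φ + χ, V.add_mem hφ hχ, S.add_mem hw hz, fun v hv d hd => by
      rw [inner_add_right, inner_add_right, h v hv d hd, k v hv d hd]; ring⟩
  zero_mem' := ⟨0, V.zero_mem, S.zero_mem, fun v _ d _ => by
    rw [inner_zero_right, inner_zero_right, neg_zero]⟩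
  smul_mem' := fun c w ⟨φ, hφ, hw, h⟩ =>
    ⟨c • φ, V.smul_mem c hφ, S.smul_mem c hw, fun v hv d hd => by
      rw [real_inner_smul_right, real_inner_smul_right, h v hv d hd]; ring⟩

/-- The inf-sup condition for `(S, V)`, on the functions of `V` with zero mean. -/
def InfSup (S : Submodule ℝ (L2Vec Ω)) (V : Submodule ℝ (L2 Ω)) : Prop :=
  ∃ γ : ℝ, 0 < γ ∧ ∀ φ ∈ V, φ ≠ 0 → ∫ x, φ x ∂area Ω = 0 →
    ∃ v ∈ S, v ≠ 0 ∧ ∃ d, HasWeakDiv v d ∧ γ * ‖φ‖ * hdivNorm v d ≤ ∫ x, φ x * d x ∂area Ω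

/-- Finite dimensional spaces `E ⊆ H¹`, `S ⊆ H(div)`, `V ⊆ L²` with the embedding properties
`∇^⊥ E ⊆ S` and `∇·S ⊆ V`, where `E` and `V` contain the constants, satisfying the inf-sup
condition. -/
structure IsCompatible (J : Euc n → Euc n →L[ℝ] Euc n) (E : Submodule ℝ (L2 Ω))
    (S : Submodule ℝ (L2Vec Ω)) (V : Submodule ℝ (L2 Ω)) : Prop where
  finite_E : FiniteDimensional ℝ E
  finite_S : FiniteDimensional ℝ S
  finite_V : FiniteDimensional ℝ V
  E_le : E ≤ H1 Ω
  S_le : S ≤ Hdiv Ω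
  curl_mem : ∀ ψ ∈ E, ∀ u, HasCurl J ψ u → u ∈ S
  div_mem : ∀ u ∈ S, ∀ d, HasWeakDiv u d → d ∈ V
  const_mem_E : ∀ f, IsConst f → f ∈ E
  const_mem_V : ∀ f, IsConst f → f ∈ V
  infSup : InfSup S V

/-- Suitable projections onto `E`, `S`, `V`: linear projections `PE`, `PS`, `PV` of `H¹`, `H(div)`,
`L²` for which the diagram with rows `H¹ → H(div) → L²` and `E → S → V` (arrows `∇^⊥` and `∇·`)
commutes, with `PS` bounded on `H(div)` and approximating every nonzero harmonic field with a
relative error less than one. -/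
def HasSuitableProjections (J : Euc n → Euc n →L[ℝ] Euc n) (E : Submodule ℝ (L2 Ω))
    (S : Submodule ℝ (L2Vec Ω)) (V : Submodule ℝ (L2 Ω)) : Prop :=
  ∃ (PE : H1 Ω →ₗ[ℝ] L2 Ω) (PS : Hdiv Ω →ₗ[ℝ] L2Vec Ω) (PV : L2 Ω →ₗ[ℝ] L2 Ω),
    ((∀ ψ, PE ψ ∈ E) ∧ ∀ ψ : H1 Ω, (ψ : L2 Ω) ∈ E → PE ψ = ψ) ∧
    ((∀ u, PS u ∈ S) ∧ ∀ u : Hdiv Ω, (u : L2Vec Ω) ∈ S → PS u = u) ∧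
    ((∀ φ, PV φ ∈ V) ∧ ∀ φ ∈ V, PV φ = φ) ∧
    (∀ (ψ : H1 Ω) (u : Hdiv Ω), HasCurl J (ψ : L2 Ω) (u : L2Vec Ω) → HasCurl J (PE ψ) (PS u)) ∧
    (∀ (u : Hdiv Ω) (d : L2 Ω), HasWeakDiv (u : L2Vec Ω) d → HasWeakDiv (PS u) (PV d)) ∧
    (∃ C : ℝ, ∀ (u : Hdiv Ω) (d d' : L2 Ω), HasWeakDiv (u : L2Vec Ω) d → HasWeakDiv (PS u) d' →
      hdivNorm (PS u) d' ≤ C * hdivNorm (u : L2Vec Ω) d) ∧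
    ∀ q : Hdiv Ω, (q : L2Vec Ω) ∈ harmonicFields Ω J → q ≠ 0 →
      ‖(q : L2Vec Ω) - PS q‖ < ‖(q : L2Vec Ω)‖

end Surfaces

/-- The doubly periodic plane: the flat torus `[0, 2πr] × [0, 2πs]` with opposite sides identified,
realized isometrically as a product of circles in `ℝ⁴`. -/
def flatTorus (r s : ℝ) : Set (Euc 4) :=
  {x | x 0 ^ 2 + x 1 ^ 2 = r ^ 2 ∧ x 2 ^ 2 + x 3 ^ 2 = s ^ 2}

/-- The constant velocity field with components `(a, b)` on the doubly periodic plane: `a` times the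
unit tangent field of the first circle plus `b` times the unit tangent field of the second. -/
noncomputable def constantField (r s a b : ℝ) (x : Euc 4) : Euc 4 :=
  !₂[-(a / r) * x 1, (a / r) * x 0, -(b / s) * x 3, (b / s) * x 2]

end MixedFE

open MixedFE
open Module (finrank)

/-!
The statement is a Hodge decomposition, discrete and continuous, and a comparison of the two.

*Calculus on the surface.* Around every point there is a chart with a smooth retraction of the
ambient space (`IsClosedSurface.exists_chart`). In it Hausdorff measure becomes `√(EG - F²) dy`
(`IsChart.map_p_eq`) and the surface divergence takes its classical form
`ρ ∇·X = ∂₁(ρ ξ¹) + ∂₂(ρ ξ²)` (`IsChart.areaDensity_mul_surfaceDiv`). A partition of unity then gives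
the divergence theorem (`IsClosedSurface.integral_surfaceDiv`). Testing against fields with
prescribed coordinates in a chart shows that weak gradients are unique and that a function with weak
gradient zero is locally, hence by connectedness globally, constant
(`IsClosedSurface.isConst_of_hasWeakGrad_zero`). The symmetry of second derivatives makes rotated
gradients of smooth functions divergence-free, and therefore, weakly, all curls
(`IsClosedSurface.hasWeakDiv_zero_of_hasCurl`).

*The discrete decomposition.* The discrete gradient is minus the adjoint of `∇· : S → V`, so
`D(V)` is the orthogonal complement in `S` of the divergence-free part of `S`. The latter contains
`∇^⊥ E`, and the orthogonal complement of `∇^⊥ E` in it is `H^h` by definition. The kernel of `∇^⊥` is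
the constants by the above, that of `D` by the inf-sup condition; this gives the dimension count
(`finrank_eq_discrete`).

*Comparison of `H^h` and `H`.* Two injective linear maps show that the dimensions agree
(`finrank_harmonicFields`). One sends `q ∈ H` to the `H^h` part of `Π^S q`: if that part vanishes then
`Π^S q` is a curl, hence orthogonal to `q`, and `‖q - Π^S q‖ < ‖q‖` forces `q = 0`. The other takes
the part of `u ∈ H^h` orthogonal to the closure of all curls: if it vanishes then `u` is a limit of
curls, so `u = Π^S u` is a limit of discrete curls by the boundedness of `Π^S`, hence itself a
discrete curl, hence `0`.

*Torus and sphere.* Fields which together with their rotation are weakly divergence-free are to be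
determined (`IsClosedSurface.integral_fderiv_harmonic`). Both surfaces carry Killing fields `K_j`,
restrictions of generators of rotations of the ambient space, which span the tangent planes. For
`Δ = ∑ K_j²` Weyl's lemma has an elementary proof
(`IsClosedSurface.isConst_of_weakly_harmonic`): `Δ` preserves the finite-dimensional space of
polynomials of degree at most `m`, so the energy identity can be applied to the projection of a
weakly harmonic function to that space, and polynomials are dense. On the torus the components of a
harmonic field with respect to the two commuting Killing fields are weakly harmonic, which leaves the
constant fields. On the sphere the Cartesian components of the rotated field are weakly harmonic
(`mul_laplacian_eq`), so that field is a constant vector, tangential everywhere only if it is `0`.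
-/

namespace MixedFE

open Set Filter Topology Metric

variable {n : ℕ} {Ω : Set (Euc n)}

/-! ### Charts -/

/-- Derivatives within `Ω` are determined on the tangent plane. -/
theorem _root_.HasFDerivWithinAt.eq_of_mem_tangentPlane {F : Type*} [NormedAddCommGroup F]
    [NormedSpace ℝ F] {f : Euc n → F} {f' f₁' : Euc n →L[ℝ] F} {x v : Euc n}
    (h : HasFDerivWithinAt f f' Ω x) (h₁ : HasFDerivWithinAt f f₁' Ω x)
    (hv : v ∈ tangentPlane Ω x) : f' v = f₁' v :=
  LinearMap.eqOn_span (f := (f' : Euc n →ₗ[ℝ] F)) (g := (f₁' : Euc n →ₗ[ℝ] F))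
    (h.unique_on h₁) hv

/-- A local chart of `Ω` together with a smooth retraction: `p` parametrizes `Ω ∩ W` over the convex
bounded open set `U`, and `g` is a smooth map on the open set `W` of the ambient space which is
inverse to `p` on `Ω ∩ W`. Convexity of `U` is a convenient form of connectedness; boundedness and
the Lipschitz condition make the area of `Ω ∩ W` finite. -/
structure IsChart (Ω W : Set (Euc n)) (U : Set (Euc 2)) (p : Euc 2 → Euc n) (g : Euc n → Euc 2) :
    Prop where
  isOpen_W : IsOpen W
  isOpen_U : IsOpen U
  convex_U : Convex ℝ U
  bounded_U : Bornology.IsBounded U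
  contDiffOn_p : ContDiffOn ℝ ∞ p U
  contDiffOn_g : ContDiffOn ℝ ∞ g W
  p_mem : ∀ y ∈ U, p y ∈ Ω
  p_mem_W : ∀ y ∈ U, p y ∈ W
  g_mem : ∀ z ∈ W, g z ∈ U
  g_p : ∀ y ∈ U, g (p y) = y
  p_g : ∀ z ∈ Ω, z ∈ W → p (g z) = z
  lipschitz : ∃ K, LipschitzOnWith K p U

/-- The retraction is the local inverse of `ℓ ∘ p` composed with `ℓ`, for a linear left inverse `ℓ`
of the derivative of the parametrization `p`. -/
theorem IsClosedSurface.exists_chart (hΩ : IsClosedSurface Ω) {x : Euc n} (hx : x ∈ Ω) :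
    ∃ W U p g, IsChart Ω W U p g ∧ x ∈ W := by
  obtain ⟨U₀, p, hp, y₀, hy₀, rfl⟩ := hΩ.exists_patch x hx
  have hpA : ∀ y ∈ U₀, ContDiffAt ℝ ∞ p y := fun y hy =>
    hp.smooth.contDiffAt (hp.isOpen.mem_nhds hy)
  obtain ⟨l₀, hl₀⟩ := LinearMap.exists_leftInverse_of_injective
    (fderiv ℝ p y₀ : Euc 2 →ₗ[ℝ] Euc n) (LinearMap.ker_eq_bot.2 (hp.immersion y₀ hy₀))
  set l : Euc n →L[ℝ] Euc 2 := LinearMap.toContinuousLinearMap l₀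
  set h : Euc 2 → Euc 2 := fun y => l (p y) with hh
  have hhA : ∀ y ∈ U₀, ContDiffAt ℝ ∞ h y := fun y hy =>
    l.contDiff.contDiffAt.comp y (hpA y hy)
  have hder : HasStrictFDerivAt h ((ContinuousLinearEquiv.refl ℝ (Euc 2) : Euc 2 →L[ℝ] Euc 2)) y₀ := by
    have h1 := l.hasStrictFDerivAt.comp y₀ ((hpA y₀ hy₀).hasStrictFDerivAt (by simp))
    have h2 : (ContinuousLinearEquiv.refl ℝ (Euc 2) : Euc 2 →L[ℝ] Euc 2) = l ∘L fderiv ℝ p y₀ :=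
      ContinuousLinearMap.ext fun v => (LinearMap.congr_fun hl₀ v).symm
    rw [h2]
    exact h1
  -- `e` is the local diffeomorphism `ℓ ∘ p` of the plane.
  set e := hder.toOpenPartialHomeomorph h with he
  have hev : ∀ y, e y = h y := fun y => rfl
  have hsrc : y₀ ∈ e.source := hder.mem_toOpenPartialHomeomorph_source
  have hcont : ContinuousAt (fderiv ℝ h) y₀ :=
    ((hhA y₀ hy₀).fderiv_right (m := 0) (by simp)).continuousAt
  have hequiv : ∀ᶠ y in 𝓝 y₀, fderiv ℝ h y ∈
      range (ContinuousLinearEquiv.toContinuousLinearMap : (Euc 2 ≃L[ℝ] Euc 2) → _) := by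
    apply hcont
    rw [hder.hasFDerivAt.fderiv]
    exact ContinuousLinearEquiv.nhds _
  obtain ⟨K, t, ht, hK⟩ := ((hpA y₀ hy₀).of_le (by simp)).exists_lipschitzOnWith
  obtain ⟨r, hr, hball⟩ := Metric.mem_nhds_iff.1 (inter_mem (inter_mem (hp.isOpen.mem_nhds hy₀)
    (e.open_source.mem_nhds hsrc)) (inter_mem hequiv ht))
  have hU₀ : ball y₀ r ⊆ U₀ := fun y hy => (hball hy).1.1
  have hS : ball y₀ r ⊆ e.source := fun y hy => (hball hy).1.2
  obtain ⟨W₀, hW₀, hW₀'⟩ := hp.relOpen (ball y₀ r) hU₀ isOpen_ball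
  have hN : IsOpen (e '' ball y₀ r) := e.isOpen_image_of_subset_source isOpen_ball hS
  have key : ∀ z ∈ Ω, z ∈ W₀ ∩ l ⁻¹' (e '' ball y₀ r) → ∃ y ∈ ball y₀ r, p y = z := by
    intro z hz hz'
    have : z ∈ p '' ball y₀ r := by rw [hW₀']; exact ⟨hz, hz'.1⟩
    exact this
  have hgp : ∀ y ∈ ball y₀ r, e.symm (l (p y)) = y := fun y hy => e.left_inv (hS hy)
  refine ⟨W₀ ∩ l ⁻¹' (e '' ball y₀ r), ball y₀ r, p, fun z => e.symm (l z),
    ⟨hW₀.inter (hN.preimage l.continuous), isOpen_ball, convex_ball _ _, isBounded_ball,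
      hp.smooth.mono hU₀, ?_, ?_, ?_, ?_, hgp, ?_, ⟨K, hK.mono fun y hy => (hball hy).2.2⟩⟩, ?_⟩
  · rintro z ⟨-, y, hy, hyz⟩
    obtain ⟨f', hf'⟩ := (hball hy).2.1
    have h1 : e.symm (l z) = y := by rw [← hyz]; exact e.left_inv (hS hy)
    have hd : HasFDerivAt h (f' : Euc 2 →L[ℝ] Euc 2) y := by
      rw [hf']
      exact ((hhA y (hU₀ hy)).differentiableAt (by simp)).hasFDerivAt
    have h2 : ContDiffAt ℝ ∞ e.symm (l z) := by
      apply e.contDiffAt_symm (f₀' := f')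
      · rw [← hyz]; exact e.map_source (hS hy)
      · rw [h1]; exact hd
      · rw [h1]; exact hhA y (hU₀ hy)
    exact (h2.comp z l.contDiff.contDiffAt).contDiffWithinAt
  · intro y hy
    have : p y ∈ Ω ∩ W₀ := hW₀' ▸ mem_image_of_mem p hy
    exact this.1
  · intro y hy
    have : p y ∈ Ω ∩ W₀ := hW₀' ▸ mem_image_of_mem p hy
    exact ⟨this.2, y, hy, rfl⟩
  · rintro z ⟨-, y, hy, hyz⟩
    rw [← hyz, e.left_inv (hS hy)]; exact hy
  · intro z hz hz'
    obtain ⟨y, hy, rfl⟩ := key z hz hz'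
    rw [hgp y hy]
  · have : p y₀ ∈ Ω ∩ W₀ := hW₀' ▸ mem_image_of_mem p (mem_ball_self hr)
    exact ⟨this.2, y₀, mem_ball_self hr, rfl⟩

namespace IsChart

variable {W : Set (Euc n)} {U : Set (Euc 2)} {p : Euc 2 → Euc n} {g : Euc n → Euc 2}

theorem contDiffAt_p (h : IsChart Ω W U p g) {y : Euc 2} (hy : y ∈ U) : ContDiffAt ℝ ∞ p y :=
  h.contDiffOn_p.contDiffAt (h.isOpen_U.mem_nhds hy)

theorem contDiffAt_g (h : IsChart Ω W U p g) {z : Euc n} (hz : z ∈ W) : ContDiffAt ℝ ∞ g z :=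
  h.contDiffOn_g.contDiffAt (h.isOpen_W.mem_nhds hz)

theorem hasFDerivAt_p (h : IsChart Ω W U p g) {y : Euc 2} (hy : y ∈ U) :
    HasFDerivAt p (fderiv ℝ p y) y :=
  ((h.contDiffAt_p hy).differentiableAt (by simp)).hasFDerivAt

theorem hasFDerivAt_g (h : IsChart Ω W U p g) {z : Euc n} (hz : z ∈ W) :
    HasFDerivAt g (fderiv ℝ g z) z :=
  ((h.contDiffAt_g hz).differentiableAt (by simp)).hasFDerivAt

theorem fderiv_g_fderiv_p (h : IsChart Ω W U p g) {y : Euc 2} (hy : y ∈ U) (v : Euc 2) :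
    fderiv ℝ g (p y) (fderiv ℝ p y v) = v := by
  have h1 := (h.hasFDerivAt_g (h.p_mem_W y hy)).comp y (h.hasFDerivAt_p hy)
  have h2 : HasFDerivAt (g ∘ p) (ContinuousLinearMap.id ℝ (Euc 2)) y :=
    (hasFDerivAt_id y).congr_of_eventuallyEq <|
      (h.isOpen_U.eventually_mem hy).mono fun y' hy' => h.g_p y' hy'
  exact congrArg (fun L : Euc 2 →L[ℝ] Euc 2 => L v) (h1.unique h2)

theorem injective_fderiv_p (h : IsChart Ω W U p g) {y : Euc 2} (hy : y ∈ U) :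
    Function.Injective (fderiv ℝ p y) :=
  Function.LeftInverse.injective (g := fderiv ℝ g (p y)) (h.fderiv_g_fderiv_p hy)

theorem tangentPlane_eq (h : IsChart Ω W U p g) {y : Euc 2} (hy : y ∈ U) :
    tangentPlane Ω (p y) = LinearMap.range (fderiv ℝ p y : Euc 2 →ₗ[ℝ] Euc n) := by
  apply le_antisymm
  · refine Submodule.span_le.2 fun v hv => ?_
    have hpg : HasFDerivAt p (fderiv ℝ p y) (g (p y)) := by
      rw [h.g_p y hy]; exact h.hasFDerivAt_p hy
    -- `p ∘ g` agrees with the identity on `Ω` near `p y`.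
    have h1 := (hpg.comp (p y) (h.hasFDerivAt_g (h.p_mem_W y hy))).hasFDerivWithinAt (s := Ω)
    have h2 : HasFDerivWithinAt (p ∘ g) (ContinuousLinearMap.id ℝ (Euc n)) Ω (p y) :=
      (hasFDerivWithinAt_id _ _).congr_of_eventuallyEq
        (by filter_upwards [self_mem_nhdsWithin, mem_nhdsWithin_of_mem_nhds
              (h.isOpen_W.mem_nhds (h.p_mem_W y hy))] with z hz hz' using h.p_g z hz hz')
        (h.p_g _ (h.p_mem y hy) (h.p_mem_W y hy))
    exact ⟨fderiv ℝ g (p y) v, h1.eq_of_mem_tangentPlane h2 (Submodule.subset_span hv)⟩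
  · rintro _ ⟨v, rfl⟩
    refine Submodule.subset_span ?_
    have h1 := (h.hasFDerivAt_p hy).hasFDerivWithinAt (s := U)
    have h2 : v ∈ tangentConeAt ℝ U y := by
      rw [tangentConeAt_of_mem_nhds (h.isOpen_U.mem_nhds hy)]; trivial
    refine tangentConeAt_mono ?_ (h1.mapsTo_tangent_cone h2)
    rintro _ ⟨z, hz, rfl⟩
    exact h.p_mem z hz

end IsChart

/-! ### The area formula -/

/-- The `i`-th partial derivative of a map on the plane. -/
noncomputable def pd {F : Type*} [NormedAddCommGroup F] [NormedSpace ℝ F] (i : Fin 2)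
    (f : Euc 2 → F) (y : Euc 2) : F :=
  fderiv ℝ f y (EuclideanSpace.single i 1)

/-- The Gram determinant of two vectors. -/
noncomputable def gramDet (a b : Euc n) : ℝ :=
  inner ℝ a a * inner ℝ b b - inner ℝ a b ^ 2

/-- The area density `√(EG - F²)` of a parametrized surface. -/
noncomputable def areaDensity (p : Euc 2 → Euc n) (y : Euc 2) : ℝ :=
  √(gramDet (pd 0 p y) (pd 1 p y))

theorem normDet_eq_sqrt_gramDet (L : Euc 2 →ₗ[ℝ] Euc n) :
    L.normDet = √(gramDet (L (EuclideanSpace.single 0 1)) (L (EuclideanSpace.single 1 1))) := by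
  have h := L.normDet_sq_eq_det_gram (EuclideanSpace.basisFun (Fin 2) ℝ)
  have h2 : L.normDet ^ 2 =
      gramDet (L (EuclideanSpace.single 0 1)) (L (EuclideanSpace.single 1 1)) := by
    rw [show L.normDet ^ 2 = ((L.normDet ^ 2 : ℝ) : ℝ) from rfl]
    simp only [RCLike.ofReal_real_eq_id, id] at h
    rw [h, Matrix.det_fin_two]
    simp only [Matrix.gram_apply, EuclideanSpace.basisFun_apply, gramDet]
    rw [real_inner_comm (L (EuclideanSpace.single 0 1)) (L (EuclideanSpace.single 1 1))]
    ring
  rw [← h2, Real.sqrt_sq L.normDet_nonneg]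

theorem gramDet_pos {L : Euc 2 →ₗ[ℝ] Euc n} (hL : Function.Injective L) :
    0 < gramDet (L (EuclideanSpace.single 0 1)) (L (EuclideanSpace.single 1 1)) := by
  have h : L.normDet ≠ 0 := fun h0 =>
    (LinearMap.normDet_eq_zero_iff_ker_ne_bot.1 h0) (LinearMap.ker_eq_bot.2 hL)
  rw [normDet_eq_sqrt_gramDet] at h
  exact Real.sqrt_ne_zero'.1 h

/-- If distances under `p` are at most `C` times those under `q`, areas of images under `p` are at
most `C²` times those of images under `q`. -/
theorem euclideanHausdorffMeasure_image_le_of_dist_le {X Y Z : Type*} [MetricSpace Y]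
    [MeasurableSpace Y] [BorelSpace Y] [MetricSpace Z] [MeasurableSpace Z] [BorelSpace Z]
    [Nonempty X] {A : Set X} {p : X → Y} {q : X → Z} {C : NNReal}
    (h : ∀ a ∈ A, ∀ b ∈ A, dist (p a) (p b) ≤ C * dist (q a) (q b)) :
    Measure.euclideanHausdorffMeasure 2 (p '' A)
      ≤ (C : ℝ≥0∞) ^ 2 * Measure.euclideanHausdorffMeasure 2 (q '' A) := by
  -- On `A` the map `p` factors as a Lipschitz map after `q`.
  set f : Z → Y := fun z => p (Function.invFunOn q A z)
  have hmem : ∀ a ∈ A, Function.invFunOn q A (q a) ∈ A := fun a ha =>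
    Function.invFunOn_mem ⟨a, ha, rfl⟩
  have heq : ∀ a ∈ A, q (Function.invFunOn q A (q a)) = q a := fun a ha =>
    Function.invFunOn_eq ⟨a, ha, rfl⟩
  have hlip : LipschitzOnWith C f (q '' A) := by
    refine LipschitzOnWith.of_dist_le_mul ?_
    rintro _ ⟨a, ha, rfl⟩ _ ⟨b, hb, rfl⟩
    refine (h _ (hmem a ha) _ (hmem b hb)).trans ?_
    rw [heq a ha, heq b hb]
  have himg : p '' A = f '' (q '' A) := by
    rw [image_image]
    refine image_congr fun a ha => ?_
    have := h a ha _ (hmem a ha)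
    rw [heq a ha, dist_self, mul_zero] at this
    exact dist_le_zero.1 this
  rw [himg, Measure.euclideanHausdorffMeasure_def, Measure.euclideanHausdorffMeasure_def,
    Measure.smul_apply, Measure.smul_apply, mul_smul_comm]
  gcongr
  have := hlip.hausdorffMeasure_image_le (d := (2 : ℕ)) (by positivity)
  simpa using this

theorem euclideanHausdorffMeasure_two_linear_image (L : Euc 2 →ₗ[ℝ] Euc n) (s : Set (Euc 2)) :
    Measure.euclideanHausdorffMeasure 2 (L '' s) =
      ENNReal.ofReal (√(gramDet (L (EuclideanSpace.single 0 1)) (L (EuclideanSpace.single 1 1)))) *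
        volume s := by
  rw [← normDet_eq_sqrt_gramDet]
  have := L.euclideanHausdorffMeasure_image_eq_normDet_mul_volume s
  rwa [show finrank ℝ (Euc 2) = 2 by simp] at this

/-- Near a point of strict differentiability with injective derivative `L`, distances under `p` and
under `L` agree up to a factor close to one. -/
theorem eventually_dist_le_of_hasStrictFDerivAt {p : Euc 2 → Euc n} {L : Euc 2 →L[ℝ] Euc n}
    {y : Euc 2} (hp : HasStrictFDerivAt p L y) (hL : Function.Injective L) {δ : ℝ} (hδ : 0 < δ) :
    ∀ᶠ r in 𝓝[>] (0 : ℝ), ∀ a ∈ closedBall y r, ∀ b ∈ closedBall y r,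
      dist (p a) (p b) ≤ (1 + δ) * dist (L a) (L b) ∧
      (1 - δ) * dist (L a) (L b) ≤ dist (p a) (p b) := by
  obtain ⟨K, hK, hK'⟩ := LinearMap.exists_antilipschitzWith (L : Euc 2 →ₗ[ℝ] Euc n)
    (LinearMap.ker_eq_bot.2 hL)
  obtain ⟨s, hs, happ⟩ := hp.approximates_deriv_on_nhds (c := (δ / K).toNNReal)
    (Or.inr (by simpa using div_pos hδ (by exact_mod_cast hK)))
  obtain ⟨R, hR, hRs⟩ := Metric.nhds_basis_closedBall.mem_iff.1 hs
  filter_upwards [Ioc_mem_nhdsGT hR] with r hr a ha b hb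
  have h1 := happ a (hRs (closedBall_subset_closedBall hr.2 ha)) b
    (hRs (closedBall_subset_closedBall hr.2 hb))
  have hKr : (0 : ℝ) < K := by exact_mod_cast hK
  rw [Real.coe_toNNReal _ (by positivity)] at h1
  have h2 : ‖a - b‖ ≤ K * ‖L a - L b‖ := by
    have := hK'.le_mul_dist a b
    simpa [dist_eq_norm] using this
  rw [dist_eq_norm, dist_eq_norm]
  rw [map_sub] at h1
  have h3 : ‖p a - p b - (L a - L b)‖ ≤ δ * ‖L a - L b‖ := by
    refine h1.trans ?_
    calc δ / K * ‖a - b‖ ≤ δ / K * (K * ‖L a - L b‖) := by gcongr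
      _ = δ * ‖L a - L b‖ := by field_simp
  have h4 := norm_le_norm_add_norm_sub' (p a - p b) (L a - L b)
  have h5 := norm_le_norm_add_norm_sub (p a - p b) (L a - L b)
  constructor <;> linarith

namespace IsChart

variable {W : Set (Euc n)} {U : Set (Euc 2)} {p : Euc 2 → Euc n} {g : Euc n → Euc 2}

theorem areaDensity_pos (h : IsChart Ω W U p g) {y : Euc 2} (hy : y ∈ U) : 0 < areaDensity p y :=
  Real.sqrt_pos.2 (gramDet_pos (L := (fderiv ℝ p y : Euc 2 →ₗ[ℝ] Euc n)) (h.injective_fderiv_p hy))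

theorem preimage_inter_eq (h : IsChart Ω W U p g) (A : Set (Euc 2)) :
    g ⁻¹' A ∩ W ∩ Ω = p '' (A ∩ U) := by
  ext z
  constructor
  · rintro ⟨⟨hA, hW⟩, hΩ⟩
    exact ⟨g z, ⟨hA, h.g_mem z hW⟩, h.p_g z hΩ hW⟩
  · rintro ⟨y, ⟨hA, hU⟩, rfl⟩
    exact ⟨⟨by rwa [mem_preimage, h.g_p y hU], h.p_mem_W y hU⟩, h.p_mem y hU⟩

theorem aemeasurable_g (h : IsChart Ω W U p g) : AEMeasurable g ((area Ω).restrict W) :=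
  h.contDiffOn_g.continuousOn.aemeasurable h.isOpen_W.measurableSet

theorem map_g_apply (h : IsChart Ω W U p g) (hΩ : MeasurableSet Ω) {A : Set (Euc 2)}
    (hA : MeasurableSet A) : ((area Ω).restrict W).map g A =
      Measure.euclideanHausdorffMeasure 2 (p '' (A ∩ U)) := by
  rw [Measure.map_apply_of_aemeasurable h.aemeasurable_g hA,
    Measure.restrict_apply' h.isOpen_W.measurableSet, area, Measure.restrict_apply' hΩ,
    h.preimage_inter_eq]

theorem exists_image_le (h : IsChart Ω W U p g) : ∃ K : NNReal, ∀ A ⊆ U,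
    Measure.euclideanHausdorffMeasure 2 (p '' A) ≤ (K : ℝ≥0∞) ^ 2 * volume A := by
  obtain ⟨K, hK⟩ := h.lipschitz
  refine ⟨K, fun A hA => ?_⟩
  have := euclideanHausdorffMeasure_image_le_of_dist_le (p := p) (q := id) (A := A) (C := K)
    fun a ha b hb => hK.dist_le_mul a (hA ha) b (hA hb)
  rwa [image_id, EuclideanSpace.euclideanHausdorffMeasure_eq_volume] at this

theorem area_lt_top (h : IsChart Ω W U p g) (hΩ : MeasurableSet Ω) : area Ω W < ⊤ := by
  obtain ⟨K, hK⟩ := h.exists_image_le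
  rw [area, Measure.restrict_apply' hΩ]
  have h1 := h.preimage_inter_eq univ
  rw [preimage_univ, univ_inter, univ_inter] at h1
  rw [h1]
  exact (hK U subset_rfl).trans_lt (ENNReal.mul_lt_top (ENNReal.pow_lt_top ENNReal.coe_lt_top) h.bounded_U.measure_lt_top)

/-- The push-forward of the area measure to the parameter domain has density `ρ`: its Radon–Nikodym
derivative is almost everywhere a limit of ratios on small balls, where `p` is close to its
derivative. -/
theorem map_g_eq (h : IsChart Ω W U p g) (hΩ : MeasurableSet Ω) :
    ((area Ω).restrict W).map g =
      (volume.restrict U).withDensity fun y => ENNReal.ofReal (areaDensity p y) := by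
  set ν := ((area Ω).restrict W).map g with hν
  obtain ⟨K, hK⟩ := h.exists_image_le
  have hfin : IsFiniteMeasure ν := by
    have : IsFiniteMeasure ((area Ω).restrict W) := ⟨by simpa using h.area_lt_top hΩ⟩
    infer_instance
  have hac : ν ≪ volume := by
    refine Measure.AbsolutelyContinuous.mk fun A hA h0 => ?_
    rw [hν, h.map_g_apply hΩ hA]
    refine le_antisymm ((hK _ inter_subset_right).trans ?_) zero_le
    rw [measure_mono_null inter_subset_left h0, mul_zero]
  have hU : ν.restrict U = ν := by
    refine Measure.restrict_eq_self_of_ae_mem ?_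
    rw [ae_iff]
    change ν Uᶜ = 0
    rw [hν, h.map_g_apply hΩ h.isOpen_U.measurableSet.compl]
    simp
  have hd : ∀ᵐ y ∂(volume.restrict U), ν.rnDeriv volume y = ENNReal.ofReal (areaDensity p y) := by
    rw [ae_restrict_iff' h.isOpen_U.measurableSet]
    filter_upwards [Besicovitch.ae_tendsto_rnDeriv ν volume] with y hy hyU
    have hst : HasStrictFDerivAt p (fderiv ℝ p y) y :=
      (h.contDiffAt_p hyU).hasStrictFDerivAt (by simp)
    have hsub : ∀ᶠ r in 𝓝[>] (0 : ℝ), closedBall y r ⊆ U := by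
      obtain ⟨R, hR, hRU⟩ := Metric.nhds_basis_closedBall.mem_iff.1 (h.isOpen_U.mem_nhds hyU)
      filter_upwards [Ioc_mem_nhdsGT hR] with r hr
      exact (closedBall_subset_closedBall hr.2).trans hRU
    have hlin : ∀ r : ℝ, Measure.euclideanHausdorffMeasure 2 (fderiv ℝ p y '' closedBall y r) =
        ENNReal.ofReal (areaDensity p y) * volume (closedBall y r) := fun r =>
      euclideanHausdorffMeasure_two_linear_image (fderiv ℝ p y : Euc 2 →ₗ[ℝ] Euc n) _
    have hvol : ∀ r : ℝ, 0 < r → volume (closedBall y r) ≠ 0 ∧ volume (closedBall y r) ≠ ⊤ :=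
      fun r hr => ⟨(measure_closedBall_pos _ _ hr).ne', measure_closedBall_lt_top.ne⟩
    apply le_antisymm
    -- On small balls `p` expands distances at most `1 + δ` times as much as its derivative.
    · have hlim : Tendsto (fun δ : ℝ => ENNReal.ofReal (1 + δ) ^ 2 *
          ENNReal.ofReal (areaDensity p y)) (𝓝[>] 0) (𝓝 (ENNReal.ofReal (areaDensity p y))) := by
        have h1 : Tendsto (fun δ : ℝ => ENNReal.ofReal ((1 + δ) ^ 2 * areaDensity p y)) (𝓝[>] 0)
            (𝓝 (ENNReal.ofReal ((1 + 0) ^ 2 * areaDensity p y))) := by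
          refine ENNReal.tendsto_ofReal (Tendsto.mono_left ?_ nhdsWithin_le_nhds)
          exact Continuous.tendsto (by fun_prop) _
        rw [add_zero, one_pow, one_mul] at h1
        refine h1.congr' ?_
        filter_upwards [self_mem_nhdsWithin] with δ hδ
        have hδ' : (0 : ℝ) < δ := hδ
        rw [ENNReal.ofReal_mul (by positivity), ENNReal.ofReal_pow (by positivity)]
      refine ge_of_tendsto hlim ?_
      filter_upwards [self_mem_nhdsWithin] with δ hδ
      have hδ' : (0 : ℝ) < δ := hδ
      refine le_of_tendsto hy ?_
      filter_upwards [hsub, eventually_dist_le_of_hasStrictFDerivAt hst (h.injective_fderiv_p hyU)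
        hδ', self_mem_nhdsWithin] with r hr1 hr2 hr3
      have hr3 : (0 : ℝ) < r := hr3
      rw [ENNReal.div_le_iff (hvol r hr3).1 (hvol r hr3).2, hν,
        h.map_g_apply hΩ measurableSet_closedBall, inter_eq_left.2 hr1, mul_assoc, ← hlin r]
      refine euclideanHausdorffMeasure_image_le_of_dist_le (C := (1 + δ).toNNReal) fun a ha b hb => ?_
      rw [Real.coe_toNNReal _ (by positivity)]
      exact (hr2 a ha b hb).1
    -- On small balls `p` expands distances at least `1 - δ` times as much as its derivative.
    · have hlim : Tendsto (fun δ : ℝ => ENNReal.ofReal (1 - δ) ^ 2 *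
          ENNReal.ofReal (areaDensity p y)) (𝓝[>] 0) (𝓝 (ENNReal.ofReal (areaDensity p y))) := by
        have h1 : Tendsto (fun δ : ℝ => ENNReal.ofReal ((1 - δ) ^ 2 * areaDensity p y)) (𝓝[>] 0)
            (𝓝 (ENNReal.ofReal ((1 - 0) ^ 2 * areaDensity p y))) := by
          refine ENNReal.tendsto_ofReal (Tendsto.mono_left ?_ nhdsWithin_le_nhds)
          exact Continuous.tendsto (by fun_prop) _
        rw [sub_zero, one_pow, one_mul] at h1
        refine h1.congr' ?_
        filter_upwards [Ioo_mem_nhdsGT one_pos] with δ hδ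
        rw [ENNReal.ofReal_mul (by positivity), ENNReal.ofReal_pow (by linarith [hδ.2])]
      refine le_of_tendsto hlim ?_
      filter_upwards [Ioo_mem_nhdsGT one_pos] with δ hδ
      have hδ1 : 0 < 1 - δ := by linarith [hδ.2]
      refine ge_of_tendsto hy ?_
      filter_upwards [hsub, eventually_dist_le_of_hasStrictFDerivAt hst (h.injective_fderiv_p hyU)
        hδ.1, self_mem_nhdsWithin] with r hr1 hr2 hr3
      have hr3 : (0 : ℝ) < r := hr3
      rw [ENNReal.le_div_iff_mul_le (Or.inl (hvol r hr3).1) (Or.inl (hvol r hr3).2), hν,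
        h.map_g_apply hΩ measurableSet_closedBall, inter_eq_left.2 hr1, mul_assoc, ← hlin r]
      have h6 := euclideanHausdorffMeasure_image_le_of_dist_le (A := closedBall y r) (p := fderiv ℝ p y)
        (q := p) (C := (1 - δ)⁻¹.toNNReal) fun a ha b hb => by
          rw [Real.coe_toNNReal _ (by positivity), inv_mul_eq_div, le_div_iff₀ hδ1, mul_comm]
          exact (hr2 a ha b hb).2
      calc _ ≤ ENNReal.ofReal (1 - δ) ^ 2 * (((1 - δ)⁻¹.toNNReal : ℝ≥0∞) ^ 2 *
            Measure.euclideanHausdorffMeasure 2 (p '' closedBall y r)) := by gcongr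
        _ = _ := by
          rw [← mul_assoc, ← mul_pow]
          change (ENNReal.ofReal (1 - δ) * ENNReal.ofReal (1 - δ)⁻¹) ^ 2 * _ = _
          rw [← ENNReal.ofReal_mul hδ1.le, mul_inv_cancel₀ hδ1.ne']
          simp
  calc ν = ν.restrict U := hU.symm
    _ = (volume.withDensity (ν.rnDeriv volume)).restrict U := by
      rw [Measure.withDensity_rnDeriv_eq _ _ hac]
    _ = (volume.restrict U).withDensity (ν.rnDeriv volume) :=
      restrict_withDensity h.isOpen_U.measurableSet _
    _ = _ := withDensity_congr_ae hd

theorem aemeasurable_p (h : IsChart Ω W U p g) : AEMeasurable p (volume.restrict U) :=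
  h.contDiffOn_p.continuousOn.aemeasurable h.isOpen_U.measurableSet

/-- The area formula. -/
theorem map_p_eq (h : IsChart Ω W U p g) (hΩ : MeasurableSet Ω) :
    ((volume.restrict U).withDensity fun y => ENNReal.ofReal (areaDensity p y)).map p =
      (area Ω).restrict W := by
  rw [← h.map_g_eq hΩ]
  have h1 : AEMeasurable p (((area Ω).restrict W).map g) := by
    rw [h.map_g_eq hΩ]
    exact h.aemeasurable_p.mono_ac (withDensity_absolutelyContinuous _ _)
  rw [AEMeasurable.map_map_of_aemeasurable h1 h.aemeasurable_g]
  have h2 : p ∘ g =ᵐ[(area Ω).restrict W] id := by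
    have h3 : ∀ᵐ z ∂area Ω, z ∈ Ω := ae_restrict_mem hΩ
    filter_upwards [ae_restrict_mem h.isOpen_W.measurableSet, ae_restrict_of_ae h3] with z hz hz'
    exact h.p_g z hz' hz
  rw [Measure.map_congr h2, Measure.map_id]

end IsChart

/-! ### Integration in charts -/

theorem areaDensity_nonneg (p : Euc 2 → Euc n) (y : Euc 2) : 0 ≤ areaDensity p y :=
  Real.sqrt_nonneg _

theorem IsClosedSurface.measurableSet (hΩ : IsClosedSurface Ω) : MeasurableSet Ω :=
  hΩ.isCompact.isClosed.measurableSet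

theorem ae_area_mem (hΩ : MeasurableSet Ω) : ∀ᵐ x ∂area Ω, x ∈ Ω :=
  ae_restrict_mem hΩ

theorem IsClosedSurface.isFiniteMeasure (hΩ : IsClosedSurface Ω) : IsFiniteMeasure (area Ω) := by
  have h1 : area Ω Ω < ⊤ := by
    refine hΩ.isCompact.measure_lt_top_of_nhdsWithin fun x hx => ?_
    obtain ⟨W, U, p, g, h, hxW⟩ := hΩ.exists_chart hx
    exact ⟨W, mem_nhdsWithin_of_mem_nhds (h.isOpen_W.mem_nhds hxW), h.area_lt_top hΩ.measurableSet⟩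
  refine ⟨?_⟩
  rw [area, Measure.restrict_apply_univ]
  rwa [area, Measure.restrict_apply_self] at h1

theorem contDiffOn_pd {F : Type*} [NormedAddCommGroup F] [NormedSpace ℝ F] {f : Euc 2 → F}
    {U : Set (Euc 2)} (hU : IsOpen U) (hf : ContDiffOn ℝ ∞ f U) (i : Fin 2) :
    ContDiffOn ℝ ∞ (pd i f) U :=
  (hf.fderiv_of_isOpen hU (by simp)).clm_apply contDiffOn_const

namespace IsChart

variable {W : Set (Euc n)} {U : Set (Euc 2)} {p : Euc 2 → Euc n} {g : Euc n → Euc 2}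

theorem gramDet_pos (h : IsChart Ω W U p g) {y : Euc 2} (hy : y ∈ U) :
    0 < gramDet (pd 0 p y) (pd 1 p y) :=
  Real.sqrt_pos.1 (h.areaDensity_pos hy)

theorem contDiffOn_areaDensity (h : IsChart Ω W U p g) : ContDiffOn ℝ ∞ (areaDensity p) U := by
  have h0 := contDiffOn_pd h.isOpen_U h.contDiffOn_p 0
  have h1 := contDiffOn_pd h.isOpen_U h.contDiffOn_p 1
  refine ContDiffOn.sqrt ?_ fun y hy => (h.gramDet_pos hy).ne'
  exact ((h0.inner ℝ h0).mul (h1.inner ℝ h1)).sub ((h0.inner ℝ h1).pow 2)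

theorem aemeasurable_areaDensity (h : IsChart Ω W U p g) :
    AEMeasurable (areaDensity p) (volume.restrict U) :=
  h.contDiffOn_areaDensity.continuousOn.aemeasurable h.isOpen_U.measurableSet

theorem absolutelyContinuous_withDensity (h : IsChart Ω W U p g) : volume.restrict U ≪
    (volume.restrict U).withDensity fun y => ENNReal.ofReal (areaDensity p y) := by
  refine withDensity_absolutelyContinuous' h.aemeasurable_areaDensity.ennreal_ofReal ?_
  filter_upwards [ae_restrict_mem h.isOpen_U.measurableSet] with y hy
  simpa using h.areaDensity_pos hy

/-- Null sets of the surface correspond to null sets of the parameter domain. -/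
theorem ae_iff (h : IsChart Ω W U p g) (hΩ : MeasurableSet Ω) {P : Euc n → Prop} :
    (∀ᵐ x ∂area Ω, x ∈ W → P x) ↔ ∀ᵐ y ∂volume, y ∈ U → P (p y) := by
  rw [← ae_restrict_iff' h.isOpen_W.measurableSet, ← ae_restrict_iff' h.isOpen_U.measurableSet]
  constructor
  · intro hP
    rw [← h.map_p_eq hΩ] at hP
    exact h.absolutelyContinuous_withDensity.ae_le (ae_of_ae_map
      (h.aemeasurable_p.mono_ac (withDensity_absolutelyContinuous _ _)) hP)
  · intro hP
    have h1 := (withDensity_absolutelyContinuous (volume.restrict U)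
      fun y => ENNReal.ofReal (areaDensity p y)).ae_le hP
    rw [← h.map_g_eq hΩ] at h1
    filter_upwards [ae_of_ae_map h.aemeasurable_g h1, ae_restrict_of_ae (ae_area_mem hΩ),
      ae_restrict_mem h.isOpen_W.measurableSet] with x hx hx1 hx2
    rwa [h.p_g x hx1 hx2] at hx

theorem aestronglyMeasurable_comp (h : IsChart Ω W U p g) (hΩ : MeasurableSet Ω) {F : Type*}
    [TopologicalSpace F] {f : Euc n → F}
    (hf : AEStronglyMeasurable f ((area Ω).restrict W)) :
    AEStronglyMeasurable (fun y => f (p y)) (volume.restrict U) := by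
  rw [← h.map_p_eq hΩ] at hf
  exact (hf.comp_aemeasurable
    (h.aemeasurable_p.mono_ac (withDensity_absolutelyContinuous _ _))).mono_ac
    h.absolutelyContinuous_withDensity

theorem setIntegral_eq (h : IsChart Ω W U p g) (hΩ : MeasurableSet Ω) {f : Euc n → ℝ}
    (hf : AEStronglyMeasurable f ((area Ω).restrict W)) :
    ∫ x in W, f x ∂area Ω = ∫ y in U, areaDensity p y * f (p y) := by
  rw [← h.map_p_eq hΩ] at hf ⊢
  rw [integral_map (h.aemeasurable_p.mono_ac (withDensity_absolutelyContinuous _ _)) hf,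
    integral_withDensity_eq_integral_toReal_smul₀ h.aemeasurable_areaDensity.ennreal_ofReal
      (by simp)]
  refine integral_congr_ae ?_
  filter_upwards with y
  rw [ENNReal.toReal_ofReal (areaDensity_nonneg p y), smul_eq_mul]

theorem integrableOn (h : IsChart Ω W U p g) (hΩ : MeasurableSet Ω) {f : Euc n → ℝ}
    (hf : IntegrableOn f W (area Ω)) :
    IntegrableOn (fun y => areaDensity p y * f (p y)) U := by
  rw [IntegrableOn, ← h.map_p_eq hΩ] at hf
  have h1 := (integrable_map_measure hf.aestronglyMeasurable
    (h.aemeasurable_p.mono_ac (withDensity_absolutelyContinuous _ _))).1 hf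
  have h2 := (integrable_withDensity_iff_integrable_smul₀'
    h.aemeasurable_areaDensity.ennreal_ofReal (by simp)).1 h1
  refine h2.congr ?_
  filter_upwards with y
  rw [ENNReal.toReal_ofReal (areaDensity_nonneg p y), smul_eq_mul]
  rfl

/-- Integrals of functions supported in the domain of a chart. -/
theorem integral_eq (h : IsChart Ω W U p g) (hΩ : MeasurableSet Ω) {f : Euc n → ℝ}
    (hf : AEStronglyMeasurable f (area Ω)) (h0 : ∀ x ∈ Ω, x ∉ W → f x = 0) :
    ∫ x, f x ∂area Ω = ∫ y in U, areaDensity p y * f (p y) := by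
  rw [← h.setIntegral_eq hΩ hf.restrict]
  refine (setIntegral_eq_integral_of_ae_compl_eq_zero ?_).symm
  filter_upwards [ae_area_mem hΩ] with x hx hxW using h0 x hx hxW

end IsChart

/-- Relatively open nonempty pieces of a closed surface have positive area. -/
theorem IsClosedSurface.area_pos (hΩ : IsClosedSurface Ω) {x : Euc n} (hx : x ∈ Ω)
    {N : Set (Euc n)} (hN : N ∈ 𝓝 x) : 0 < area Ω N := by
  obtain ⟨W, U, p, g, h, hxW⟩ := hΩ.exists_chart hx
  obtain ⟨O, hON, hO, hxO⟩ := _root_.mem_nhds_iff.1 hN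
  refine lt_of_lt_of_le (pos_iff_ne_zero.2 fun h0 => ?_) (measure_mono hON)
  have h1 : ∀ᵐ x ∂area Ω, x ∈ W → x ∉ O := by
    filter_upwards [measure_eq_zero_iff_ae_notMem.1 h0] with z hz _ using hz
  rw [h.ae_iff hΩ.measurableSet] at h1
  have h2 : IsOpen (U ∩ p ⁻¹' O) := h.contDiffOn_p.continuousOn.isOpen_inter_preimage h.isOpen_U hO
  have h3 : (U ∩ p ⁻¹' O).Nonempty :=
    ⟨g x, h.g_mem x hxW, by rwa [mem_preimage, h.p_g x hx hxW]⟩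
  refine (h2.measure_pos volume h3).ne' (measure_eq_zero_iff_ae_notMem.2 ?_)
  filter_upwards [h1] with y hy hy' using hy hy'.1 hy'.2

/-! ### Tangential traces -/

/-- The trace over the plane spanned by `a` and `b` of the tangential part of `A`. -/
theorem trace_starProjection_comp_mul_gramDet {T : Submodule ℝ (Euc n)} {L : Euc 2 →ₗ[ℝ] Euc n}
    (hL : Function.Injective L) (hT : T = LinearMap.range L) (A : Euc n →L[ℝ] Euc n)
    {a b : Euc n} (ha : a = L (EuclideanSpace.single 0 1)) (hb : b = L (EuclideanSpace.single 1 1)) :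
    LinearMap.trace ℝ (Euc n) ((T.starProjection ∘L A : Euc n →L[ℝ] Euc n) : Euc n →ₗ[ℝ] Euc n) *
      gramDet a b =
    inner ℝ (A a) a * inner ℝ b b - inner ℝ a b * (inner ℝ (A a) b + inner ℝ (A b) a) +
      inner ℝ (A b) b * inner ℝ a a := by
  have hD : gramDet a b ≠ 0 := by rw [ha, hb]; exact (MixedFE.gramDet_pos hL).ne'
  -- `c` gives the coordinates of the projection onto the plane.
  let c : Euc n →ₗ[ℝ] Euc 2 :=
    (EuclideanSpace.equiv (Fin 2) ℝ).symm.toLinearMap ∘ₗ LinearMap.pi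
      ![(gramDet a b)⁻¹ • (inner ℝ b b • (innerₛₗ ℝ a) - inner ℝ a b • (innerₛₗ ℝ b)),
        (gramDet a b)⁻¹ • (inner ℝ a a • (innerₛₗ ℝ b) - inner ℝ a b • (innerₛₗ ℝ a))]
  have hc0 : ∀ v, c v 0 = (gramDet a b)⁻¹ * (inner ℝ b b * inner ℝ a v - inner ℝ a b * inner ℝ b v) :=
    fun v => by simp [c]
  have hc1 : ∀ v, c v 1 = (gramDet a b)⁻¹ * (inner ℝ a a * inner ℝ b v - inner ℝ a b * inner ℝ a v) :=
    fun v => by simp [c]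
  have hLv : ∀ w : Euc 2, L w = w 0 • a + w 1 • b := by
    intro w
    have : w = w 0 • EuclideanSpace.single 0 (1 : ℝ) + w 1 • EuclideanSpace.single 1 (1 : ℝ) := by
      ext i; fin_cases i <;> simp
    conv_lhs => rw [this]
    rw [map_add, map_smul, map_smul, ha, hb]
  have hP : ∀ v, T.starProjection v = L (c v) := by
    intro v
    refine Submodule.eq_starProjection_of_mem_of_inner_eq_zero (hT ▸ ⟨c v, rfl⟩) ?_
    intro w hw
    rw [hT] at hw
    obtain ⟨w, rfl⟩ := hw
    rw [hLv, hLv, hc0, hc1]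
    simp only [inner_sub_left, inner_add_left, inner_add_right, real_inner_smul_left,
      real_inner_smul_right, real_inner_comm a v, real_inner_comm b v, real_inner_comm b a]
    rw [real_inner_comm a b]
    field_simp
    simp only [gramDet]
    ring
  have h1 : ((T.starProjection ∘L A : Euc n →L[ℝ] Euc n) : Euc n →ₗ[ℝ] Euc n) =
      L ∘ₗ (c ∘ₗ (A : Euc n →ₗ[ℝ] Euc n)) := by
    ext1 v
    exact hP _
  rw [h1, LinearMap.trace_comp_comm', LinearMap.trace_eq_sum_inner _ (EuclideanSpace.basisFun (Fin 2) ℝ)]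
  simp only [Fin.sum_univ_two, EuclideanSpace.basisFun_apply, LinearMap.comp_apply,
    EuclideanSpace.inner_single_left, map_one, one_mul, ← ha, ← hb]
  rw [hc0, hc1]
  simp only [ContinuousLinearMap.coe_coe, real_inner_comm (A a), real_inner_comm (A b)]
  field_simp
  ring

/-! ### The surface divergence in coordinates -/

section pd

variable {F : Type*} [NormedAddCommGroup F] {y : Euc 2} {i j : Fin 2}

theorem pd_add [NormedSpace ℝ F] {f g : Euc 2 → F} (hf : DifferentiableAt ℝ f y)
    (hg : DifferentiableAt ℝ g y) : pd i (fun y => f y + g y) y = pd i f y + pd i g y := by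
  simp [pd, fderiv_fun_add hf hg]

theorem pd_smul [NormedSpace ℝ F] {c : Euc 2 → ℝ} {f : Euc 2 → F} (hc : DifferentiableAt ℝ c y)
    (hf : DifferentiableAt ℝ f y) :
    pd i (fun y => c y • f y) y = c y • pd i f y + pd i c y • f y := by
  simp [pd, fderiv_fun_smul hc hf]

theorem pd_mul {c f : Euc 2 → ℝ} (hc : DifferentiableAt ℝ c y) (hf : DifferentiableAt ℝ f y) :
    pd i (fun y => c y * f y) y = c y * pd i f y + pd i c y * f y := by
  simp [pd, fderiv_fun_mul hc hf, mul_comm]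

theorem pd_inner [InnerProductSpace ℝ F] {a b : Euc 2 → F} (ha : DifferentiableAt ℝ a y)
    (hb : DifferentiableAt ℝ b y) :
    pd i (fun y => inner ℝ (a y) (b y)) y = inner ℝ (a y) (pd i b y) + inner ℝ (pd i a y) (b y) := by
  simp [pd, fderiv_inner_apply ℝ ha hb]

theorem pd_comm [NormedSpace ℝ F] {f : Euc 2 → F} (hf : ContDiffAt ℝ ∞ f y) :
    pd i (pd j f) y = pd j (pd i f) y := by
  have h1 : DifferentiableAt ℝ (fderiv ℝ f) y :=
    (hf.fderiv_right (m := 1) (by norm_cast)).differentiableAt (by simp)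
  have h2 : IsSymmSndFDerivAt ℝ f y := hf.isSymmSndFDerivAt (by simp; norm_cast)
  have h3 : ∀ i j : Fin 2, pd i (pd j f) y =
      fderiv ℝ (fderiv ℝ f) y (EuclideanSpace.single i 1) (EuclideanSpace.single j 1) := by
    intro i j
    change fderiv ℝ (fun y => fderiv ℝ f y (EuclideanSpace.single j 1)) y _ = _
    rw [fderiv_clm_apply h1 (differentiableAt_const _)]
    simp
  rw [h3, h3, h2.eq]

theorem pd_sq_eq {ρ : Euc 2 → ℝ} (hρ : DifferentiableAt ℝ ρ y) :
    pd i (fun y => ρ y ^ 2) y = 2 * ρ y * pd i ρ y := by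
  simp only [pow_two]
  rw [pd_mul hρ hρ]; ring

theorem pd_congr [NormedSpace ℝ F] {f g : Euc 2 → F} (h : f =ᶠ[𝓝 y] g) : pd i f y = pd i g y := by
  rw [pd, h.fderiv_eq, pd]

end pd

namespace IsChart

variable {W : Set (Euc n)} {U : Set (Euc 2)} {p : Euc 2 → Euc n} {g : Euc n → Euc 2}

theorem contDiffAt_pd_p (h : IsChart Ω W U p g) (i : Fin 2) {y : Euc 2} (hy : y ∈ U) :
    ContDiffAt ℝ ∞ (pd i p) y :=
  (contDiffOn_pd h.isOpen_U h.contDiffOn_p i).contDiffAt (h.isOpen_U.mem_nhds hy)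

theorem differentiableAt_pd_p (h : IsChart Ω W U p g) (i : Fin 2) {y : Euc 2} (hy : y ∈ U) :
    DifferentiableAt ℝ (pd i p) y :=
  (h.contDiffAt_pd_p i hy).differentiableAt (by simp)

theorem differentiableAt_areaDensity (h : IsChart Ω W U p g) {y : Euc 2} (hy : y ∈ U) :
    DifferentiableAt ℝ (areaDensity p) y :=
  (h.contDiffOn_areaDensity.contDiffAt (h.isOpen_U.mem_nhds hy)).differentiableAt (by simp)

theorem areaDensity_sq (h : IsChart Ω W U p g) {y : Euc 2} (hy : y ∈ U) :
    areaDensity p y ^ 2 = gramDet (pd 0 p y) (pd 1 p y) :=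
  Real.sq_sqrt (h.gramDet_pos hy).le

/-- The derivative of the area density, via `ρ² = EG - F²`. -/
theorem areaDensity_mul_pd (h : IsChart Ω W U p g) (i : Fin 2) {y : Euc 2} (hy : y ∈ U) :
    areaDensity p y * pd i (areaDensity p) y =
      inner ℝ (pd 0 p y) (pd i (pd 0 p) y) * inner ℝ (pd 1 p y) (pd 1 p y) +
      inner ℝ (pd 0 p y) (pd 0 p y) * inner ℝ (pd 1 p y) (pd i (pd 1 p) y) -
      inner ℝ (pd 0 p y) (pd 1 p y) *
        (inner ℝ (pd 0 p y) (pd i (pd 1 p) y) + inner ℝ (pd 1 p y) (pd i (pd 0 p) y)) := by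
  have d0 := h.differentiableAt_pd_p 0 hy
  have d1 := h.differentiableAt_pd_p 1 hy
  have h1 : (fun y => areaDensity p y ^ 2 + inner ℝ (pd 0 p y) (pd 1 p y) ^ 2) =ᶠ[𝓝 y]
      fun y => inner ℝ (pd 0 p y) (pd 0 p y) * inner ℝ (pd 1 p y) (pd 1 p y) := by
    filter_upwards [h.isOpen_U.mem_nhds hy] with z hz
    rw [h.areaDensity_sq hz, gramDet]; ring
  have h2 := pd_congr (i := i) h1
  have dρ := h.differentiableAt_areaDensity hy
  rw [pd_add (f := fun y => areaDensity p y ^ 2) (g := fun y => inner ℝ (pd 0 p y) (pd 1 p y) ^ 2)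
    (dρ.pow 2) ((d0.inner ℝ d1).pow 2), pd_sq_eq dρ, pd_sq_eq (d0.inner ℝ d1),
    pd_mul (d0.inner ℝ d0) (d1.inner ℝ d1), pd_inner d0 d1, pd_inner d0 d0, pd_inner d1 d1] at h2
  rw [real_inner_comm (pd 0 p y) (pd i (pd 0 p) y), real_inner_comm (pd 1 p y) (pd i (pd 1 p) y),
    real_inner_comm (pd 1 p y) (pd i (pd 0 p) y)] at h2
  linarith

/-- The classical formula for the divergence in coordinates: `ρ ∇·X = ∂₁(ρ ξ¹) + ∂₂(ρ ξ²)`. -/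
theorem areaDensity_mul_surfaceDiv (h : IsChart Ω W U p g) {X : Euc n → Euc n}
    {ξ₀ ξ₁ : Euc 2 → ℝ} {y : Euc 2} (hy : y ∈ U) (hX : DifferentiableAt ℝ X (p y))
    (h₀ : DifferentiableAt ℝ ξ₀ y) (h₁ : DifferentiableAt ℝ ξ₁ y)
    (hXξ : ∀ z ∈ U, X (p z) = ξ₀ z • pd 0 p z + ξ₁ z • pd 1 p z) :
    areaDensity p y * surfaceDiv Ω X (p y) =
      pd 0 (fun z => areaDensity p z * ξ₀ z) y + pd 1 (fun z => areaDensity p z * ξ₁ z) y := by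
  have d0 := h.differentiableAt_pd_p 0 hy
  have d1 := h.differentiableAt_pd_p 1 hy
  have dρ := h.differentiableAt_areaDensity hy
  have hA : ∀ i : Fin 2, fderiv ℝ X (p y) (pd i p y) =
      (ξ₀ y • pd i (pd 0 p) y + pd i ξ₀ y • pd 0 p y) +
      (ξ₁ y • pd i (pd 1 p) y + pd i ξ₁ y • pd 1 p y) := by
    intro i
    rw [← pd_smul h₀ d0, ← pd_smul h₁ d1, ← pd_add (f := fun z => ξ₀ z • pd 0 p z)
      (g := fun z => ξ₁ z • pd 1 p z) (h₀.smul d0) (h₁.smul d1)]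
    have h3 : (fun z => X (p z)) =ᶠ[𝓝 y] fun z => ξ₀ z • pd 0 p z + ξ₁ z • pd 1 p z := by
      filter_upwards [h.isOpen_U.mem_nhds hy] with z hz using hXξ z hz
    rw [← pd_congr h3]
    change _ = fderiv ℝ (X ∘ p) y _
    rw [(hX.hasFDerivAt.comp y (h.hasFDerivAt_p hy)).fderiv]
    rfl
  have htr := trace_starProjection_comp_mul_gramDet (L := (fderiv ℝ p y : Euc 2 →ₗ[ℝ] Euc n))
    (h.injective_fderiv_p hy) (h.tangentPlane_eq hy) (fderiv ℝ X (p y)) (a := pd 0 p y)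
    (b := pd 1 p y) rfl rfl
  change surfaceDiv Ω X (p y) * _ = _ at htr
  rw [← h.areaDensity_sq hy, hA, hA] at htr
  rw [pd_mul dρ h₀, pd_mul dρ h₁]
  have hρ := h.areaDensity_pos hy
  have hρ2 := h.areaDensity_sq hy
  have e0 := h.areaDensity_mul_pd 0 hy
  have e1 := h.areaDensity_mul_pd 1 hy
  have hc : pd 0 (pd 1 p) y = pd 1 (pd 0 p) y := pd_comm (h.contDiffAt_p hy)
  rw [hc] at htr e0
  refine mul_left_cancel₀ hρ.ne' ?_
  simp only [inner_add_left, real_inner_smul_left] at htr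
  rw [real_inner_comm (pd 0 p y) (pd 1 p y)] at htr
  simp only [real_inner_comm (pd 0 p y) (pd _ (pd _ p) y),
    real_inner_comm (pd 1 p y) (pd _ (pd _ p) y)] at htr
  rw [gramDet] at hρ2
  linear_combination htr - ξ₀ y * e0 - ξ₁ y * e1
    - (pd 0 ξ₀ y + pd 1 ξ₁ y) * hρ2

end IsChart

/-! ### Cutoffs and partitions of unity -/

open scoped Manifold

theorem contDiff_of_contDiffOn_of_eq_zero {E F : Type*} [NormedAddCommGroup E] [NormedSpace ℝ E]
    [NormedAddCommGroup F] [NormedSpace ℝ F] {f : E → F} {W C : Set E} (hW : IsOpen W)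
    (hf : ContDiffOn ℝ ∞ f W) (hC : IsClosed C) (hCW : C ⊆ W) (h0 : ∀ x, x ∉ C → f x = 0) :
    ContDiff ℝ ∞ f := by
  refine contDiff_iff_contDiffAt.2 fun x => ?_
  by_cases hx : x ∈ W
  · exact hf.contDiffAt (hW.mem_nhds hx)
  · refine (contDiffAt_const (c := (0 : F))).congr_of_eventuallyEq ?_
    filter_upwards [hC.isOpen_compl.mem_nhds fun hxC => hx (hCW hxC)] with z hz using h0 z hz

theorem exists_contDiff_one_tsupport_subset {K W : Set (Euc n)} (hK : IsCompact K) (hW : IsOpen W)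
    (hKW : K ⊆ W) : ∃ χ : Euc n → ℝ, ContDiff ℝ ∞ χ ∧ (∀ x ∈ K, χ x = 1) ∧ tsupport χ ⊆ W := by
  obtain ⟨K', hK', hKK', hK'W⟩ := exists_compact_between hK hW hKW
  obtain ⟨f, hf1, hf0, -⟩ := exists_contMDiffMap_one_nhds_of_subset_interior (n := (⊤ : ℕ∞))
    𝓘(ℝ, Euc n) hK.isClosed hKK'
  refine ⟨f, f.contMDiff.contDiff, fun x hx => (subset_of_mem_nhdsSet hf1 hx),
    (closure_minimal ?_ hK'.isClosed).trans hK'W⟩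
  intro x hx
  by_contra hxK
  exact hx (hf0 x hxK)

/-- A partition of unity near `Ω` subordinate to finitely many charts. -/
theorem IsClosedSurface.exists_partition (hΩ : IsClosedSurface Ω) :
    ∃ (ι : Type) (_ : Fintype ι) (χ : ι → Euc n → ℝ) (W : ι → Set (Euc n)),
      (∀ i, ContDiff ℝ ∞ (χ i)) ∧ (∀ i, tsupport (χ i) ⊆ W i) ∧
      (∀ i, ∃ U p g, IsChart Ω (W i) U p g) ∧ ∀ x ∈ Ω, ∀ᶠ z in 𝓝 x, ∑ i, χ i z = 1 := by
  choose! W U p g h hW using fun x (hx : x ∈ Ω) => hΩ.exists_chart hx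
  obtain ⟨t, ht, hcov⟩ := hΩ.isCompact.elim_nhds_subcover W
    fun x hx => (h x hx).isOpen_W.mem_nhds (hW x hx)
  have hopen : ∀ i : t, IsOpen (W i) := fun i => (h i (ht i i.2)).isOpen_W
  obtain ⟨δ, hδ, hδW⟩ := hΩ.isCompact.exists_cthickening_subset_open
    (isOpen_iUnion hopen) (by
      refine hcov.trans ?_
      rw [iUnion_subset_iff]; intro i; rw [iUnion_subset_iff]; intro hi
      exact subset_iUnion (fun i : t => W i) ⟨i, hi⟩)
  obtain ⟨f, hf⟩ := SmoothPartitionOfUnity.exists_isSubordinate 𝓘(ℝ, Euc n)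
    (isClosed_cthickening (δ := δ) (E := Ω)) (fun i : t => W i) hopen hδW
  let e : t ≃ Fin (Fintype.card t) := Fintype.equivFin t
  refine ⟨Fin (Fintype.card t), inferInstance, fun i => f (e.symm i), fun i => W (e.symm i),
    fun i => (f (e.symm i)).contMDiff.contDiff, fun i => hf (e.symm i),
    fun i => ⟨_, _, _, h _ (ht _ (e.symm i).2)⟩, fun x hx => ?_⟩
  filter_upwards [isOpen_thickening.mem_nhds (self_subset_thickening hδ Ω hx)] with z hz
  have := f.sum_eq_one (thickening_subset_cthickening _ _ hz)
  rw [finsum_eq_sum_of_fintype] at this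
  rw [← this]
  exact Fintype.sum_equiv e.symm _ _ fun i => rfl

/-! ### The divergence theorem -/

theorem surfaceDiv_eq_zero_of_notMem_tsupport {X : Euc n → Euc n} {x : Euc n}
    (hx : x ∉ tsupport X) : surfaceDiv Ω X x = 0 := by
  rw [surfaceDiv, fderiv_of_notMem_tsupport ℝ hx]
  simp

theorem surfaceDiv_congr {X Y : Euc n → Euc n} {x : Euc n} (h : X =ᶠ[𝓝 x] Y) :
    surfaceDiv Ω X x = surfaceDiv Ω Y x := by
  rw [surfaceDiv, h.fderiv_eq, surfaceDiv]

theorem surfaceDiv_sum {ι : Type*} [Fintype ι] {X : ι → Euc n → Euc n} {x : Euc n}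
    (h : ∀ i, DifferentiableAt ℝ (X i) x) :
    surfaceDiv Ω (fun z => ∑ i, X i z) x = ∑ i, surfaceDiv Ω (X i) x := by
  simp only [surfaceDiv]
  rw [fderiv_fun_sum fun i _ => h i, ← map_sum]
  congr 1
  ext v
  simp

/-- The divergence of `φ X` is `φ ∇·X + X φ`. -/
theorem surfaceDiv_smul {φ : Euc n → ℝ} {X : Euc n → Euc n} {x : Euc n}
    (hφ : DifferentiableAt ℝ φ x) (hX : DifferentiableAt ℝ X x) (hT : X x ∈ tangentPlane Ω x) :
    surfaceDiv Ω (fun z => φ z • X z) x = φ x * surfaceDiv Ω X x + fderiv ℝ φ x (X x) := by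
  have h1 : (((tangentPlane Ω x).starProjection ∘L fderiv ℝ (fun z => φ z • X z) x :
      Euc n →L[ℝ] Euc n) : Euc n →ₗ[ℝ] Euc n) =
      φ x • (((tangentPlane Ω x).starProjection ∘L fderiv ℝ X x : Euc n →L[ℝ] Euc n) :
        Euc n →ₗ[ℝ] Euc n) + LinearMap.smulRight (fderiv ℝ φ x : Euc n →ₗ[ℝ] ℝ) (X x) := by
    rw [fderiv_fun_smul hφ hX]
    ext1 v
    simp [Submodule.starProjection_eq_self_iff.2 hT]
  rw [surfaceDiv, h1, map_add, map_smul, surfaceDiv, LinearMap.trace_smulRight]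
  rfl

/-- The integral of a partial derivative of a compactly supported function vanishes. -/
theorem setIntegral_pd_eq_zero {U K : Set (Euc 2)} {f : Euc 2 → ℝ} (hU : IsOpen U)
    (hf : ContDiffOn ℝ ∞ f U) (hK : IsCompact K) (hKU : K ⊆ U) (h0 : ∀ y ∈ U, y ∉ K → f y = 0)
    (i : Fin 2) : ∫ y in U, pd i f y = 0 := by
  -- Extension by zero turns `f` into a smooth compactly supported function on the whole plane.
  set F := U.indicator f with hF
  have hFf : ∀ y ∈ U, F =ᶠ[𝓝 y] f := fun y hy => by
    filter_upwards [hU.mem_nhds hy] with z hz using indicator_of_mem hz f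
  have hF0 : ∀ y, y ∉ K → F y = 0 := fun y hy => by
    by_cases hyU : y ∈ U
    · rw [hF, indicator_of_mem hyU, h0 y hyU hy]
    · exact indicator_of_notMem hyU f
  have hFs : ContDiff ℝ ∞ F := contDiff_of_contDiffOn_of_eq_zero hU
    (hf.congr fun y hy => indicator_of_mem hy f) hK.isClosed hKU hF0
  have hFc : HasCompactSupport F := HasCompactSupport.intro hK hF0
  have h1 : ∫ y in U, pd i f y = ∫ y in U, pd i F y :=
    setIntegral_congr_fun hU.measurableSet fun y hy => (pd_congr (hFf y hy)).symm
  have h2 : ∫ y in U, pd i F y = ∫ y, pd i F y := by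
    refine setIntegral_eq_integral_of_forall_compl_eq_zero fun y hy => ?_
    have h3 : F =ᶠ[𝓝 y] fun _ => 0 := by
      filter_upwards [hK.isClosed.isOpen_compl.mem_nhds fun hyK => hy (hKU hyK)] with z hz
        using hF0 z hz
    rw [pd, h3.fderiv_eq]; simp
  have h4 : Integrable (fun y => fderiv ℝ F y (EuclideanSpace.single i 1)) := by
    refine Continuous.integrable_of_hasCompactSupport
      ((hFs.continuous_fderiv (by simp)).clm_apply continuous_const) ?_
    exact (hFc.fderiv_apply (𝕜 := ℝ) _)
  have h5 := integral_mul_fderiv_eq_neg_fderiv_mul_of_integrable (μ := volume)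
    (f := fun _ : Euc 2 => (1 : ℝ)) (g := F) (v := EuclideanSpace.single i 1) (by simp)
    (by simpa using h4) (by simpa using hFs.continuous.integrable_of_hasCompactSupport hFc)
    (fun _ _ => differentiableAt_const _) (fun y _ => (hFs.differentiable (by simp)) y)
  rw [h1, h2]
  simpa [pd] using h5

namespace IsChart

variable {W : Set (Euc n)} {U : Set (Euc 2)} {p : Euc 2 → Euc n} {g : Euc n → Euc 2}

theorem fderiv_p_eq (y v : Euc 2) : fderiv ℝ p y v = v 0 • pd 0 p y + v 1 • pd 1 p y := by
  have : v = v 0 • EuclideanSpace.single 0 (1 : ℝ) + v 1 • EuclideanSpace.single 1 (1 : ℝ) := by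
    ext i; fin_cases i <;> simp
  conv_lhs => rw [this]
  rw [map_add, map_smul, map_smul, pd, pd]

/-- The coordinates of a vector field in a chart. -/
noncomputable def coord (p : Euc 2 → Euc n) (g : Euc n → Euc 2) (X : Euc n → Euc n) (i : Fin 2)
    (y : Euc 2) : ℝ :=
  fderiv ℝ g (p y) (X (p y)) i

theorem contDiffOn_coord (h : IsChart Ω W U p g) {X : Euc n → Euc n} (hX : ContDiff ℝ ∞ X)
    (i : Fin 2) : ContDiffOn ℝ ∞ (coord p g X i) U := by
  have h1 : ContDiffOn ℝ ∞ (fun y => fderiv ℝ g (p y) (X (p y))) U :=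
    ((h.contDiffOn_g.fderiv_of_isOpen h.isOpen_W (by simp)).comp h.contDiffOn_p h.p_mem_W).clm_apply
      (hX.comp_contDiffOn h.contDiffOn_p)
  exact (EuclideanSpace.proj i : Euc 2 →L[ℝ] ℝ).contDiff.comp_contDiffOn h1

theorem eq_coord (h : IsChart Ω W U p g) {X : Euc n → Euc n}
    (hT : ∀ x ∈ Ω, X x ∈ tangentPlane Ω x) {y : Euc 2} (hy : y ∈ U) :
    X (p y) = coord p g X 0 y • pd 0 p y + coord p g X 1 y • pd 1 p y := by
  have h1 := hT _ (h.p_mem y hy)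
  rw [h.tangentPlane_eq hy] at h1
  obtain ⟨v, hv⟩ := h1
  have hv' : fderiv ℝ p y v = X (p y) := hv
  rw [coord, coord, ← fderiv_p_eq, ← hv', h.fderiv_g_fderiv_p hy]

theorem areaDensity_mul_surfaceDiv_coord (h : IsChart Ω W U p g) {X : Euc n → Euc n}
    (hX : ContDiff ℝ ∞ X) (hT : ∀ x ∈ Ω, X x ∈ tangentPlane Ω x) {y : Euc 2} (hy : y ∈ U) :
    areaDensity p y * surfaceDiv Ω X (p y) =
      pd 0 (fun z => areaDensity p z * coord p g X 0 z) y +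
      pd 1 (fun z => areaDensity p z * coord p g X 1 z) y :=
  h.areaDensity_mul_surfaceDiv hy ((hX.differentiable (by simp)) _)
    (((h.contDiffOn_coord hX 0).contDiffAt (h.isOpen_U.mem_nhds hy)).differentiableAt (by simp))
    (((h.contDiffOn_coord hX 1).contDiffAt (h.isOpen_U.mem_nhds hy)).differentiableAt (by simp))
    fun _ hz => h.eq_coord hT hz

theorem contDiffOn_areaDensity_mul_coord (h : IsChart Ω W U p g) {X : Euc n → Euc n}
    (hX : ContDiff ℝ ∞ X) (i : Fin 2) :
    ContDiffOn ℝ ∞ (fun z => areaDensity p z * coord p g X i z) U :=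
  h.contDiffOn_areaDensity.mul (h.contDiffOn_coord hX i)

end IsChart

theorem IsClosedSurface.continuousOn_surfaceDiv (hΩ : IsClosedSurface Ω) {X : Euc n → Euc n}
    (hX : ContDiff ℝ ∞ X) (hT : ∀ x ∈ Ω, X x ∈ tangentPlane Ω x) :
    ContinuousOn (surfaceDiv Ω X) Ω := by
  intro x hx
  obtain ⟨W, U, p, g, h, hxW⟩ := hΩ.exists_chart hx
  have h1 : ContinuousOn (fun y => (areaDensity p y)⁻¹ *
      (pd 0 (fun z => areaDensity p z * IsChart.coord p g X 0 z) y +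
      pd 1 (fun z => areaDensity p z * IsChart.coord p g X 1 z) y)) U :=
    (h.contDiffOn_areaDensity.continuousOn.inv₀ fun y hy => (h.areaDensity_pos hy).ne').mul
      ((contDiffOn_pd h.isOpen_U (h.contDiffOn_areaDensity_mul_coord hX 0) 0).continuousOn.add
        (contDiffOn_pd h.isOpen_U (h.contDiffOn_areaDensity_mul_coord hX 1) 1).continuousOn)
  have h2 := (h1.comp h.contDiffOn_g.continuousOn h.g_mem).continuousAt (h.isOpen_W.mem_nhds hxW)
  have h3 : ∀ z ∈ Ω, z ∈ W → surfaceDiv Ω X z = (areaDensity p (g z))⁻¹ *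
      (pd 0 (fun z => areaDensity p z * IsChart.coord p g X 0 z) (g z) +
      pd 1 (fun z => areaDensity p z * IsChart.coord p g X 1 z) (g z)) := by
    intro z hz hzW
    rw [← h.areaDensity_mul_surfaceDiv_coord hX hT (h.g_mem z hzW), h.p_g z hz hzW,
      inv_mul_cancel_left₀ (h.areaDensity_pos (h.g_mem z hzW)).ne']
  refine h2.continuousWithinAt.congr_of_eventuallyEq ?_ (h3 x hx hxW)
  filter_upwards [self_mem_nhdsWithin, mem_nhdsWithin_of_mem_nhds (h.isOpen_W.mem_nhds hxW)]
    with z hz hzW using h3 z hz hzW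

/-- Continuous functions on a closed surface are integrable. -/
theorem IsClosedSurface.integrable_of_continuousOn (hΩ : IsClosedSurface Ω) {F : Type*}
    [NormedAddCommGroup F] [SecondCountableTopology F] {f : Euc n → F} (hf : ContinuousOn f Ω) :
    Integrable f (area Ω) := by
  have := hΩ.isFiniteMeasure
  obtain ⟨C, hC⟩ := hΩ.isCompact.exists_bound_of_continuousOn hf
  refine Integrable.of_bound (hf.aestronglyMeasurable hΩ.measurableSet) C ?_
  filter_upwards [ae_area_mem hΩ.measurableSet] with x hx using hC x hx

/-- The divergence theorem for a field supported in the domain of a chart. -/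
theorem IsChart.integral_surfaceDiv {W : Set (Euc n)} {U : Set (Euc 2)} {p : Euc 2 → Euc n}
    {g : Euc n → Euc 2} (h : IsChart Ω W U p g) (hΩ : IsClosedSurface Ω) {X : Euc n → Euc n}
    (hX : ContDiff ℝ ∞ X) (hT : ∀ x ∈ Ω, X x ∈ tangentPlane Ω x) (hXW : tsupport X ⊆ W) :
    ∫ x, surfaceDiv Ω X x ∂area Ω = 0 := by
  have hK : IsCompact (g '' (Ω ∩ tsupport X)) :=
    (hΩ.isCompact.inter_right (isClosed_tsupport X)).image_of_continuousOn
      (h.contDiffOn_g.continuousOn.mono fun x hx => hXW hx.2)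
  have hKU : g '' (Ω ∩ tsupport X) ⊆ U := by
    rintro _ ⟨x, hx, rfl⟩
    exact h.g_mem x (hXW hx.2)
  have h0 : ∀ i, ∀ y ∈ U, y ∉ g '' (Ω ∩ tsupport X) →
      areaDensity p y * IsChart.coord p g X i y = 0 := by
    intro i y hy hyK
    have : X (p y) = 0 := image_eq_zero_of_notMem_tsupport fun hs =>
      hyK ⟨p y, ⟨h.p_mem y hy, hs⟩, h.g_p y hy⟩
    simp [IsChart.coord, this]
  rw [h.integral_eq hΩ.measurableSet
    (hΩ.integrable_of_continuousOn (hΩ.continuousOn_surfaceDiv hX hT)).aestronglyMeasurable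
    fun x _ hxW => surfaceDiv_eq_zero_of_notMem_tsupport fun hx => hxW (hXW hx)]
  rw [setIntegral_congr_fun h.isOpen_U.measurableSet
    fun y hy => h.areaDensity_mul_surfaceDiv_coord hX hT hy]
  have hint : ∀ i, IntegrableOn (pd i fun z => areaDensity p z * IsChart.coord p g X i z) U := by
    intro i
    have hc := (contDiffOn_pd h.isOpen_U (h.contDiffOn_areaDensity_mul_coord hX i) i).continuousOn
    have h1 : IntegrableOn (pd i fun z => areaDensity p z * IsChart.coord p g X i z)
        (g '' (Ω ∩ tsupport X)) := (hc.mono hKU).integrableOn_compact hK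
    refine h1.of_forall_sdiff_eq_zero h.isOpen_U.measurableSet fun y hy => ?_
    have h2 : (fun z => areaDensity p z * IsChart.coord p g X i z) =ᶠ[𝓝 y] fun _ => 0 := by
      filter_upwards [h.isOpen_U.mem_nhds hy.1, hK.isClosed.isOpen_compl.mem_nhds hy.2] with z h1 h2
        using h0 i z h1 h2
    rw [pd_congr h2]; simp [pd]
  rw [integral_add (hint 0) (hint 1),
    setIntegral_pd_eq_zero h.isOpen_U (h.contDiffOn_areaDensity_mul_coord hX 0) hK hKU (h0 0),
    setIntegral_pd_eq_zero h.isOpen_U (h.contDiffOn_areaDensity_mul_coord hX 1) hK hKU (h0 1),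
    add_zero]

/-- The divergence theorem on a closed surface. -/
theorem IsClosedSurface.integral_surfaceDiv (hΩ : IsClosedSurface Ω) {X : Euc n → Euc n}
    (hX : ContDiff ℝ ∞ X) (hT : ∀ x ∈ Ω, X x ∈ tangentPlane Ω x) :
    ∫ x, surfaceDiv Ω X x ∂area Ω = 0 := by
  obtain ⟨ι, _, χ, W, hχ, hχW, hW, hsum⟩ := hΩ.exists_partition
  have hXi : ∀ i, ContDiff ℝ ∞ fun z => χ i z • X z := fun i => (hχ i).smul hX
  have hTi : ∀ i, ∀ x ∈ Ω, χ i x • X x ∈ tangentPlane Ω x := fun i x hx =>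
    Submodule.smul_mem _ _ (hT x hx)
  have h1 : ∀ x ∈ Ω, surfaceDiv Ω X x = ∑ i, surfaceDiv Ω (fun z => χ i z • X z) x := by
    intro x hx
    rw [← surfaceDiv_sum fun i => (hXi i).differentiable (by simp) x]
    refine surfaceDiv_congr ?_
    filter_upwards [hsum x hx] with z hz
    rw [← Finset.sum_smul, hz, one_smul]
  have h2 : surfaceDiv Ω X =ᵐ[area Ω] fun x => ∑ i, surfaceDiv Ω (fun z => χ i z • X z) x := by
    filter_upwards [ae_area_mem hΩ.measurableSet] with x hx using h1 x hx
  rw [integral_congr_ae h2, integral_finsetSum _ fun i _ =>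
    hΩ.integrable_of_continuousOn (hΩ.continuousOn_surfaceDiv (hXi i) (hTi i))]
  refine Finset.sum_eq_zero fun i _ => ?_
  obtain ⟨U, p, g, h⟩ := hW i
  exact h.integral_surfaceDiv hΩ (hXi i) (hTi i)
    ((closure_mono fun x hx => left_ne_zero_of_smul hx).trans (hχW i))

/-! ### Vector fields with prescribed coordinates -/

/-- Compactly supported coordinates in a chart define a smooth tangential field on the ambient
space, supported in the domain of the chart. -/
theorem IsChart.exists_field {W : Set (Euc n)} {U : Set (Euc 2)} {p : Euc 2 → Euc n}
    {g : Euc n → Euc 2} (h : IsChart Ω W U p g) {ξ : Fin 2 → Euc 2 → ℝ}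
    (hξ : ∀ i, ContDiffOn ℝ ∞ (ξ i) U) {K : Set (Euc 2)} (hK : IsCompact K) (hKU : K ⊆ U)
    (h0 : ∀ i, ∀ y ∈ U, y ∉ K → ξ i y = 0) :
    ∃ X : Euc n → Euc n, ContDiff ℝ ∞ X ∧ (∀ x ∈ Ω, X x ∈ tangentPlane Ω x) ∧ tsupport X ⊆ W ∧
      ∀ y ∈ U, X (p y) = ξ 0 y • pd 0 p y + ξ 1 y • pd 1 p y := by
  obtain ⟨χ, hχ, hχ1, hχW⟩ := exists_contDiff_one_tsupport_subset
    (hK.image_of_continuousOn (h.contDiffOn_p.continuousOn.mono hKU)) h.isOpen_W (by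
      rintro _ ⟨y, hy, rfl⟩
      exact h.p_mem_W y (hKU hy))
  set Y : Euc n → Euc n := fun z => ξ 0 (g z) • pd 0 p (g z) + ξ 1 (g z) • pd 1 p (g z) with hY
  have hYs : ContDiffOn ℝ ∞ Y W :=
    (((hξ 0).smul (contDiffOn_pd h.isOpen_U h.contDiffOn_p 0)).add
      ((hξ 1).smul (contDiffOn_pd h.isOpen_U h.contDiffOn_p 1))).comp h.contDiffOn_g h.g_mem
  have hχ0 : ∀ x, x ∉ tsupport χ → χ x • Y x = 0 := fun x hx => by
    rw [image_eq_zero_of_notMem_tsupport hx, zero_smul]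
  refine ⟨fun z => χ z • Y z, contDiff_of_contDiffOn_of_eq_zero h.isOpen_W
    (hχ.contDiffOn.smul hYs) (isClosed_tsupport χ) hχW hχ0, fun x hx => ?_,
    (closure_mono fun x hx => left_ne_zero_of_smul hx).trans hχW, fun y hy => ?_⟩
  · by_cases hxW : x ∈ W
    · refine Submodule.smul_mem _ _ ?_
      have h1 := h.tangentPlane_eq (h.g_mem x hxW)
      rw [h.p_g x hx hxW] at h1
      rw [h1]
      exact Submodule.add_mem _ (Submodule.smul_mem _ _ ⟨_, rfl⟩) (Submodule.smul_mem _ _ ⟨_, rfl⟩)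
    · change χ x • Y x ∈ _
      rw [hχ0 x fun hs => hxW (hχW hs)]
      exact Submodule.zero_mem _
  · change χ (p y) • Y (p y) = _
    by_cases hyK : y ∈ K
    · rw [hχ1 _ (mem_image_of_mem p hyK), one_smul, hY]
      simp only [h.g_p y hy]
    · rw [hY]
      simp only [h.g_p y hy, h0 _ y hy hyK, zero_smul, add_zero, smul_zero]

/-- Almost everywhere statements on `Ω` may be checked in charts. -/
theorem IsClosedSurface.ae_of_charts (hΩ : IsClosedSurface Ω) {P : Euc n → Prop}
    (hP : ∀ W U p g, IsChart Ω W U p g → ∀ᵐ y ∂volume, y ∈ U → P (p y)) : ∀ᵐ x ∂area Ω, P x := by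
  have h1 : area Ω (Ω ∩ {x | ¬ P x}) = 0 := by
    refine measure_null_of_locally_null _ fun x hx => ?_
    obtain ⟨W, U, p, g, h, hxW⟩ := hΩ.exists_chart hx.1
    refine ⟨W ∩ {x | ¬ P x}, ?_, ?_⟩
    · filter_upwards [self_mem_nhdsWithin, mem_nhdsWithin_of_mem_nhds (h.isOpen_W.mem_nhds hxW)]
        with z hz hzW using ⟨hzW, hz.2⟩
    · rw [measure_eq_zero_iff_ae_notMem]
      filter_upwards [(h.ae_iff hΩ.measurableSet).2 (hP W U p g h)] with z hz hz'
        using hz'.2 (hz hz'.1)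
  filter_upwards [measure_eq_zero_iff_ae_notMem.1 h1, ae_area_mem hΩ.measurableSet] with x hx hxΩ
  by_contra hPx
  exact hx ⟨hxΩ, hPx⟩

theorem IsClosedSurface.integrable_of_memLp (hΩ : IsClosedSurface Ω) {F : Type*}
    [NormedAddCommGroup F] (u : Lp F 2 (area Ω)) : Integrable u (area Ω) := by
  have := hΩ.isFiniteMeasure
  exact (Lp.memLp u).integrable (by norm_num)

/-- The weak gradient of the zero function vanishes. -/
theorem IsClosedSurface.eq_zero_of_hasWeakGrad_zero (hΩ : IsClosedSurface Ω) {w : L2Vec Ω}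
    (hw : HasWeakGrad 0 w) : w = 0 := by
  have hint : ∀ X : Euc n → Euc n, ContDiff ℝ ∞ X → (∀ x ∈ Ω, X x ∈ tangentPlane Ω x) →
      Integrable (fun x => inner ℝ (w x) (X x)) (area Ω) ∧
      ∫ x, inner ℝ (w x) (X x) ∂area Ω = 0 := by
    intro X hX hT
    obtain ⟨-, h2, h3⟩ := hw.2 X hX hT
    refine ⟨h2, ?_⟩
    have h4 : (fun x => (0 : L2 Ω) x * surfaceDiv Ω X x) =ᵐ[area Ω] fun _ => 0 := by
      filter_upwards [Lp.coeFn_zero ℝ 2 (area Ω)] with x hx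
      rw [hx, Pi.zero_apply, zero_mul]
    rw [integral_congr_ae h4, integral_zero] at h3
    linarith
  have key : ∀ᵐ x ∂area Ω, w x = 0 := by
    refine hΩ.ae_of_charts fun W U p g h => ?_
    have hwp := h.aestronglyMeasurable_comp hΩ.measurableSet (Lp.aestronglyMeasurable w).restrict
    have hpc : ∀ i, ContinuousOn (pd i p) U := fun i =>
      (contDiffOn_pd h.isOpen_U h.contDiffOn_p i).continuousOn
    -- Fields of the form `η ∂ᵢp` test the tangential components of `w`.
    have h1 : ∀ i : Fin 2, ∀ᵐ y ∂volume, y ∈ U →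
        areaDensity p y * inner ℝ (w (p y)) (pd i p y) = 0 := by
      intro i
      have hloc : IntegrableOn (fun y => areaDensity p y * inner ℝ (w (p y)) (pd i p y)) U := by
        obtain ⟨C, hC⟩ := h.lipschitz
        have h2 := (h.integrableOn hΩ.measurableSet
          (hΩ.integrable_of_memLp w).norm.integrableOn).mul_const
            ((C : ℝ) * ‖(EuclideanSpace.single i 1 : Euc 2)‖)
        refine h2.mono' (h.aemeasurable_areaDensity.aestronglyMeasurable.mul
          (hwp.inner ((hpc i).aestronglyMeasurable h.isOpen_U.measurableSet))) ?_
        filter_upwards [ae_restrict_mem h.isOpen_U.measurableSet] with y hy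
        rw [norm_mul, Real.norm_of_nonneg (areaDensity_nonneg p y), mul_assoc]
        refine mul_le_mul_of_nonneg_left ((norm_inner_le_norm _ _).trans ?_)
          (areaDensity_nonneg p y)
        refine mul_le_mul_of_nonneg_left (((fderiv ℝ p y).le_opNorm _).trans ?_) (norm_nonneg _)
        exact mul_le_mul_of_nonneg_right
          (norm_fderiv_le_of_lipschitzOn ℝ (h.isOpen_U.mem_nhds hy) hC) (norm_nonneg _)
      refine h.isOpen_U.ae_eq_zero_of_integral_contDiff_smul_eq_zero hloc.locallyIntegrableOn ?_
      intro η hη hηc hηU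
      obtain ⟨X, hX, hT, hXW, hXp⟩ := h.exists_field (ξ := fun j y => if j = i then η y else 0)
        (fun j => by by_cases hj : j = i <;> simp [hj, hη.contDiffOn, contDiffOn_const]) hηc hηU
        (fun j y _ hy => by simp [image_eq_zero_of_notMem_tsupport hy])
      obtain ⟨h3, h4⟩ := hint X hX hT
      rw [h.integral_eq hΩ.measurableSet h3.aestronglyMeasurable fun x _ hx => by
        rw [image_eq_zero_of_notMem_tsupport fun hs => hx (hXW hs), inner_zero_right]] at h4
      rw [← setIntegral_eq_integral_of_forall_compl_eq_zero (s := U) fun y hy => by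
        rw [image_eq_zero_of_notMem_tsupport fun hs => hy (hηU hs), zero_smul], ← h4]
      refine setIntegral_congr_fun h.isOpen_U.measurableSet fun y hy => ?_
      have h5 : X (p y) = η y • pd i p y := by
        rw [hXp y hy]
        fin_cases i <;> simp
      simp only [h5, real_inner_smul_right, smul_eq_mul]
      ring
    have h2 : ∀ᵐ y ∂volume, y ∈ U → w (p y) ∈ tangentPlane Ω (p y) := by
      refine (h.ae_iff (P := fun x => w x ∈ tangentPlane Ω x) hΩ.measurableSet).1 ?_
      filter_upwards [hw.1] with x hx _ using hx
    filter_upwards [h1 0, h1 1, h2] with y hy0 hy1 hy2 hyU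
    have hρ := (h.areaDensity_pos hyU).ne'
    have e0 := (mul_eq_zero.1 (hy0 hyU)).resolve_left hρ
    have e1 := (mul_eq_zero.1 (hy1 hyU)).resolve_left hρ
    have h3 := hy2 hyU
    rw [h.tangentPlane_eq hyU] at h3
    obtain ⟨v, hv⟩ := h3
    have hv' : fderiv ℝ p y v = w (p y) := hv
    rw [IsChart.fderiv_p_eq] at hv'
    have h6 : inner ℝ (w (p y)) (w (p y)) = (0 : ℝ) := by
      nth_rewrite 2 [← hv']
      rw [inner_add_right, real_inner_smul_right, real_inner_smul_right, e0, e1]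
      simp
    exact inner_self_eq_zero.1 h6
  exact (Lp.eq_zero_iff_ae_eq_zero).2 key

theorem IsClosedSurface.hasWeakGrad_unique (hΩ : IsClosedSurface Ω) {ψ : L2 Ω} {w z : L2Vec Ω}
    (hw : HasWeakGrad ψ w) (hz : HasWeakGrad ψ z) : w = z := by
  have h := hw.add (hz.smul (-1))
  rw [neg_one_smul, neg_one_smul, add_neg_cancel] at h
  have := hΩ.eq_zero_of_hasWeakGrad_zero h
  rwa [← sub_eq_add_neg, sub_eq_zero] at this

/-! ### Functions with vanishing weak gradient -/

open scoped Convolution in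
/-- A function on the plane whose distributional derivatives vanish is locally constant almost
everywhere: its mollifications have zero derivative. -/
theorem exists_ae_eq_const_of_integral_pd_eq_zero {U : Set (Euc 2)} (hU : IsOpen U)
    {f : Euc 2 → ℝ} (hf : LocallyIntegrableOn f U)
    (h : ∀ (i : Fin 2) (η : Euc 2 → ℝ), ContDiff ℝ ∞ η → HasCompactSupport η → tsupport η ⊆ U →
      ∫ y, f y * pd i η y = 0) {y₀ : Euc 2} (hy₀ : y₀ ∈ U) :
    ∃ r > 0, ∃ c, ball y₀ r ⊆ U ∧ ∀ᵐ y ∂volume, y ∈ ball y₀ r → f y = c := by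
  obtain ⟨R, hR, hRU⟩ := Metric.nhds_basis_closedBall.mem_iff.1 (hU.mem_nhds hy₀)
  set r := R / 2 with hr
  have hr0 : 0 < r := by positivity
  -- The truncation `F` is integrable on the whole plane, and mollifying it at points of the smaller
  -- ball with radii less than `r` sees only values of `f`.
  set F := (closedBall y₀ R).indicator f with hF
  have hFint : Integrable F := by
    rw [hF, integrable_indicator_iff measurableSet_closedBall]
    exact hf.integrableOn_compact_subset hRU (isCompact_closedBall _ _)
  let φ : ℕ → ContDiffBump (0 : Euc 2) := fun k =>
    ⟨r / (k + 2) / 2, r / (k + 2), by positivity, by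
      have : 0 < r / ((k : ℝ) + 2) := by positivity
      linarith⟩
  have hφ : Tendsto (fun k => (φ k).rOut) atTop (𝓝 0) := by
    have h1 : Tendsto (fun k : ℕ => r / ((k : ℝ) + 2)) atTop (𝓝 0) :=
      tendsto_const_nhds.div_atTop
        (tendsto_atTop_add_const_right _ _ tendsto_natCast_atTop_atTop)
    exact h1
  have hφr : ∀ k, (φ k).rOut < r := fun k => by
    change r / ((k : ℝ) + 2) < r
    rw [div_lt_iff₀ (by positivity)]
    nlinarith [(Nat.cast_nonneg k : (0 : ℝ) ≤ k)]
  have hconv := ContDiffBump.ae_convolution_tendsto_right_of_locallyIntegrable (μ := volume)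
    (φ := φ) (K := 2) hφ (Eventually.of_forall fun k => by
      change r / ((k : ℝ) + 2) ≤ 2 * (r / ((k : ℝ) + 2) / 2); linarith) hFint.locallyIntegrable
  set u : ℕ → Euc 2 → ℝ := fun k =>
    ((φ k).normed volume ⋆[ContinuousLinearMap.lsmul ℝ ℝ, volume] F) with hu
  have hder : ∀ k, ∀ x ∈ ball y₀ r, HasFDerivAt (u k) (0 : Euc 2 →L[ℝ] ℝ) x := by
    intro k x hx
    have hsm : ContDiff ℝ ∞ ((φ k).normed volume) := (φ k).contDiff_normed
    have h1 := (φ k).hasCompactSupport_normed (μ := volume) |>.hasFDerivAt_convolution_left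
      (ContinuousLinearMap.lsmul ℝ ℝ) (hsm.of_le (by norm_cast)) hFint.locallyIntegrable x
    suffices hz : (fderiv ℝ ((φ k).normed volume) ⋆[(ContinuousLinearMap.lsmul ℝ ℝ).precompL
        (Euc 2), volume] F) x = (0 : Euc 2 →L[ℝ] ℝ) by
      rw [hz] at h1; exact h1
    -- `η` is the mollifier centred at `x`.
    set η : Euc 2 → ℝ := fun s => (φ k).normed volume (x - s) with hη
    have hηd : ∀ s v, fderiv ℝ η s v = -fderiv ℝ ((φ k).normed volume) (x - s) v := by
      intro s v
      have h2 : HasFDerivAt η ((fderiv ℝ ((φ k).normed volume) (x - s)) ∘L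
          (-ContinuousLinearMap.id ℝ (Euc 2))) s :=
        HasFDerivAt.comp s ((hsm.differentiable (by simp)) _).hasFDerivAt
          ((hasFDerivAt_id s).const_sub x)
      rw [h2.fderiv]
      simp
    have hηs : ∀ s, s ∉ closedBall x (φ k).rOut → η s = 0 := by
      intro s hs
      change (φ k).normed volume (x - s) = 0
      refine image_eq_zero_of_notMem_tsupport ?_
      rw [(φ k).tsupport_normed_eq]
      simpa [dist_eq_norm, norm_sub_rev] using hs
    have hsub : closedBall x (φ k).rOut ⊆ closedBall y₀ R := by
      refine closedBall_subset_closedBall' ?_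
      have := hφr k
      have h3 := mem_ball.1 hx
      linarith
    have hηt : tsupport η ⊆ closedBall x (φ k).rOut :=
      closure_minimal (fun s hs => by by_contra hs'; exact hs (hηs s hs')) isClosed_closedBall
    have hz : ∀ i : Fin 2, ∫ y, F y * pd i η y = 0 := by
      intro i
      rw [← h i η (hsm.comp (contDiff_const.sub contDiff_id))
        (HasCompactSupport.intro (isCompact_closedBall _ _) hηs) (hηt.trans (hsub.trans hRU))]
      refine integral_congr_ae (Eventually.of_forall fun y => ?_)
      by_cases hy : y ∈ closedBall y₀ R
      · simp only [hF, indicator_of_mem hy]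
      · have : pd i η y = 0 := by
          rw [pd, fderiv_of_notMem_tsupport ℝ fun hs => hy (hsub (hηt hs))]; simp
        simp only [this, mul_zero]
    have hz' : ∀ i : Fin 2, ((fderiv ℝ ((φ k).normed volume) ⋆[(ContinuousLinearMap.lsmul ℝ ℝ).precompL
        (Euc 2), volume] F) x) (EuclideanSpace.single i 1) = 0 := by
      intro i
      rw [convolution_eq_swap]
      have hcc : HasCompactSupport (fderiv ℝ ((φ k).normed volume)) :=
        (φ k).hasCompactSupport_normed.fderiv ℝ
      have hex : Integrable (fun t => ((ContinuousLinearMap.lsmul ℝ ℝ).precompL (Euc 2)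
          (fderiv ℝ ((φ k).normed volume) (x - t))) (F t)) :=
        (hcc.convolutionExists_left _ (hsm.continuous_fderiv (by simp))
          hFint.locallyIntegrable x).integrable_swap
      rw [ContinuousLinearMap.integral_apply hex]
      have h4 := hz i
      rw [← neg_eq_zero, ← integral_neg] at h4
      rw [← h4]
      refine integral_congr_ae (Eventually.of_forall fun t => ?_)
      simp only [pd, hηd]
      simp [ContinuousLinearMap.precompL_apply, mul_comm]
    refine ContinuousLinearMap.ext fun v => ?_
    have : v = v 0 • EuclideanSpace.single 0 (1 : ℝ) + v 1 • EuclideanSpace.single 1 (1 : ℝ) := by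
      ext i; fin_cases i <;> simp
    rw [this, map_add, map_add, map_smul, map_smul, map_smul, map_smul, hz', hz']
    simp
  have hconst : ∀ k, ∀ x ∈ ball y₀ r, ∀ z ∈ ball y₀ r, u k x = u k z := by
    intro k x hx z hz
    refine isOpen_ball.is_const_of_fderiv_eq_zero (𝕜 := ℝ) (convex_ball y₀ r).isPreconnected
      (fun x hx => ((hder k x hx).differentiableAt).differentiableWithinAt)
      (fun x hx => (hder k x hx).fderiv) hx hz
  obtain ⟨x₁, hx₁, hx₁'⟩ : ∃ x₁ ∈ ball y₀ r, Tendsto (fun k => u k x₁) atTop (𝓝 (F x₁)) := by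
    by_contra! hcon
    have h5 : ∀ᵐ x ∂volume, x ∉ ball y₀ r := by
      filter_upwards [hconv] with x hx hx'
      exact hcon x hx' hx
    exact (measure_ball_pos volume y₀ hr0).ne' (measure_eq_zero_iff_ae_notMem.2 h5)
  have hbR : ball y₀ r ⊆ closedBall y₀ R :=
    ball_subset_closedBall.trans (closedBall_subset_closedBall (by linarith))
  refine ⟨r, hr0, F x₁, hbR.trans hRU, ?_⟩
  filter_upwards [hconv] with x hx hxb
  have h6 : F x = F x₁ := tendsto_nhds_unique hx
    (hx₁'.congr fun k => hconst k x₁ hx₁ x hxb)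
  rwa [hF, indicator_of_mem (hbR hxb), ← hF] at h6

/-- A function on a connected closed surface which is locally constant almost everywhere is constant
almost everywhere. -/
theorem IsClosedSurface.exists_ae_eq_const (hΩ : IsClosedSurface Ω) {f : Euc n → ℝ}
    (h : ∀ x ∈ Ω, ∃ N ∈ 𝓝 x, ∃ c, ∀ᵐ z ∂area Ω, z ∈ N → f z = c) :
    ∃ c, ∀ᵐ z ∂area Ω, f z = c := by
  choose N hN c hc using fun x : Ω => h x x.2
  have hloc : IsLocallyConstant c := by
    rw [IsLocallyConstant.iff_eventually_eq]
    intro x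
    have h1 : ∀ᶠ z in 𝓝 (x : Euc n), N x ∈ 𝓝 z := eventually_mem_nhds_iff.2 (hN x)
    filter_upwards [continuous_subtype_val.continuousAt.eventually h1] with z hz
    by_contra hne
    have h2 := hΩ.area_pos z.2 (inter_mem hz (hN z))
    refine h2.ne' (measure_eq_zero_iff_ae_notMem.2 ?_)
    filter_upwards [hc x, hc z] with t h3 h4 ht
    exact hne ((h4 ht.2).symm.trans (h3 ht.1))
  have : PreconnectedSpace Ω := Subtype.preconnectedSpace hΩ.isConnected.isPreconnected
  obtain ⟨x₀, hx₀⟩ := hΩ.isConnected.nonempty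
  refine ⟨c ⟨x₀, hx₀⟩, ?_⟩
  have h3 : area Ω (Ω ∩ {x | ¬ f x = c ⟨x₀, hx₀⟩}) = 0 := by
    refine measure_null_of_locally_null _ fun x hx => ?_
    refine ⟨N ⟨x, hx.1⟩ ∩ {z | ¬ f z = c ⟨x₀, hx₀⟩}, ?_, ?_⟩
    · filter_upwards [self_mem_nhdsWithin, mem_nhdsWithin_of_mem_nhds (hN ⟨x, hx.1⟩)]
        with z hz hzN using ⟨hzN, hz.2⟩
    · rw [measure_eq_zero_iff_ae_notMem]
      filter_upwards [hc ⟨x, hx.1⟩] with z hz hz'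
      refine hz'.2 ((hz hz'.1).trans ?_)
      exact hloc.apply_eq_of_preconnectedSpace _ _
  filter_upwards [measure_eq_zero_iff_ae_notMem.1 h3, ae_area_mem hΩ.measurableSet] with x hx hxΩ
  by_contra hfx
  exact hx ⟨hxΩ, hfx⟩

/-- In a chart, the field with the single coordinate `ξⁱ = η / ρ` has divergence `∂ᵢη / ρ`. Testing with
it shows that the function has vanishing distributional derivatives in the coordinates. -/
theorem IsClosedSurface.isConst_of_hasWeakGrad_zero (hΩ : IsClosedSurface Ω) {ψ : L2 Ω}
    (h0 : HasWeakGrad ψ 0) : IsConst ψ := by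
  have hint : ∀ X : Euc n → Euc n, ContDiff ℝ ∞ X → (∀ x ∈ Ω, X x ∈ tangentPlane Ω x) →
      Integrable (fun x => ψ x * surfaceDiv Ω X x) (area Ω) ∧
      ∫ x, ψ x * surfaceDiv Ω X x ∂area Ω = 0 := by
    intro X hX hT
    obtain ⟨h2, -, h3⟩ := h0.2 X hX hT
    refine ⟨h2, h3.trans ?_⟩
    have h4 : (fun x => inner ℝ ((0 : L2Vec Ω) x) (X x)) =ᵐ[area Ω] fun _ => (0 : ℝ) := by
      filter_upwards [Lp.coeFn_zero (Euc n) 2 (area Ω)] with x hx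
      rw [hx, Pi.zero_apply, inner_zero_left]
    rw [integral_congr_ae h4, integral_zero, neg_zero]
  refine hΩ.exists_ae_eq_const fun x hx => ?_
  obtain ⟨W, U, p, g, h, hxW⟩ := hΩ.exists_chart hx
  have hloc : LocallyIntegrableOn (fun y => ψ (p y)) U := by
    have h1 : LocallyIntegrableOn (fun y => areaDensity p y * ψ (p y)) U :=
      (h.integrableOn hΩ.measurableSet (hΩ.integrable_of_memLp ψ).integrableOn).locallyIntegrableOn
    have h2 := h1.continuousOn_mul (g := fun y => (areaDensity p y)⁻¹)
      (h.contDiffOn_areaDensity.continuousOn.inv₀ fun y hy => (h.areaDensity_pos hy).ne')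
      h.isOpen_U.isLocallyClosed
    refine (locallyIntegrableOn_congr ?_).1 h2
    filter_upwards [ae_restrict_mem h.isOpen_U.measurableSet] with y hy
    rw [inv_mul_cancel_left₀ (h.areaDensity_pos hy).ne']
  obtain ⟨r, hr, c, hrU, hc⟩ := exists_ae_eq_const_of_integral_pd_eq_zero h.isOpen_U hloc (by
    intro i η hη hηc hηU
    have hdiv : ContDiffOn ℝ ∞ (fun y => η y / areaDensity p y) U :=
      hη.contDiffOn.div h.contDiffOn_areaDensity fun y hy => (h.areaDensity_pos hy).ne'
    obtain ⟨X, hX, hT, hXW, hXp⟩ := h.exists_field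
      (ξ := fun j y => if j = i then η y / areaDensity p y else 0)
      (fun j => by by_cases hj : j = i <;> simp [hj, hdiv, contDiffOn_const]) hηc hηU
      (fun j y _ hy => by simp [image_eq_zero_of_notMem_tsupport hy])
    obtain ⟨h3, h4⟩ := hint X hX hT
    rw [h.integral_eq hΩ.measurableSet h3.aestronglyMeasurable fun x _ hx => by
      rw [surfaceDiv_eq_zero_of_notMem_tsupport fun hs => hx (hXW hs), mul_zero]] at h4
    rw [← setIntegral_eq_integral_of_forall_compl_eq_zero (s := U) fun y hy => by
      rw [pd, fderiv_of_notMem_tsupport ℝ fun hs => hy (hηU hs)]; simp, ← h4]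
    refine setIntegral_congr_fun h.isOpen_U.measurableSet fun y hy => ?_
    have hdy : DifferentiableAt ℝ (fun y => η y / areaDensity p y) y :=
      (hdiv.contDiffAt (h.isOpen_U.mem_nhds hy)).differentiableAt (by simp)
    have h5 := h.areaDensity_mul_surfaceDiv hy ((hX.differentiable (by simp)) _)
      (ξ₀ := fun y => if 0 = i then η y / areaDensity p y else 0)
      (ξ₁ := fun y => if 1 = i then η y / areaDensity p y else 0)
      (by fin_cases i <;> simp [hdy]) (by fin_cases i <;> simp [hdy]) hXp
    have h6 : pd i (fun z => areaDensity p z * (η z / areaDensity p z)) y = pd i η y := by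
      refine pd_congr ?_
      filter_upwards [h.isOpen_U.mem_nhds hy] with z hz
      exact mul_div_cancel₀ _ (h.areaDensity_pos hz).ne'
    have h7 : areaDensity p y * surfaceDiv Ω X (p y) = pd i η y := by
      rw [h5, ← h6]
      fin_cases i <;> simp [pd]
    change ψ (p y) * pd i η y = areaDensity p y * (ψ (p y) * surfaceDiv Ω X (p y))
    rw [← h7]; ring) (h.g_mem x hxW)
  refine ⟨W ∩ g ⁻¹' ball (g x) r, inter_mem (h.isOpen_W.mem_nhds hxW)
    ((h.contDiffAt_g hxW).continuousAt.preimage_mem_nhds (ball_mem_nhds _ hr)), c, ?_⟩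
  have h8 := (h.ae_iff (P := fun z => g z ∈ ball (g x) r → ψ z = c) hΩ.measurableSet).2 (by
    filter_upwards [hc] with y hy hyU hyb
    rw [h.g_p y hyU] at hyb
    exact hy hyb)
  filter_upwards [h8] with z hz hz' using hz hz'.1 hz'.2

/-- Constants have zero weak gradient: this is the divergence theorem. -/
theorem IsClosedSurface.hasWeakGrad_zero_of_isConst (hΩ : IsClosedSurface Ω) {ψ : L2 Ω}
    (hψ : IsConst ψ) : HasWeakGrad ψ 0 := by
  obtain ⟨c, hc⟩ := hψ
  refine ⟨HasWeakGrad.zero.1, fun X hX hT => ⟨?_, (HasWeakGrad.zero.2 X hX hT).2.1, ?_⟩⟩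
  · refine ((hΩ.integrable_of_continuousOn
      (hΩ.continuousOn_surfaceDiv hX hT)).const_mul c).congr ?_
    filter_upwards [hc] with x hx
    rw [hx]
  · have h1 : (fun x => ψ x * surfaceDiv Ω X x) =ᵐ[area Ω] fun x => c * surfaceDiv Ω X x := by
      filter_upwards [hc] with x hx
      rw [hx]
    rw [integral_congr_ae h1, integral_const_mul, hΩ.integral_surfaceDiv hX hT, mul_zero]
    have h4 : (fun x => inner ℝ ((0 : L2Vec Ω) x) (X x)) =ᵐ[area Ω] fun _ => (0 : ℝ) := by
      filter_upwards [Lp.coeFn_zero (Euc n) 2 (area Ω)] with x hx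
      rw [hx, Pi.zero_apply, inner_zero_left]
    rw [integral_congr_ae h4, integral_zero, neg_zero]

/-! ### Density of polynomials and the weak divergence -/

/-- The polynomial function on Euclidean space defined by `q`. -/
noncomputable def polyFun (q : MvPolynomial (Fin n) ℝ) (x : Euc n) : ℝ :=
  MvPolynomial.eval (fun i => x i) q

theorem contDiff_polyFun (q : MvPolynomial (Fin n) ℝ) : ContDiff ℝ ∞ (polyFun q) := by
  have hc : ∀ i : Fin n, ContDiff ℝ ∞ fun x : Euc n => x i := fun i =>
    (EuclideanSpace.proj i : Euc n →L[ℝ] ℝ).contDiff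
  unfold polyFun
  induction q using MvPolynomial.induction_on with
  | C a => simpa using contDiff_const
  | add p q hp hq => simpa using hp.add hq
  | mul_X p i hp => simpa using hp.mul (hc i)

/-- The Stone–Weierstrass theorem for polynomials on a compact subset of Euclidean space. -/
theorem exists_polyFun_near (hΩ : IsCompact Ω) {φ : Euc n → ℝ} (hφ : Continuous φ) {ε : ℝ}
    (hε : 0 < ε) : ∃ q : MvPolynomial (Fin n) ℝ, ∀ x ∈ Ω, |polyFun q x - φ x| < ε := by
  have : CompactSpace Ω := isCompact_iff_compactSpace.1 hΩ
  let c : Fin n → C(Ω, ℝ) := fun i => ⟨fun x => (x : Euc n) i, by fun_prop⟩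
  let A : Subalgebra ℝ C(Ω, ℝ) := (MvPolynomial.aeval c : MvPolynomial (Fin n) ℝ →ₐ[ℝ] C(Ω, ℝ)).range
  have hA : A.SeparatesPoints := by
    intro x y hxy
    have : ∃ i, (x : Euc n) i ≠ (y : Euc n) i := by
      by_contra! hall
      exact hxy (Subtype.ext (PiLp.ext hall))
    obtain ⟨i, hi⟩ := this
    exact ⟨c i, ⟨c i, ⟨MvPolynomial.X i, by simp⟩, rfl⟩, hi⟩
  obtain ⟨⟨_, ⟨q, rfl⟩⟩, hq⟩ := ContinuousMap.exists_mem_subalgebra_near_continuous_of_separatesPoints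
    A hA (fun x : Ω => φ x) (hφ.comp continuous_subtype_val) ε hε
  refine ⟨q, fun x hx => ?_⟩
  have h1 := hq ⟨x, hx⟩
  rw [Real.norm_eq_abs] at h1
  convert h1 using 3
  have h2 : ∀ q : MvPolynomial (Fin n) ℝ, (MvPolynomial.aeval c q) ⟨x, hx⟩ = polyFun q x := by
    intro q
    unfold polyFun
    induction q using MvPolynomial.induction_on with
    | C a => simp
    | add p q hp hq => simp [hp, hq]
    | mul_X p i hp => simp [hp, c]
  exact (h2 q).symm

theorem IsClosedSurface.ae_eq_zero_of_integral_polyFun_eq_zero (hΩ : IsClosedSurface Ω)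
    {f : Euc n → ℝ} (hf : Integrable f (area Ω))
    (h : ∀ q : MvPolynomial (Fin n) ℝ, ∫ x, f x * polyFun q x ∂area Ω = 0) :
    ∀ᵐ x ∂area Ω, f x = 0 := by
  refine ae_eq_zero_of_integral_contDiff_smul_eq_zero hf.locallyIntegrable fun φ hφ _ => ?_
  have hint : ∀ ψ : Euc n → ℝ, Continuous ψ → Integrable (fun x => f x * ψ x) (area Ω) := by
    intro ψ hψ
    obtain ⟨C, hC⟩ := hΩ.isCompact.exists_bound_of_continuousOn hψ.continuousOn
    exact hf.mul_bdd (c := C) hψ.aestronglyMeasurable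
      ((ae_area_mem hΩ.measurableSet).mono fun x hx => hC x hx)
  have hle : ∀ ε > 0, |∫ x, φ x • f x ∂area Ω| ≤ ε * ∫ x, |f x| ∂area Ω := by
    intro ε hε
    obtain ⟨q, hq⟩ := exists_polyFun_near hΩ.isCompact hφ.continuous hε
    have h1 : ∫ x, φ x • f x ∂area Ω = ∫ x, (f x * φ x - f x * polyFun q x) ∂area Ω := by
      rw [integral_sub (hint φ hφ.continuous) (hint _ (contDiff_polyFun q).continuous), h q, sub_zero]
      simp only [smul_eq_mul, mul_comm]
    rw [h1, ← integral_const_mul, ← Real.norm_eq_abs]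
    refine norm_integral_le_of_norm_le (hf.abs.const_mul ε) ?_
    filter_upwards [ae_area_mem hΩ.measurableSet] with x hx
    rw [← mul_sub, norm_mul, mul_comm, Real.norm_eq_abs, Real.norm_eq_abs, abs_sub_comm]
    exact mul_le_mul_of_nonneg_right (hq x hx).le (abs_nonneg _)
  by_contra hne
  have hpos : 0 < |∫ x, φ x • f x ∂area Ω| := abs_pos.2 hne
  set I := ∫ x, |f x| ∂area Ω
  have hI : 0 ≤ I := integral_nonneg fun x => abs_nonneg _
  have h2 := hle (|∫ x, φ x • f x ∂area Ω| / (2 * (I + 1))) (by positivity)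
  rw [div_mul_eq_mul_div, le_div_iff₀ (by positivity)] at h2
  nlinarith

theorem IsClosedSurface.hasWeakDiv_unique (hΩ : IsClosedSurface Ω) {u : L2Vec Ω} {d e : L2 Ω}
    (hd : HasWeakDiv u d) (he : HasWeakDiv u e) : d = e := by
  have h := hd.add (he.smul (-1))
  rw [neg_one_smul, neg_one_smul, add_neg_cancel, ← sub_eq_add_neg] at h
  rw [← sub_eq_zero]
  refine Lp.eq_zero_iff_ae_eq_zero.2 (hΩ.ae_eq_zero_of_integral_polyFun_eq_zero
    (hΩ.integrable_of_memLp _) fun q => ?_)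
  rw [(h.2 _ (contDiff_polyFun q)).2.2]
  have h2 : (fun x => fderiv ℝ (polyFun q) x ((0 : L2Vec Ω) x)) =ᵐ[area Ω] fun _ => 0 := by
    filter_upwards [Lp.coeFn_zero (Euc n) 2 (area Ω)] with x hx
    rw [hx, Pi.zero_apply, map_zero]
  rw [integral_congr_ae h2, integral_zero, neg_zero]

/-! ### Rotation fields and the curl -/

section Rotation

variable {T : Submodule ℝ (Euc n)} {A : Euc n →L[ℝ] Euc n}

theorem rotation_skew (ho : ∀ v ∈ T, inner ℝ (A v) v = 0) {v w : Euc n} (hv : v ∈ T) (hw : w ∈ T) :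
    inner ℝ (A v) w = -inner ℝ (A w) v := by
  have h := ho (v + w) (T.add_mem hv hw)
  rw [map_add, inner_add_left, inner_add_right, inner_add_right, ho v hv, ho w hw] at h
  linarith

theorem rotation_inner (hn : ∀ v ∈ T, ‖A v‖ = ‖v‖) {v w : Euc n} (hv : v ∈ T) (hw : w ∈ T) :
    inner ℝ (A v) (A w) = inner ℝ v w := by
  rw [real_inner_eq_norm_add_mul_self_sub_norm_mul_self_sub_norm_mul_self_div_two, ← map_add,
    hn _ (T.add_mem hv hw), hn v hv, hn w hw,
    ← real_inner_eq_norm_add_mul_self_sub_norm_mul_self_sub_norm_mul_self_div_two]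

/-- A rotation by a right angle is minus its own inverse. -/
theorem rotation_rotation (hm : ∀ v ∈ T, A v ∈ T) (hn : ∀ v ∈ T, ‖A v‖ = ‖v‖)
    (ho : ∀ v ∈ T, inner ℝ (A v) v = 0) {v : Euc n} (hv : v ∈ T) : A (A v) = -v := by
  have h1 : A (A v) + v ∈ T := T.add_mem (hm _ (hm _ hv)) hv
  have h2 : ∀ w ∈ T, inner ℝ (A (A v) + v) w = 0 := by
    intro w hw
    rw [inner_add_left, rotation_skew ho (hm v hv) hw, rotation_inner hn hw hv, real_inner_comm]
    ring
  rw [← add_eq_zero_iff_eq_neg]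
  exact inner_self_eq_zero.1 (h2 _ h1)

/-- A rotation by a right angle preserves the area form up to sign. -/
theorem rotation_inner_sq (hm : ∀ v ∈ T, A v ∈ T) (hn : ∀ v ∈ T, ‖A v‖ = ‖v‖)
    (ho : ∀ v ∈ T, inner ℝ (A v) v = 0) {a b : Euc n} (ha : a ∈ T) (ha0 : a ≠ 0)
    (hab : ∀ v ∈ T, ∃ s t : ℝ, v = s • a + t • b) : inner ℝ (A a) b ^ 2 = gramDet a b := by
  obtain ⟨s, t, hst⟩ := hab _ (hm a ha)
  have h1 := ho a ha
  have h2 : inner ℝ (A a) (A a) = (inner ℝ a a : ℝ) := rotation_inner hn ha ha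
  have h3 : inner ℝ (A a) b = s * inner ℝ a b + t * inner ℝ b b := by
    rw [hst, inner_add_left, real_inner_smul_left, real_inner_smul_left]
  have h4 : s * inner ℝ a a + t * inner ℝ a b = 0 := by
    rw [← h1, hst, inner_add_left, real_inner_smul_left, real_inner_smul_left, real_inner_comm a b]
  have h5 : t * inner ℝ (A a) b = (inner ℝ a a : ℝ) := by
    rw [← h2]
    nth_rewrite 3 [hst]
    rw [inner_add_right, real_inner_smul_right, real_inner_smul_right, h1]
    ring
  have hE : (inner ℝ a a : ℝ) ≠ 0 := inner_self_ne_zero.2 ha0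
  refine mul_left_cancel₀ hE ?_
  rw [gramDet]
  set x : ℝ := inner ℝ (A a) b
  linear_combination (x * inner ℝ a a) * h3 + (inner ℝ a a * inner ℝ b b - inner ℝ a b ^ 2) * h5
    + (x * inner ℝ a b) * h4

end Rotation

theorem tangentPlane_rotation {J : Euc n → Euc n →L[ℝ] Euc n} (hJ : IsRotationField Ω J)
    {x : Euc n} (hx : x ∈ Ω) {v : Euc n} (hv : v ∈ tangentPlane Ω x) : J x (J x v) = -v :=
  rotation_rotation (hJ.mapsTo x hx) (hJ.norm_eq x hx) (hJ.orthogonal x hx) hv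

theorem IsClosedSurface.aestronglyMeasurable_rotation (hΩ : IsClosedSurface Ω)
    {J : Euc n → Euc n →L[ℝ] Euc n} (hJ : IsRotationField Ω J) (w : L2Vec Ω) :
    AEStronglyMeasurable (fun x => J x (w x)) (area Ω) :=
  (ContinuousLinearMap.apply ℝ (Euc n)).flip.aestronglyMeasurable_comp₂
    (hJ.continuousOn.aestronglyMeasurable hΩ.measurableSet) (Lp.aestronglyMeasurable w)

/-- The rotated field `k × w`. -/
theorem IsClosedSurface.exists_rotated (hΩ : IsClosedSurface Ω)
    {J : Euc n → Euc n →L[ℝ] Euc n} (hJ : IsRotationField Ω J) {w : L2Vec Ω}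
    (hw : IsTangential w) : ∃ u : L2Vec Ω, ∀ᵐ x ∂area Ω, u x = J x (w x) := by
  have h1 : MemLp (fun x => J x (w x)) 2 (area Ω) := by
    refine (Lp.memLp w).of_le (hΩ.aestronglyMeasurable_rotation hJ w) ?_
    filter_upwards [hw, ae_area_mem hΩ.measurableSet] with x hx hxΩ
    rw [hJ.norm_eq x hxΩ _ hx]
  exact ⟨h1.toLp _, h1.coeFn_toLp⟩

theorem IsClosedSurface.existsUnique_hasCurl (hΩ : IsClosedSurface Ω)
    {J : Euc n → Euc n →L[ℝ] Euc n} (hJ : IsRotationField Ω J) {ψ : L2 Ω} (hψ : ψ ∈ H1 Ω) :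
    ∃! u, HasCurl J ψ u := by
  obtain ⟨w, hw⟩ := hψ
  obtain ⟨u, hu⟩ := hΩ.exists_rotated hJ hw.1
  refine ⟨u, ⟨w, hw, hu⟩, ?_⟩
  rintro v ⟨z, hz, hv⟩
  rw [hΩ.hasWeakGrad_unique hz hw] at hv
  refine Lp.ext ?_
  filter_upwards [hu, hv] with x h1 h2
  rw [h1, h2]

/-- The kernel of `∇^⊥` consists of the constants, as rotation is isometric on tangent planes. -/
theorem IsClosedSurface.hasCurl_zero_iff (hΩ : IsClosedSurface Ω)
    {J : Euc n → Euc n →L[ℝ] Euc n} (hJ : IsRotationField Ω J) {ψ : L2 Ω} :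
    HasCurl J ψ 0 ↔ IsConst ψ := by
  constructor
  · rintro ⟨w, hw, h0⟩
    have : w = 0 := by
      refine Lp.eq_zero_iff_ae_eq_zero.2 ?_
      filter_upwards [h0, Lp.coeFn_zero (Euc n) 2 (area Ω), hw.1, ae_area_mem hΩ.measurableSet]
        with x h1 h2 h3 h4
      have h5 := hJ.norm_eq x h4 _ h3
      rw [← h1, h2, Pi.zero_apply, norm_zero] at h5
      exact norm_eq_zero.1 h5.symm
    rw [this] at hw
    exact hΩ.isConst_of_hasWeakGrad_zero hw
  · intro h
    refine ⟨0, hΩ.hasWeakGrad_zero_of_isConst h, ?_⟩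
    filter_upwards [Lp.coeFn_zero (Euc n) 2 (area Ω)] with x hx
    rw [hx, Pi.zero_apply, map_zero]

/-- In a chart, a rotation field has a constant sign with respect to the area form of the
coordinates. -/
theorem IsChart.exists_sign {W : Set (Euc n)} {U : Set (Euc 2)} {p : Euc 2 → Euc n}
    {g : Euc n → Euc 2} (h : IsChart Ω W U p g) {J : Euc n → Euc n →L[ℝ] Euc n}
    (hJ : IsRotationField Ω J) : ∃ σ : ℝ, σ ^ 2 = 1 ∧ ∀ y ∈ U,
      inner ℝ (J (p y) (pd 0 p y)) (pd 1 p y) = σ * areaDensity p y := by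
  have hpc : ∀ i, ContinuousOn (pd i p) U := fun i =>
    (contDiffOn_pd h.isOpen_U h.contDiffOn_p i).continuousOn
  have hf : ContinuousOn (fun y => (inner ℝ (J (p y) (pd 0 p y)) (pd 1 p y) : ℝ)) U :=
    ((hJ.continuousOn.comp h.contDiffOn_p.continuousOn h.p_mem).clm_apply (hpc 0)).inner (hpc 1)
  have hsq : EqOn ((fun y => (inner ℝ (J (p y) (pd 0 p y)) (pd 1 p y) : ℝ)) ^ 2)
      ((areaDensity p) ^ 2) U := by
    intro y hy
    have hT := h.tangentPlane_eq hy
    simp only [Pi.pow_apply]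
    rw [h.areaDensity_sq hy]
    refine rotation_inner_sq (T := tangentPlane Ω (p y)) (hJ.mapsTo _ (h.p_mem y hy))
      (hJ.norm_eq _ (h.p_mem y hy)) (hJ.orthogonal _ (h.p_mem y hy)) ?_ ?_ ?_
    · rw [hT]; exact ⟨_, rfl⟩
    · intro h0
      have := h.gramDet_pos hy
      rw [h0, gramDet] at this
      simp at this
    · rw [hT]
      rintro _ ⟨v, rfl⟩
      exact ⟨v 0, v 1, fderiv_p_eq y v⟩
  rcases h.convex_U.isPreconnected.eq_or_eq_neg_of_sq_eq hf
    h.contDiffOn_areaDensity.continuousOn hsq fun hy => (h.areaDensity_pos hy).ne' with h1 | h1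
  · exact ⟨1, by norm_num, fun y hy => by rw [one_mul]; exact h1 hy⟩
  · exact ⟨-1, by norm_num, fun y hy => by rw [neg_one_mul]; exact h1 hy⟩

/-- For `φ` supported in a chart, `∫ dφ(k × w)` is minus the pairing of `w` with the field
`k × ∇φ`. This field is divergence-free by the symmetry of second derivatives, so the pairing with a
weak gradient `w` vanishes. -/
theorem IsChart.integral_fderiv_rotation_eq_zero {W : Set (Euc n)} {U : Set (Euc 2)}
    {p : Euc 2 → Euc n} {g : Euc n → Euc 2} (h : IsChart Ω W U p g) (hΩ : IsClosedSurface Ω)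
    {J : Euc n → Euc n →L[ℝ] Euc n} (hJ : IsRotationField Ω J) {ψ : L2 Ω} {w : L2Vec Ω}
    (hw : HasWeakGrad ψ w) {φ : Euc n → ℝ} (hφ : ContDiff ℝ ∞ φ) (hφW : tsupport φ ⊆ W) :
    ∫ x, fderiv ℝ φ x (J x (w x)) ∂area Ω = 0 := by
  obtain ⟨σ, hσ, hσρ⟩ := h.exists_sign hJ
  have hφp : ContDiffOn ℝ ∞ (fun y => φ (p y)) U := hφ.comp_contDiffOn h.contDiffOn_p
  have hK : IsCompact (g '' (Ω ∩ tsupport φ)) :=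
    (hΩ.isCompact.inter_right (isClosed_tsupport φ)).image_of_continuousOn
      (h.contDiffOn_g.continuousOn.mono fun x hx => hφW hx.2)
  have hKU : g '' (Ω ∩ tsupport φ) ⊆ U := by
    rintro _ ⟨x, hx, rfl⟩
    exact h.g_mem x (hφW hx.2)
  have hpd : ∀ i, ∀ y ∈ U, pd i (fun y => φ (p y)) y = fderiv ℝ φ (p y) (pd i p y) := by
    intro i y hy
    change fderiv ℝ (φ ∘ p) y _ = _
    rw [(((hφ.differentiable (by simp)) _).hasFDerivAt.comp y (h.hasFDerivAt_p hy)).fderiv]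
    rfl
  have hpd0 : ∀ i, ∀ y ∈ U, y ∉ g '' (Ω ∩ tsupport φ) → pd i (fun y => φ (p y)) y = 0 := by
    intro i y hy hyK
    rw [hpd i y hy, fderiv_of_notMem_tsupport ℝ fun hs =>
      hyK ⟨p y, ⟨h.p_mem y hy, hs⟩, h.g_p y hy⟩]
    simp
  have hξ : ∀ c i, ContDiffOn ℝ ∞ (fun y => c * pd i (fun y => φ (p y)) y / areaDensity p y) U :=
    fun c i => (contDiffOn_const.mul (contDiffOn_pd h.isOpen_U hφp i)).div h.contDiffOn_areaDensity
      fun y hy => (h.areaDensity_pos hy).ne'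
  -- `X` is the rotated gradient `k × ∇φ`, where `σ` is the orientation of the chart.
  obtain ⟨X, hX, hT, hXW, hXp⟩ := h.exists_field
    (ξ := ![fun y => -σ * pd 1 (fun y => φ (p y)) y / areaDensity p y,
      fun y => σ * pd 0 (fun y => φ (p y)) y / areaDensity p y])
    (fun i => by
      fin_cases i
      · exact hξ _ _
      · exact hξ _ _) hK hKU
    (fun i y hy hyK => by fin_cases i <;> simp [hpd0 _ y hy hyK])
  have hdiv : ∀ x ∈ Ω, surfaceDiv Ω X x = 0 := by
    intro x hx
    by_cases hxW : x ∈ W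
    swap
    · exact surfaceDiv_eq_zero_of_notMem_tsupport fun hs => hxW (hXW hs)
    have hy := h.g_mem x hxW
    rw [← h.p_g x hx hxW]
    set y := g x
    refine (mul_eq_zero.1 ?_).resolve_left (h.areaDensity_pos hy).ne'
    have hdiff : ∀ i, DifferentiableAt ℝ (pd i fun y => φ (p y)) y := fun i =>
      ((contDiffOn_pd h.isOpen_U hφp i).contDiffAt (h.isOpen_U.mem_nhds hy)).differentiableAt
        (by simp)
    rw [h.areaDensity_mul_surfaceDiv hy ((hX.differentiable (by simp)) _)
      (((hξ _ _).contDiffAt (h.isOpen_U.mem_nhds hy)).differentiableAt (by simp))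
      (((hξ _ _).contDiffAt (h.isOpen_U.mem_nhds hy)).differentiableAt (by simp)) hXp]
    have e0 : pd 0 (fun z => areaDensity p z *
        (-σ * pd 1 (fun y => φ (p y)) z / areaDensity p z)) y =
        -σ * pd 0 (pd 1 fun y => φ (p y)) y := by
      rw [pd_congr (g := fun z => -σ * pd 1 (fun y => φ (p y)) z),
        pd_mul (differentiableAt_const _) (hdiff 1)]
      · simp [pd]
      · filter_upwards [h.isOpen_U.mem_nhds hy] with z hz
        exact mul_div_cancel₀ _ (h.areaDensity_pos hz).ne'
    have e1 : pd 1 (fun z => areaDensity p z *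
        (σ * pd 0 (fun y => φ (p y)) z / areaDensity p z)) y =
        σ * pd 1 (pd 0 fun y => φ (p y)) y := by
      rw [pd_congr (g := fun z => σ * pd 0 (fun y => φ (p y)) z),
        pd_mul (differentiableAt_const _) (hdiff 0)]
      · simp [pd]
      · filter_upwards [h.isOpen_U.mem_nhds hy] with z hz
        exact mul_div_cancel₀ _ (h.areaDensity_pos hz).ne'
    refine (congrArg₂ (· + ·) e0 e1).trans ?_
    rw [pd_comm (hφp.contDiffAt (h.isOpen_U.mem_nhds hy))]
    ring
  have hpt : ∀ x ∈ Ω, ∀ v ∈ tangentPlane Ω x, fderiv ℝ φ x (J x v) = -inner ℝ v (X x) := by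
    intro x hx v hv
    by_cases hxW : x ∈ W
    swap
    · rw [fderiv_of_notMem_tsupport ℝ fun hs => hxW (hφW hs),
        image_eq_zero_of_notMem_tsupport fun hs => hxW (hXW hs)]
      simp
    have hy := h.g_mem x hxW
    have hskew : ∀ {v w : Euc n}, v ∈ tangentPlane Ω x → w ∈ tangentPlane Ω x →
      inner ℝ (J x v) w = -inner ℝ (J x w) v := rotation_skew (hJ.orthogonal x hx)
    have hs1 := hσρ _ hy
    have hX1 := hXp _ hy
    have hT1 := h.tangentPlane_eq hy
    have hρ := (h.areaDensity_pos hy).ne'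
    have hd0 := hpd 0 _ hy
    have hd1 := hpd 1 _ hy
    rw [h.p_g x hx hxW] at hs1 hX1 hT1 hd0 hd1
    set y := g x
    have ha : pd 0 p y ∈ tangentPlane Ω x := hT1 ▸ ⟨_, rfl⟩
    have hb : pd 1 p y ∈ tangentPlane Ω x := hT1 ▸ ⟨_, rfl⟩
    have hclaim : ∀ v ∈ tangentPlane Ω x, fderiv ℝ φ x v = inner ℝ (J x v) (X x) := by
      intro v hv
      rw [hT1] at hv
      obtain ⟨v, rfl⟩ := hv
      change fderiv ℝ φ x (fderiv ℝ p y v) = inner ℝ (J x (fderiv ℝ p y v)) (X x)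
      have h1 := hskew hb ha
      rw [fderiv_p_eq, map_add, map_add, map_smul, map_smul, map_smul, map_smul, ← hd0, ← hd1, hX1]
      simp only [inner_add_left, inner_add_right, real_inner_smul_left, real_inner_smul_right,
        hJ.orthogonal x hx _ ha, hJ.orthogonal x hx _ hb, h1, hs1, smul_eq_mul,
        Matrix.cons_val_zero, Matrix.cons_val_one]
      field_simp
      linear_combination areaDensity p y * (-(v 0 * pd 0 (fun y => φ (p y)) y) -
        v 1 * pd 1 (fun y => φ (p y)) y) * hσ
    rw [hclaim _ (hJ.mapsTo x hx v hv), tangentPlane_rotation hJ hx hv, inner_neg_left]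
  have h1 : (fun x => fderiv ℝ φ x (J x (w x))) =ᵐ[area Ω] fun x => -inner ℝ (w x) (X x) := by
    filter_upwards [hw.1, ae_area_mem hΩ.measurableSet] with x hx hxΩ using hpt x hxΩ _ hx
  rw [integral_congr_ae h1, integral_neg, ← (hw.2 X hX hT).2.2]
  have h2 : (fun x => ψ x * surfaceDiv Ω X x) =ᵐ[area Ω] fun _ => 0 := by
    filter_upwards [ae_area_mem hΩ.measurableSet] with x hx
    rw [hdiv x hx, mul_zero]
  rw [integral_congr_ae h2, integral_zero]

theorem IsClosedSurface.integrable_fderiv_apply (hΩ : IsClosedSurface Ω) {φ : Euc n → ℝ}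
    (hφ : ContDiff ℝ ∞ φ) {f : Euc n → Euc n} (hf : Integrable f (area Ω)) :
    Integrable (fun x => fderiv ℝ φ x (f x)) (area Ω) := by
  have hc : Continuous (fderiv ℝ φ) := hφ.continuous_fderiv (by simp)
  obtain ⟨C, hC⟩ := hΩ.isCompact.exists_bound_of_continuousOn hc.continuousOn
  refine (hf.norm.const_mul C).mono' ((ContinuousLinearMap.apply ℝ ℝ).flip.aestronglyMeasurable_comp₂
    hc.aestronglyMeasurable hf.aestronglyMeasurable) ?_
  filter_upwards [ae_area_mem hΩ.measurableSet] with x hx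
  exact ((fderiv ℝ φ x).le_opNorm _).trans (mul_le_mul_of_nonneg_right (hC x hx) (norm_nonneg _))

/-- Curls are divergence free. -/
theorem IsClosedSurface.hasWeakDiv_zero_of_hasCurl (hΩ : IsClosedSurface Ω)
    {J : Euc n → Euc n →L[ℝ] Euc n} (hJ : IsRotationField Ω J) {ψ : L2 Ω} {u : L2Vec Ω}
    (hu : HasCurl J ψ u) : HasWeakDiv u 0 := by
  obtain ⟨w, hw, huw⟩ := hu
  have hTu : IsTangential u := by
    filter_upwards [huw, hw.1, ae_area_mem hΩ.measurableSet] with x h1 h2 h3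
    rw [h1]; exact hJ.mapsTo x h3 _ h2
  have hui := hΩ.integrable_of_memLp u
  refine ⟨hTu, fun φ hφ => ⟨(HasWeakDiv.zero.2 φ hφ).1, hΩ.integrable_fderiv_apply hφ hui, ?_⟩⟩
  have h1 : (fun x => (0 : L2 Ω) x * φ x) =ᵐ[area Ω] fun _ => 0 := by
    filter_upwards [Lp.coeFn_zero ℝ 2 (area Ω)] with x hx
    rw [hx, Pi.zero_apply, zero_mul]
  rw [integral_congr_ae h1, integral_zero, eq_comm, neg_eq_zero]
  obtain ⟨ι, _, χ, W, hχ, hχW, hW, hsum⟩ := hΩ.exists_partition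
  have h2 : (fun x => fderiv ℝ φ x (u x)) =ᵐ[area Ω]
      fun x => ∑ i, fderiv ℝ (fun z => χ i z * φ z) x (u x) := by
    filter_upwards [ae_area_mem hΩ.measurableSet] with x hx
    have h3 : φ =ᶠ[𝓝 x] fun z => ∑ i, χ i z * φ z := by
      filter_upwards [hsum x hx] with z hz
      rw [← Finset.sum_mul, hz, one_mul]
    rw [h3.fderiv_eq, fderiv_fun_sum fun i _ => (((hχ i).mul hφ).differentiable (by simp)) x]
    simp
  rw [integral_congr_ae h2, integral_finsetSum _ fun i _ =>
    hΩ.integrable_fderiv_apply ((hχ i).mul hφ) hui]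
  refine Finset.sum_eq_zero fun i _ => ?_
  obtain ⟨U, p, g, h⟩ := hW i
  rw [← h.integral_fderiv_rotation_eq_zero hΩ hJ hw ((hχ i).mul hφ)
    ((closure_mono fun x hx => left_ne_zero_of_mul hx).trans (hχW i))]
  refine integral_congr_ae ?_
  filter_upwards [huw] with x hx
  rw [hx]

/-! ### The discrete Hodge decomposition -/

/-- A linear relation which is a function on a subspace defines a linear map. -/
theorem exists_linearMap_of_relation {A B : Type*} [AddCommGroup A] [Module ℝ A] [AddCommGroup B]
    [Module ℝ B] {P : Submodule ℝ A} {R : A → B → Prop}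
    (hadd : ∀ a b a' b', R a b → R a' b' → R (a + a') (b + b'))
    (hsmul : ∀ (c : ℝ) a b, R a b → R (c • a) (c • b)) (hex : ∀ a ∈ P, ∃! b, R a b) :
    ∃ f : P →ₗ[ℝ] B, ∀ (a : P) (b : B), R a b ↔ b = f a := by
  choose! f hf hu using hex
  refine ⟨⟨⟨fun a => f a, fun a b => ?_⟩, fun c a => ?_⟩, fun a b => ⟨fun h => hu a a.2 b h, ?_⟩⟩
  · exact (hu _ (P.add_mem a.2 b.2) _ (hadd _ _ _ _ (hf a a.2) (hf b b.2))).symm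
  · exact (hu _ (P.smul_mem c a.2) _ (hsmul c _ _ (hf a a.2))).symm
  · rintro rfl
    exact hf a a.2

/-- The constant function one. -/
theorem IsClosedSurface.exists_one (hΩ : IsClosedSurface Ω) :
    ∃ e : L2 Ω, e ≠ 0 ∧ (∀ᵐ x ∂area Ω, e x = 1) ∧ ∀ f : L2 Ω, IsConst f ↔ f ∈ Submodule.span ℝ {e} := by
  have := hΩ.isFiniteMeasure
  have h1 : MemLp (fun _ : Euc n => (1 : ℝ)) 2 (area Ω) := memLp_const 1
  have he : ∀ᵐ x ∂area Ω, h1.toLp _ x = 1 := h1.coeFn_toLp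
  refine ⟨h1.toLp _, fun h0 => ?_, he, fun f => ?_⟩
  · rw [h0] at he
    obtain ⟨x, hx⟩ := hΩ.isConnected.nonempty
    have h2 := hΩ.area_pos hx univ_mem
    have h3 : ∀ᵐ x ∂area Ω, x ∉ (univ : Set (Euc n)) := by
      filter_upwards [he, Lp.coeFn_zero ℝ 2 (area Ω)] with x h4 h5
      rw [h5] at h4
      simp at h4
    exact h2.ne' (measure_eq_zero_iff_ae_notMem.2 h3)
  · rw [Submodule.mem_span_singleton]
    constructor
    · rintro ⟨c, hc⟩
      refine ⟨c, Lp.ext ?_⟩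
      filter_upwards [hc, he, Lp.coeFn_smul c (h1.toLp _)] with x h2 h3 h4
      rw [h4, Pi.smul_apply, h3, h2, smul_eq_mul, mul_one]
    · rintro ⟨c, rfl⟩
      refine ⟨c, ?_⟩
      filter_upwards [he, Lp.coeFn_smul c (h1.toLp _)] with x h3 h4
      rw [h4, Pi.smul_apply, h3, smul_eq_mul, mul_one]

/-- The divergence-free elements of `S`. -/
def divFree (S : Submodule ℝ (L2Vec Ω)) : Submodule ℝ (L2Vec Ω) where
  carrier := {u | u ∈ S ∧ HasWeakDiv u 0}
  add_mem' := fun ⟨su, hu⟩ ⟨sv, hv⟩ => ⟨S.add_mem su sv, by simpa using hu.add hv⟩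
  zero_mem' := ⟨S.zero_mem, HasWeakDiv.zero⟩
  smul_mem' := fun c _ ⟨su, hu⟩ => ⟨S.smul_mem c su, by simpa using hu.smul c⟩

section Discrete

variable {J : Euc n → Euc n →L[ℝ] Euc n} {E : Submodule ℝ (L2 Ω)} {S : Submodule ℝ (L2Vec Ω)}
  {V : Submodule ℝ (L2 Ω)}

theorem discreteHarmonic_eq : discreteHarmonic J E S = (curlImage J E)ᗮ ⊓ divFree S := by
  ext u
  rw [Submodule.mem_inf, Submodule.mem_orthogonal']
  constructor
  · rintro ⟨h1, h2, h3⟩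
    exact ⟨fun c ⟨ψ, hψ, hc⟩ => h3 ψ hψ c hc, h1, h2⟩
  · rintro ⟨h3, h1, h2⟩
    exact ⟨h1, h2, fun ψ hψ c hc => h3 c ⟨ψ, hψ, hc⟩⟩

theorem curlImage_le_divFree (hΩ : IsClosedSurface Ω) (hJ : IsRotationField Ω J)
    (hC : IsCompatible J E S V) : curlImage J E ≤ divFree S :=
  fun u ⟨ψ, hψ, hu⟩ => ⟨hC.curl_mem ψ hψ u hu, hΩ.hasWeakDiv_zero_of_hasCurl hJ hu⟩

theorem divFree_le : divFree S ≤ S := fun _ h => h.1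

theorem existsUnique_hasWeakDiv (hΩ : IsClosedSurface Ω) (hC : IsCompatible J E S V) {u : L2Vec Ω}
    (hu : u ∈ S) : ∃! d, HasWeakDiv u d := by
  obtain ⟨d, hd⟩ := hC.S_le hu
  exact ⟨d, hd, fun e he => hΩ.hasWeakDiv_unique he hd⟩

/-- The divergence as a linear map `S → V`. -/
theorem exists_divMap (hΩ : IsClosedSurface Ω) (hC : IsCompatible J E S V) :
    ∃ d : S →ₗ[ℝ] V, ∀ (u : S) (e : L2 Ω), HasWeakDiv (u : L2Vec Ω) e ↔ e = d u := by
  obtain ⟨f, hf⟩ := exists_linearMap_of_relation (P := S)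
    (R := fun (u : L2Vec Ω) (d : L2 Ω) => HasWeakDiv u d)
    (fun _ _ _ _ h h' => h.add h') (fun c _ _ h => h.smul c)
    fun u hu => existsUnique_hasWeakDiv hΩ hC hu
  exact ⟨f.codRestrict V fun u => hC.div_mem u u.2 _ ((hf u _).2 rfl), hf⟩

/-- The discrete gradient is minus the adjoint of the divergence. -/
theorem isDiscreteGrad_iff [FiniteDimensional ℝ S] [FiniteDimensional ℝ V] {d : S →ₗ[ℝ] V}
    (hd : ∀ (u : S) (e : L2 Ω), HasWeakDiv (u : L2Vec Ω) e ↔ e = d u) (φ : V) (w : L2Vec Ω) :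
    IsDiscreteGrad S (φ : L2 Ω) w ↔ w = -(LinearMap.adjoint d φ : S) := by
  have key : ∀ v : S, inner ℝ (v : L2Vec Ω) ((LinearMap.adjoint d φ : S) : L2Vec Ω) =
      (inner ℝ (d v : L2 Ω) (φ : L2 Ω) : ℝ) := fun v => LinearMap.adjoint_inner_right d v φ
  constructor
  · rintro ⟨hw, h⟩
    have h1 : ∀ v : S, inner ℝ v (⟨w, hw⟩ + LinearMap.adjoint d φ : S) = 0 := by
      intro v
      have h2 := h v v.2 (d v) ((hd v _).2 rfl)
      rw [inner_add_right]
      change inner ℝ (v : L2Vec Ω) w + inner ℝ (v : L2Vec Ω) ((LinearMap.adjoint d φ : S) : L2Vec Ω) = 0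
      rw [h2, key, neg_add_cancel]
    have h3 := inner_self_eq_zero.1 (h1 _)
    have h4 := congrArg (Subtype.val) h3
    exact eq_neg_of_add_eq_zero_left h4
  · rintro rfl
    refine ⟨S.neg_mem (Subtype.property _), fun v hv e he => ?_⟩
    rw [inner_neg_right, (hd ⟨v, hv⟩ e).1 he, ← key ⟨v, hv⟩]

theorem inner_L2_eq (f g : L2 Ω) : inner ℝ f g = ∫ x, f x * g x ∂area Ω := by
  rw [L2.inner_def]
  refine integral_congr_ae (Eventually.of_forall fun x => ?_)
  simp [mul_comm]

/-- A weak divergence has zero mean. -/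
theorem inner_eq_zero_of_hasWeakDiv {u : L2Vec Ω} {d f : L2 Ω} (hd : HasWeakDiv u d)
    (hf : IsConst f) : inner ℝ d f = (0 : ℝ) := by
  obtain ⟨c, hc⟩ := hf
  have h1 := (hd.2 (fun _ => c) contDiff_const).2.2
  rw [inner_L2_eq]
  have h2 : (fun x => d x * f x) =ᵐ[area Ω] fun x => d x * c := by
    filter_upwards [hc] with x hx
    rw [hx]
  rw [integral_congr_ae h2, h1]
  simp

/-- The kernel of the discrete gradient is given by the inf-sup condition. -/
theorem isDiscreteGrad_zero_iff (hΩ : IsClosedSurface Ω) (hC : IsCompatible J E S V) {φ : L2 Ω}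
    (hφ : φ ∈ V) : IsDiscreteGrad S φ 0 ↔ IsConst φ := by
  constructor
  · rintro ⟨-, h⟩
    have := hΩ.isFiniteMeasure
    obtain ⟨e, he0, he1, he⟩ := hΩ.exists_one
    have heC : IsConst e := (he e).2 (Submodule.mem_span_singleton_self e)
    have hee : (inner ℝ e e : ℝ) ≠ 0 := inner_self_ne_zero.2 he0
    set m : ℝ := inner ℝ e φ / inner ℝ e e with hm
    -- `φ - m e` is the mean-free part of `φ`.
    have hmV : φ - m • e ∈ V := V.sub_mem hφ (V.smul_mem m (hC.const_mem_V e heC))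
    have hmean : ∫ x, (φ - m • e : L2 Ω) x ∂area Ω = 0 := by
      have h1 : inner ℝ e (φ - m • e) = (0 : ℝ) := by
        rw [inner_sub_right, real_inner_smul_right, hm, div_mul_cancel₀ _ hee, sub_self]
      rw [← h1, inner_L2_eq]
      refine integral_congr_ae ?_
      filter_upwards [he1] with x hx
      rw [hx, one_mul]
    by_cases h0 : φ - m • e = 0
    · rw [he, Submodule.mem_span_singleton]
      exact ⟨m, (sub_eq_zero.1 h0).symm⟩
    · exfalso
      obtain ⟨γ, hγ, hinf⟩ := hC.infSup
      obtain ⟨v, hv, hv0, d, hd, hle⟩ := hinf _ hmV h0 hmean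
      have h2 : ∫ x, (φ - m • e : L2 Ω) x * d x ∂area Ω = 0 := by
        rw [← inner_L2_eq, real_inner_comm, inner_sub_right, real_inner_smul_right,
          inner_eq_zero_of_hasWeakDiv hd heC]
        have h3 := h v hv d hd
        rw [inner_zero_right] at h3
        linarith
      rw [h2] at hle
      have h4 : 0 < hdivNorm v d := by
        have := norm_pos_iff.2 hv0
        exact Real.sqrt_pos.2 (by positivity)
      have h5 : 0 < ‖φ - m • e‖ := norm_pos_iff.2 h0
      have : 0 < γ * ‖φ - m • e‖ * hdivNorm v d := by positivity
      linarith
  · intro hc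
    refine ⟨S.zero_mem, fun v hv d hd => ?_⟩
    rw [inner_zero_right, inner_eq_zero_of_hasWeakDiv hd hc, neg_zero]

/-- The range of the adjoint of the divergence is the orthogonal complement of its kernel. -/
theorem gradImage_eq (hΩ : IsClosedSurface Ω) (hC : IsCompatible J E S V) :
    gradImage S V = (divFree S)ᗮ ⊓ S := by
  have := hC.finite_S
  have := hC.finite_V
  obtain ⟨d, hd⟩ := exists_divMap hΩ hC
  apply le_antisymm
  · rintro w ⟨φ, hφ, hw, h⟩
    refine ⟨(Submodule.mem_orthogonal _ _).2 fun u hu => ?_, hw⟩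
    rw [h u hu.1 0 hu.2, inner_zero_left, neg_zero]
  · rintro w ⟨hw1, hw2⟩
    have h1 : (⟨w, hw2⟩ : S) ∈ (LinearMap.ker d)ᗮ := by
      refine (Submodule.mem_orthogonal _ _).2 fun u hu => ?_
      refine (Submodule.mem_orthogonal _ _).1 hw1 u ⟨u.2, (hd u 0).2 ?_⟩
      rw [LinearMap.mem_ker.1 hu]; rfl
    rw [LinearMap.orthogonal_ker] at h1
    obtain ⟨φ, hφ⟩ := h1
    refine ⟨(-φ : V), (-φ : V).2, (isDiscreteGrad_iff hd _ _).2 ?_⟩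
    rw [map_neg, hφ]
    simp

/-- Rank and nullity for a map whose kernel is the one-dimensional space of constants. -/
theorem finrank_add_one_of_ker_const (hΩ : IsClosedSurface Ω) {P : Submodule ℝ (L2 Ω)}
    [FiniteDimensional ℝ P] (hP : ∀ f, IsConst f → f ∈ P) {B : Type*} [AddCommGroup B] [Module ℝ B]
    {f : P →ₗ[ℝ] B} (hf : ∀ a : P, f a = 0 ↔ IsConst (a : L2 Ω)) :
    finrank ℝ (LinearMap.range f) + 1 = finrank ℝ P := by
  obtain ⟨e, he0, -, he⟩ := hΩ.exists_one
  have h1 : Submodule.map P.subtype (LinearMap.ker f) = Submodule.span ℝ {e} := by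
    ext a
    rw [← he, Submodule.mem_map]
    constructor
    · rintro ⟨b, hb, rfl⟩
      exact (hf b).1 hb
    · intro ha
      exact ⟨⟨a, hP a ha⟩, (hf _).2 ha, rfl⟩
  rw [← f.finrank_range_add_finrank_ker, ← Submodule.finrank_map_subtype_eq, h1,
    finrank_span_singleton he0]

theorem finrank_curlImage (hΩ : IsClosedSurface Ω) (hJ : IsRotationField Ω J)
    (hC : IsCompatible J E S V) : finrank ℝ (curlImage J E) + 1 = finrank ℝ E := by
  have := hC.finite_E
  obtain ⟨f, hf⟩ := exists_linearMap_of_relation (P := E)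
    (R := fun (ψ : L2 Ω) (u : L2Vec Ω) => HasCurl J ψ u)
    (fun _ _ _ _ h h' => h.add h') (fun c _ _ h => h.smul c)
    fun ψ hψ => hΩ.existsUnique_hasCurl hJ (hC.E_le hψ)
  have h1 : curlImage J E = LinearMap.range f := by
    ext u
    constructor
    · rintro ⟨ψ, hψ, hu⟩
      exact ⟨⟨ψ, hψ⟩, ((hf ⟨ψ, hψ⟩ u).1 hu).symm⟩
    · rintro ⟨ψ, rfl⟩
      exact ⟨ψ, ψ.2, (hf ψ _).2 rfl⟩
  rw [h1]
  refine finrank_add_one_of_ker_const hΩ hC.const_mem_E fun a => ?_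
  rw [← hΩ.hasCurl_zero_iff hJ, hf a 0, eq_comm]

theorem finrank_gradImage (hΩ : IsClosedSurface Ω) (hC : IsCompatible J E S V) :
    finrank ℝ (gradImage S V) + 1 = finrank ℝ V := by
  have := hC.finite_S
  have := hC.finite_V
  obtain ⟨d, hd⟩ := exists_divMap hΩ hC
  have h1 : gradImage S V = LinearMap.range (S.subtype ∘ₗ (-LinearMap.adjoint d)) := by
    ext w
    constructor
    · rintro ⟨φ, hφ, hw⟩
      exact ⟨⟨φ, hφ⟩, ((isDiscreteGrad_iff hd ⟨φ, hφ⟩ w).1 hw).symm⟩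
    · rintro ⟨φ, rfl⟩
      exact ⟨φ, φ.2, (isDiscreteGrad_iff hd φ _).2 rfl⟩
  rw [h1]
  refine finrank_add_one_of_ker_const hΩ hC.const_mem_V fun a => ?_
  rw [← isDiscreteGrad_zero_iff hΩ hC a.2, isDiscreteGrad_iff hd a 0, eq_comm]
  rfl

theorem finrank_eq_discrete (hΩ : IsClosedSurface Ω) (hJ : IsRotationField Ω J)
    (hC : IsCompatible J E S V) : finrank ℝ S + 2 = finrank ℝ E + finrank ℝ V +
      finrank ℝ (discreteHarmonic J E S) := by
  have := hC.finite_S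
  have : FiniteDimensional ℝ (divFree S) := Submodule.finiteDimensional_of_le divFree_le
  have h1 := Submodule.finrank_add_inf_finrank_orthogonal (divFree_le (S := S))
  have h2 := Submodule.finrank_add_inf_finrank_orthogonal (curlImage_le_divFree hΩ hJ hC)
  rw [← gradImage_eq hΩ hC] at h1
  rw [← discreteHarmonic_eq] at h2
  have h3 := finrank_curlImage hΩ hJ hC
  have h4 := finrank_gradImage hΩ hC
  omega

theorem discrete_decomposition (hΩ : IsClosedSurface Ω) (hJ : IsRotationField Ω J)
    (hC : IsCompatible J E S V) : curlImage J E ⟂ gradImage S V ∧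
      curlImage J E ⟂ discreteHarmonic J E S ∧ gradImage S V ⟂ discreteHarmonic J E S ∧
      curlImage J E ⊔ gradImage S V ⊔ discreteHarmonic J E S = S := by
  have := hC.finite_S
  have h0 := curlImage_le_divFree hΩ hJ hC
  have : FiniteDimensional ℝ (divFree S) := Submodule.finiteDimensional_of_le divFree_le
  have : FiniteDimensional ℝ (curlImage J E) := Submodule.finiteDimensional_of_le h0
  have hG : divFree S ⟂ gradImage S V := by
    rw [gradImage_eq hΩ hC]
    exact (Submodule.isOrtho_orthogonal_right _).mono_right inf_le_left
  have hH : discreteHarmonic J E S ≤ divFree S := by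
    rw [discreteHarmonic_eq]; exact inf_le_right
  refine ⟨hG.mono_left h0, ?_, (hG.mono_left hH).symm, ?_⟩
  · rw [discreteHarmonic_eq]
    exact (Submodule.isOrtho_orthogonal_right _).mono_right inf_le_left
  · rw [sup_right_comm, discreteHarmonic_eq,
      Submodule.sup_orthogonal_inf_of_hasOrthogonalProjection h0, gradImage_eq hΩ hC,
      Submodule.sup_orthogonal_inf_of_hasOrthogonalProjection divFree_le]

/-! ### Comparison of discrete and continuous harmonic fields -/

theorem IsClosedSurface.memLp_of_continuousOn (hΩ : IsClosedSurface Ω) {F : Type*}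
    [NormedAddCommGroup F] [SecondCountableTopology F] {f : Euc n → F} (hf : ContinuousOn f Ω) :
    MemLp f 2 (area Ω) := by
  have := hΩ.isFiniteMeasure
  obtain ⟨C, hC⟩ := hΩ.isCompact.exists_bound_of_continuousOn hf
  refine MemLp.of_bound (hf.aestronglyMeasurable hΩ.measurableSet) C ?_
  filter_upwards [ae_area_mem hΩ.measurableSet] with x hx using hC x hx

/-- The square integrable tangential fields. -/
def tangentialFields (Ω : Set (Euc n)) : Submodule ℝ (L2Vec Ω) where
  carrier := {u | IsTangential u}
  add_mem' := IsTangential.add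
  zero_mem' := HasWeakDiv.zero.1
  smul_mem' := fun c _ h => h.smul c

theorem isClosed_tangentialFields : IsClosed (tangentialFields Ω : Set (L2Vec Ω)) := by
  refine IsSeqClosed.isClosed fun u v hu hv => ?_
  obtain ⟨ns, -, hns⟩ := (tendstoInMeasure_of_tendsto_Lp hv).exists_seq_tendsto_ae
  filter_upwards [hns, ae_all_iff.2 hu] with x h1 h2
  exact (Submodule.closed_of_finiteDimensional (tangentPlane Ω x)).mem_of_tendsto h1
    (Eventually.of_forall fun k => h2 (ns k))

/-- Integration of the derivative of `φ` along fields is represented by the ambient gradient of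
`φ`. -/
theorem IsClosedSurface.exists_inner_eq_integral_fderiv (hΩ : IsClosedSurface Ω) {φ : Euc n → ℝ}
    (hφ : ContDiff ℝ ∞ φ) :
    ∃ G : L2Vec Ω, ∀ u : L2Vec Ω, ∫ x, fderiv ℝ φ x (u x) ∂area Ω = inner ℝ G u := by
  have := hΩ.isFiniteMeasure
  have hc : Continuous (gradient φ) :=
    (InnerProductSpace.toDual ℝ (Euc n)).symm.continuous.comp (hφ.continuous_fderiv (by simp))
  have h1 : MemLp (gradient φ) 2 (area Ω) := hΩ.memLp_of_continuousOn hc.continuousOn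
  refine ⟨h1.toLp _, fun u => ?_⟩
  rw [L2.inner_def]
  refine integral_congr_ae ?_
  filter_upwards [h1.coeFn_toLp] with x hx
  rw [hx, gradient, InnerProductSpace.toDual_symm_apply]

/-- Weakly divergence-free fields form a closed subspace. -/
theorem IsClosedSurface.hasWeakDiv_zero_of_tendsto (hΩ : IsClosedSurface Ω) {u : ℕ → L2Vec Ω}
    {v : L2Vec Ω} (hu : ∀ k, HasWeakDiv (u k) 0) (hv : Tendsto u atTop (𝓝 v)) : HasWeakDiv v 0 := by
  have hT : IsTangential v :=
    isClosed_tangentialFields.mem_of_tendsto hv (Eventually.of_forall fun k => (hu k).1)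
  refine ⟨hT, fun φ hφ => ⟨(HasWeakDiv.zero.2 φ hφ).1,
    hΩ.integrable_fderiv_apply hφ (hΩ.integrable_of_memLp v), ?_⟩⟩
  obtain ⟨G, hG⟩ := hΩ.exists_inner_eq_integral_fderiv hφ
  have h1 : ∀ k, inner ℝ G (u k) = -∫ x, (0 : L2 Ω) x * φ x ∂area Ω := by
    intro k
    rw [((hu k).2 φ hφ).2.2, hG]
    simp
  have h2 : Tendsto (fun k => (inner ℝ G (u k) : ℝ)) atTop (𝓝 (inner ℝ G v)) :=
    tendsto_const_nhds.inner hv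
  rw [hG, tendsto_nhds_unique h2 (tendsto_const_nhds.congr fun k => (h1 k).symm), neg_neg]

/-- Divergence-free fields in `S` orthogonal to the discrete harmonic fields are curls. -/
theorem mem_curlImage (hΩ : IsClosedSurface Ω) (hJ : IsRotationField Ω J)
    (hC : IsCompatible J E S V) {u : L2Vec Ω} (hu : u ∈ divFree S)
    (h : u ∈ (discreteHarmonic J E S)ᗮ) : u ∈ curlImage J E := by
  have := hC.finite_S
  have h0 := curlImage_le_divFree hΩ hJ hC
  have : FiniteDimensional ℝ (curlImage J E) :=
    Submodule.finiteDimensional_of_le (h0.trans divFree_le)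
  have hmem := (curlImage J E).starProjection_apply_mem u
  have h1 : u - (curlImage J E).starProjection u ∈ discreteHarmonic J E S := by
    rw [discreteHarmonic_eq]
    exact ⟨Submodule.sub_starProjection_mem_orthogonal u, Submodule.sub_mem _ hu (h0 hmem)⟩
  have h2 := (Submodule.mem_orthogonal' _ _).1 h _ h1
  have h3 := Submodule.inner_right_of_mem_orthogonal hmem
    (Submodule.sub_starProjection_mem_orthogonal (K := curlImage J E) u)
  have h4 : inner ℝ (u - (curlImage J E).starProjection u) (u - (curlImage J E).starProjection u) =
      (0 : ℝ) := by
    nth_rewrite 1 [inner_sub_left]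
    rw [h2, h3, sub_zero]
  rw [sub_eq_zero.1 (inner_self_eq_zero.1 h4)]
  exact hmem

theorem harmonicFields_le_Hdiv : harmonicFields Ω J ≤ Hdiv Ω := fun _ h => ⟨0, h.1⟩

theorem hdivNorm_zero (u : L2Vec Ω) : hdivNorm u 0 = ‖u‖ := by
  simp [hdivNorm]

/-- With suitable projections, `q ↦ Π^S q` followed by the orthogonal projection onto the discrete
harmonic fields is injective on harmonic fields. Conversely, the harmonic part of the Hodge
decomposition of a discrete harmonic field determines it. -/
theorem finrank_harmonicFields (hΩ : IsClosedSurface Ω) (hJ : IsRotationField Ω J)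
    (hC : IsCompatible J E S V) (hP : HasSuitableProjections J E S V) :
    FiniteDimensional ℝ (harmonicFields Ω J) ∧
      finrank ℝ (discreteHarmonic J E S) = finrank ℝ (harmonicFields Ω J) := by
  obtain ⟨PE, PS, PV, ⟨hPE, -⟩, ⟨hPS, hPS'⟩, ⟨hPV, hPV'⟩, hcurl, hdiv, ⟨C, hCb⟩, hlt⟩ := hP
  have := hC.finite_S
  have hHS : discreteHarmonic J E S ≤ S := fun _ h => h.1
  have : FiniteDimensional ℝ (discreteHarmonic J E S) := Submodule.finiteDimensional_of_le hHS
  have hdiv0 : ∀ u : Hdiv Ω, HasWeakDiv (u : L2Vec Ω) 0 → HasWeakDiv (PS u) 0 := by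
    intro u hu
    have := hdiv u 0 hu
    rwa [map_zero] at this
  have h0 := curlImage_le_divFree hΩ hJ hC
  have : FiniteDimensional ℝ (curlImage J E) :=
    Submodule.finiteDimensional_of_le (h0.trans divFree_le)
  -- The map from harmonic fields to discrete harmonic fields.
  let F : harmonicFields Ω J →ₗ[ℝ] discreteHarmonic J E S :=
    (discreteHarmonic J E S).orthogonalProjectionOnto.toLinearMap ∘ₗ PS ∘ₗ
      Submodule.inclusion harmonicFields_le_Hdiv
  have hF : Function.Injective F := by
    rw [← LinearMap.ker_eq_bot, LinearMap.ker_eq_bot']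
    intro q hq
    set q' : Hdiv Ω := Submodule.inclusion harmonicFields_le_Hdiv q with hq'
    have h1 : PS q' ∈ (discreteHarmonic J E S)ᗮ :=
      Submodule.orthogonalProjectionOnto_eq_zero_iff.1 hq
    obtain ⟨ψ, hψ, hc⟩ := mem_curlImage hΩ hJ hC ⟨hPS q', hdiv0 q' q.2.1⟩ h1
    have h2 : inner ℝ (q : L2Vec Ω) (PS q') = 0 := q.2.2 ψ (hC.E_le hψ) _ hc
    by_contra hne
    have h3 := hlt q' q.2 fun h => hne (by
      apply Subtype.ext
      exact congrArg (fun z : Hdiv Ω => (z : L2Vec Ω)) h)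
    -- By orthogonality of `q` and the curl `PS q`, the error `q - PS q` is at least as large as `q`.
    have h4 : ‖(q : L2Vec Ω) - PS q'‖ ^ 2 = ‖(q : L2Vec Ω)‖ ^ 2 + ‖PS q'‖ ^ 2 := by
      rw [norm_sub_sq_real, h2]; ring
    have h5 : ‖(q : L2Vec Ω) - PS q'‖ < ‖(q : L2Vec Ω)‖ := h3
    have h6 := pow_lt_pow_left₀ h5 (norm_nonneg _) two_ne_zero
    nlinarith [sq_nonneg ‖PS q'‖]
  have hfin : FiniteDimensional ℝ (harmonicFields Ω J) := FiniteDimensional.of_injective F hF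
  refine ⟨hfin, le_antisymm ?_ (LinearMap.finrank_le_finrank_of_injective hF)⟩
  -- The map from discrete harmonic fields to harmonic fields; `M` is the closure of all curls.
  set M := (curlImage J (H1 Ω)).topologicalClosure with hM
  have hMc : IsClosed (M : Set (L2Vec Ω)) := Submodule.isClosed_topologicalClosure _
  have : CompleteSpace M := hMc.completeSpace_coe
  have hseq : ∀ u ∈ M, ∃ c : ℕ → L2Vec Ω, (∀ k, c k ∈ curlImage J (H1 Ω)) ∧
      Tendsto c atTop (𝓝 u) := fun u hu => mem_closure_iff_seq_limit.1 hu
  have hM0 : ∀ u ∈ M, HasWeakDiv u 0 := by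
    intro u hu
    obtain ⟨c, hc, hcu⟩ := hseq u hu
    refine hΩ.hasWeakDiv_zero_of_tendsto (fun k => ?_) hcu
    obtain ⟨ψ, -, h⟩ := hc k
    exact hΩ.hasWeakDiv_zero_of_hasCurl hJ h
  let G₀ : discreteHarmonic J E S →ₗ[ℝ] L2Vec Ω :=
    (LinearMap.id - M.starProjection.toLinearMap) ∘ₗ (discreteHarmonic J E S).subtype
  have hG₀ : ∀ u, G₀ u = (u : L2Vec Ω) - M.starProjection (u : L2Vec Ω) := fun u => rfl
  let G : discreteHarmonic J E S →ₗ[ℝ] harmonicFields Ω J := G₀.codRestrict _ fun u => by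
    rw [hG₀]
    constructor
    · have h1 := u.2.2.1.add ((hM0 _ (M.starProjection_apply_mem (u : L2Vec Ω))).smul (-1))
      rwa [smul_zero, add_zero, neg_one_smul, ← sub_eq_add_neg] at h1
    · intro ψ hψ c hc
      exact Submodule.inner_left_of_mem_orthogonal
        (Submodule.le_topologicalClosure _ (show c ∈ curlImage J (H1 Ω) from ⟨ψ, hψ, hc⟩))
        (Submodule.sub_starProjection_mem_orthogonal (K := M) _)
  have hG : Function.Injective G := by
    rw [← LinearMap.ker_eq_bot, LinearMap.ker_eq_bot']
    intro u hu
    have h1 : (u : L2Vec Ω) - M.starProjection (u : L2Vec Ω) = 0 := congrArg Subtype.val hu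
    have huM : (u : L2Vec Ω) ∈ M := by
      rw [sub_eq_zero.1 h1]; exact M.starProjection_apply_mem _
    obtain ⟨c, hc, hcu⟩ := hseq _ huM
    have hcH : ∀ k, HasWeakDiv (c k) 0 := fun k => by
      obtain ⟨ψ, -, h⟩ := hc k
      exact hΩ.hasWeakDiv_zero_of_hasCurl hJ h
    let c' : ℕ → Hdiv Ω := fun k => ⟨c k, 0, hcH k⟩
    let u' : Hdiv Ω := ⟨u, 0, u.2.2.1⟩
    -- By boundedness of `PS` the field `u = PS u` is a limit of discrete curls.
    have hlim : Tendsto (fun k => PS (c' k)) atTop (𝓝 (u : L2Vec Ω)) := by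
      rw [tendsto_iff_norm_sub_tendsto_zero]
      have h2 : ∀ k, ‖PS (c' k) - (u : L2Vec Ω)‖ ≤ C * ‖c k - (u : L2Vec Ω)‖ := by
        intro k
        have h3 : PS u' = (u : L2Vec Ω) := hPS' u' u.2.1
        have h4 : HasWeakDiv ((c' k - u' : Hdiv Ω) : L2Vec Ω) 0 := by
          have := (hcH k).add (u.2.2.1.smul (-1))
          rwa [smul_zero, add_zero, neg_one_smul, ← sub_eq_add_neg] at this
        have h5 := hCb (c' k - u') 0 0 h4 (hdiv0 _ h4)
        rw [hdivNorm_zero, hdivNorm_zero, map_sub, h3] at h5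
        exact h5
      refine squeeze_zero (fun k => norm_nonneg _) h2 ?_
      have := (tendsto_iff_norm_sub_tendsto_zero.1 hcu).const_mul C
      rwa [mul_zero] at this
    have hmem : (u : L2Vec Ω) ∈ curlImage J E := by
      refine (Submodule.closed_of_finiteDimensional (curlImage J E)).mem_of_tendsto hlim
        (Eventually.of_forall fun k => ?_)
      obtain ⟨ψ, hψ, h⟩ := hc k
      exact ⟨PE ⟨ψ, hψ⟩, hPE _, hcurl ⟨ψ, hψ⟩ (c' k) h⟩
    obtain ⟨ψ, hψ, h⟩ := hmem
    exact Subtype.ext (inner_self_eq_zero.1 (u.2.2.2 ψ hψ _ h))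
  exact LinearMap.finrank_le_finrank_of_injective hG

end Discrete

/-! ### Harmonic fields tested against smooth functions -/

theorem IsClosedSurface.integrable_mul_of_continuousOn (hΩ : IsClosedSurface Ω) {f : Euc n → ℝ}
    (hf : Integrable f (area Ω)) {g : Euc n → ℝ} (hg : ContinuousOn g Ω) :
    Integrable (fun x => f x * g x) (area Ω) := by
  obtain ⟨C, hC⟩ := hΩ.isCompact.exists_bound_of_continuousOn hg
  exact hf.mul_bdd (c := C) (hg.aestronglyMeasurable hΩ.measurableSet)
    ((ae_area_mem hΩ.measurableSet).mono fun x hx => hC x hx)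

/-- Integration by parts for smooth functions and fields. -/
theorem IsClosedSurface.integral_mul_surfaceDiv (hΩ : IsClosedSurface Ω) {φ : Euc n → ℝ}
    (hφ : ContDiff ℝ ∞ φ) {X : Euc n → Euc n} (hX : ContDiff ℝ ∞ X)
    (hT : ∀ x ∈ Ω, X x ∈ tangentPlane Ω x) :
    ∫ x, φ x * surfaceDiv Ω X x ∂area Ω = -∫ x, fderiv ℝ φ x (X x) ∂area Ω := by
  have h1 := hΩ.integral_surfaceDiv (X := fun z => φ z • X z) (hφ.smul hX) fun x hx =>
    Submodule.smul_mem _ (φ x) (hT x hx)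
  have h2 : (fun x => surfaceDiv Ω (fun z => φ z • X z) x) =ᵐ[area Ω]
      fun x => φ x * surfaceDiv Ω X x + fderiv ℝ φ x (X x) := by
    filter_upwards [ae_area_mem hΩ.measurableSet] with x hx
    exact surfaceDiv_smul (hφ.differentiable (by simp) x) (hX.differentiable (by simp) x) (hT x hx)
  rw [integral_congr_ae h2, integral_add
    (f := fun x => φ x * surfaceDiv Ω X x)
    (hΩ.integrable_of_continuousOn
      (hφ.continuous.continuousOn.mul (hΩ.continuousOn_surfaceDiv hX hT)))
    (hΩ.integrable_fderiv_apply hφ (hΩ.integrable_of_continuousOn hX.continuous.continuousOn))] at h1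
  linarith

/-- A smooth function belongs to `H¹`; its weak gradient is the tangential representative of its
derivative. -/
theorem IsClosedSurface.exists_hasWeakGrad (hΩ : IsClosedSurface Ω) {φ : Euc n → ℝ}
    (hφ : ContDiff ℝ ∞ φ) {ψ : L2 Ω} (hψ : ∀ᵐ x ∂area Ω, ψ x = φ x) :
    ∃ w, HasWeakGrad ψ w ∧ ∀ u, IsTangential u → inner ℝ w u = ∫ x, fderiv ℝ φ x (u x) ∂area Ω := by
  obtain ⟨G, hG⟩ := hΩ.exists_inner_eq_integral_fderiv hφ
  have : CompleteSpace (tangentialFields Ω) :=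
    isClosed_tangentialFields.completeSpace_coe
  set w := (tangentialFields Ω).starProjection G
  have hw : IsTangential w := (tangentialFields Ω).starProjection_apply_mem G
  have key : ∀ u, IsTangential u → inner ℝ w u = ∫ x, fderiv ℝ φ x (u x) ∂area Ω := by
    intro u hu
    have h1 := Submodule.inner_left_of_mem_orthogonal (K := tangentialFields Ω) (u := u) hu
      (Submodule.sub_starProjection_mem_orthogonal (K := tangentialFields Ω) G)
    rw [inner_sub_left, sub_eq_zero] at h1
    rw [← h1, hG]
  refine ⟨w, ⟨hw, fun X hX hT => ?_⟩, key⟩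
  have hXm := hΩ.memLp_of_continuousOn hX.continuous.continuousOn
  have h1 : (fun x => ψ x * surfaceDiv Ω X x) =ᵐ[area Ω] fun x => φ x * surfaceDiv Ω X x := by
    filter_upwards [hψ] with x hx
    rw [hx]
  have h2 : (fun x => (inner ℝ (w x) (hXm.toLp X x) : ℝ)) =ᵐ[area Ω]
      fun x => inner ℝ (w x) (X x) := by
    filter_upwards [hXm.coeFn_toLp] with x hx
    rw [hx]
  refine ⟨(hΩ.integrable_of_continuousOn (hφ.continuous.continuousOn.mul
    (hΩ.continuousOn_surfaceDiv hX hT))).congr h1.symm,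
    (L2.integrable_inner w (hXm.toLp X)).congr h2, ?_⟩
  rw [integral_congr_ae h1, hΩ.integral_mul_surfaceDiv hφ hX hT, ← integral_congr_ae h2,
    ← L2.inner_def, key]
  · congr 1
    refine integral_congr_ae ?_
    filter_upwards [hXm.coeFn_toLp] with x hx
    rw [hx]
  · filter_upwards [hXm.coeFn_toLp, ae_area_mem hΩ.measurableSet] with x hx hxΩ
    rw [hx]
    exact hT x hxΩ

/-- Rotation by a right angle is skew-adjoint on square integrable tangential fields. -/
theorem IsClosedSurface.inner_rotated (hΩ : IsClosedSurface Ω) {J : Euc n → Euc n →L[ℝ] Euc n}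
    (hJ : IsRotationField Ω J) {u v u' v' : L2Vec Ω} (hu : IsTangential u) (hv : IsTangential v)
    (hu' : ∀ᵐ x ∂area Ω, u' x = J x (u x)) (hv' : ∀ᵐ x ∂area Ω, v' x = J x (v x)) :
    inner ℝ u' v = -(inner ℝ u v' : ℝ) := by
  rw [L2.inner_def, L2.inner_def, ← integral_neg]
  refine integral_congr_ae ?_
  filter_upwards [hu, hv, hu', hv', ae_area_mem hΩ.measurableSet] with x h1 h2 h3 h4 h5
  rw [h3, h4, rotation_skew (hJ.orthogonal x h5) h1 h2, real_inner_comm]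

/-- Both a harmonic field and its rotation by a right angle are weakly divergence-free. -/
theorem IsClosedSurface.integral_fderiv_harmonic (hΩ : IsClosedSurface Ω)
    {J : Euc n → Euc n →L[ℝ] Euc n} (hJ : IsRotationField Ω J) {u : L2Vec Ω}
    (hu : u ∈ harmonicFields Ω J) {φ : Euc n → ℝ} (hφ : ContDiff ℝ ∞ φ) :
    ∫ x, fderiv ℝ φ x (u x) ∂area Ω = 0 ∧ ∫ x, fderiv ℝ φ x (J x (u x)) ∂area Ω = 0 := by
  obtain ⟨hdiv, horth⟩ := hu
  constructor
  · have h1 := (hdiv.2 φ hφ).2.2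
    have h2 : (fun x => (0 : L2 Ω) x * φ x) =ᵐ[area Ω] fun _ => 0 := by
      filter_upwards [Lp.coeFn_zero ℝ 2 (area Ω)] with x hx
      rw [hx, Pi.zero_apply, zero_mul]
    rw [integral_congr_ae h2, integral_zero] at h1
    linarith
  · have hφm := hΩ.memLp_of_continuousOn hφ.continuous.continuousOn
    obtain ⟨w, hw, hw'⟩ := hΩ.exists_hasWeakGrad hφ hφm.coeFn_toLp
    obtain ⟨c, hc⟩ := hΩ.exists_rotated hJ hw.1
    obtain ⟨u', hu'⟩ := hΩ.exists_rotated hJ hdiv.1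
    have hu'T : IsTangential u' := by
      filter_upwards [hu', hdiv.1, ae_area_mem hΩ.measurableSet] with x h1 h2 h3
      rw [h1]
      exact hJ.mapsTo x h3 _ h2
    have h1 := horth _ ⟨w, hw⟩ c ⟨w, hw, hc⟩
    rw [real_inner_comm, hΩ.inner_rotated hJ hw.1 hdiv.1 hc hu', neg_eq_zero, hw' u' hu'T] at h1
    rw [← h1]
    refine integral_congr_ae ?_
    filter_upwards [hu'] with x hx
    rw [hx]

/-! ### Killing fields -/

/-- The restriction of a rotation of the ambient space is divergence-free. -/
theorem IsClosedSurface.surfaceDiv_skew (hΩ : IsClosedSurface Ω) {A : Euc n →L[ℝ] Euc n}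
    (hA : ∀ v, inner ℝ (A v) v = (0 : ℝ)) {x : Euc n} (hx : x ∈ Ω) : surfaceDiv Ω A x = 0 := by
  obtain ⟨W, U, p, g, h, hxW⟩ := hΩ.exists_chart hx
  have hy := h.g_mem x hxW
  have h1 := trace_starProjection_comp_mul_gramDet
    (L := (fderiv ℝ p (g x) : Euc 2 →ₗ[ℝ] Euc n))
    (h.injective_fderiv_p hy) (h.tangentPlane_eq hy) A rfl rfl
  rw [h.p_g x hx hxW, hA, hA] at h1
  have h2 : ∀ a b : Euc n, inner ℝ (A a) b + inner ℝ (A b) a = (0 : ℝ) := by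
    intro a b
    have h := hA (a + b)
    rw [map_add, inner_add_left, inner_add_right, inner_add_right, hA, hA] at h
    linarith
  rw [h2] at h1
  rw [surfaceDiv, ContinuousLinearMap.fderiv]
  refine (mul_eq_zero.1 (h1.trans (by ring))).resolve_right (gramDet_pos ?_).ne'
  exact h.injective_fderiv_p hy

/-- Tangential Killing fields are weakly divergence-free. -/
theorem IsClosedSurface.integral_fderiv_skew (hΩ : IsClosedSurface Ω) {A : Euc n →L[ℝ] Euc n}
    (hA : ∀ v, inner ℝ (A v) v = (0 : ℝ)) (hT : ∀ x ∈ Ω, A x ∈ tangentPlane Ω x)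
    {φ : Euc n → ℝ} (hφ : ContDiff ℝ ∞ φ) : ∫ x, fderiv ℝ φ x (A x) ∂area Ω = 0 := by
  have h1 := hΩ.integral_mul_surfaceDiv hφ A.contDiff hT
  have h2 : (fun x => φ x * surfaceDiv Ω A x) =ᵐ[area Ω] fun _ => 0 := by
    filter_upwards [ae_area_mem hΩ.measurableSet] with x hx
    rw [hΩ.surfaceDiv_skew hA hx, mul_zero]
  rw [integral_congr_ae h2, integral_zero] at h1
  linarith

/-! ### Orientations of a connected surface -/

theorem IsClosedSurface.finrank_tangentPlane (hΩ : IsClosedSurface Ω) {x : Euc n} (hx : x ∈ Ω) :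
    finrank ℝ (tangentPlane Ω x) = 2 := by
  obtain ⟨W, U, p, g, h, hxW⟩ := hΩ.exists_chart hx
  have h1 := h.tangentPlane_eq (h.g_mem x hxW)
  rw [h.p_g x hx hxW] at h1
  rw [h1, LinearMap.finrank_range_of_inj (h.injective_fderiv_p (h.g_mem x hxW))]
  simp

/-- On a connected surface there are only two rotation fields. The reference field `N` is assumed
to be given by linear maps whose ranges are the tangent planes. -/
theorem IsClosedSurface.rotation_eq_or_neg (hΩ : IsClosedSurface Ω)
    {J N : Euc n → Euc n →L[ℝ] Euc n} (hJ : IsRotationField Ω J) (hN : IsRotationField Ω N)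
    (hr : ∀ x ∈ Ω, tangentPlane Ω x = LinearMap.range (N x : Euc n →ₗ[ℝ] Euc n)) :
    ∃ σ : ℝ, (σ = 1 ∨ σ = -1) ∧ ∀ x ∈ Ω, ∀ v ∈ tangentPlane Ω x, J x v = σ • N x v := by
  have hNr : ∀ x ∈ Ω, ∀ v, N x v ∈ tangentPlane Ω x := fun x hx v => by rw [hr x hx]; exact ⟨v, rfl⟩
  -- The sets where `J = N` and `J = -N` on the tangent plane, as equalizers of continuous maps.
  let F : Set (Euc n) := {x | x ∈ Ω ∧ J x ∘L N x = N x ∘L N x}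
  let G : Set (Euc n) := {x | x ∈ Ω ∧ J x ∘L N x = -(N x ∘L N x)}
  have hclosed : ∀ {f g : Euc n → Euc n →L[ℝ] Euc n}, ContinuousOn f Ω → ContinuousOn g Ω →
      IsClosed {x | x ∈ Ω ∧ f x = g x} := by
    intro f g hf hg
    have h1 := (hf.sub hg).preimage_isClosed_of_isClosed hΩ.isCompact.isClosed
      (isClosed_singleton (x := 0))
    convert h1 using 1
    ext x
    simp [sub_eq_zero]
  have hF : IsClosed F := hclosed (hJ.continuousOn.clm_comp hN.continuousOn)
    (hN.continuousOn.clm_comp hN.continuousOn)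
  have hG : IsClosed G := hclosed (hJ.continuousOn.clm_comp hN.continuousOn)
    (hN.continuousOn.clm_comp hN.continuousOn).neg
  have hne : ∀ x ∈ Ω, ∃ a ∈ tangentPlane Ω x, a ≠ 0 := by
    intro x hx
    refine (Submodule.ne_bot_iff _).1 fun h => ?_
    have h2 := hΩ.finrank_tangentPlane hx
    rw [h, finrank_bot] at h2
    omega
  have hspan : ∀ x ∈ Ω, ∀ a ∈ tangentPlane Ω x, a ≠ 0 → ∀ v ∈ tangentPlane Ω x,
      ∃ s t : ℝ, v = s • a + t • N x a := by
    intro x hx a ha ha0 v hv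
    have h3 : LinearIndependent ℝ ![a, N x a] := by
      rw [LinearIndependent.pair_iff]
      intro s t hst
      have e1 := congrArg (inner ℝ a) hst
      have e2 := congrArg (inner ℝ (N x a)) hst
      have e3 := hN.orthogonal x hx a ha
      have e4 : inner ℝ (N x a) (N x a) = (inner ℝ a a : ℝ) :=
        rotation_inner (hN.norm_eq x hx) ha ha
      rw [inner_add_right, real_inner_smul_right, real_inner_smul_right,
        real_inner_comm (N x a) a, e3, inner_zero_right] at e1
      rw [inner_add_right, real_inner_smul_right, real_inner_smul_right, e3, e4,
        inner_zero_right] at e2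
      have e5 : (inner ℝ a a : ℝ) ≠ 0 := inner_self_ne_zero.2 ha0
      constructor
      · simpa [e5, ha0] using e1
      · simpa [e5, ha0] using e2
    have h4 : Submodule.span ℝ (Set.range ![a, N x a]) = tangentPlane Ω x := by
      refine Submodule.eq_of_le_of_finrank_le ?_ ?_
      · rw [Submodule.span_le]
        rintro _ ⟨i, rfl⟩
        fin_cases i
        · exact ha
        · exact hN.mapsTo x hx a ha
      · rw [hΩ.finrank_tangentPlane hx, finrank_span_eq_card h3]
        simp
    rw [← h4, Matrix.range_cons, Matrix.range_cons, Matrix.range_empty, Set.union_empty,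
      Set.singleton_union, Submodule.mem_span_pair] at hv
    obtain ⟨s, t, h⟩ := hv
    exact ⟨s, t, h.symm⟩
  -- In a plane there are only two rotations by a right angle.
  have hpt : ∀ x ∈ Ω, ∃ σ : ℝ, (σ = 1 ∨ σ = -1) ∧ ∀ v ∈ tangentPlane Ω x, J x v = σ • N x v := by
    intro x hx
    obtain ⟨a, ha, ha0⟩ := hne x hx
    obtain ⟨s, t, hst⟩ := hspan x hx a ha ha0 _ (hJ.mapsTo x hx a ha)
    have e3 := hN.orthogonal x hx a ha
    have e4 : inner ℝ (N x a) (N x a) = (inner ℝ a a : ℝ) := rotation_inner (hN.norm_eq x hx) ha ha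
    have e6 : inner ℝ (J x a) (J x a) = (inner ℝ a a : ℝ) := rotation_inner (hJ.norm_eq x hx) ha ha
    have e5 : (inner ℝ a a : ℝ) ≠ 0 := inner_self_ne_zero.2 ha0
    have e7 := hJ.orthogonal x hx a ha
    rw [hst, inner_add_left, real_inner_smul_left, real_inner_smul_left, e3, mul_zero, add_zero,
      mul_eq_zero, or_iff_left e5] at e7
    rw [e7, zero_smul, zero_add] at hst
    rw [hst, real_inner_smul_left, real_inner_smul_right, e4, ← mul_assoc, mul_eq_right₀ e5] at e6
    refine ⟨t, by simpa using mul_self_eq_one_iff.1 e6, fun v hv => ?_⟩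
    obtain ⟨c, d, rfl⟩ := hspan x hx a ha ha0 v hv
    have e8 : t • J x (N x a) = t • (t • N x (N x a)) := by
      rw [tangentPlane_rotation hN hx ha, ← map_smul, ← hst, tangentPlane_rotation hJ hx ha,
        smul_smul, e6, one_smul]
    have ht : t ≠ 0 := fun h => by simp [h] at e6
    have e9 := smul_right_injective (Euc n) ht e8
    rw [map_add, map_smul, map_smul, map_add, map_smul, map_smul, hst, e9]
    module
  have hcov : Ω ⊆ F ∪ G := by
    intro x hx
    obtain ⟨σ, h1 | h1, h2⟩ := hpt x hx
    · refine Or.inl ⟨hx, ContinuousLinearMap.ext fun v => ?_⟩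
      simp [h2 _ (hNr x hx v), h1]
    · refine Or.inr ⟨hx, ContinuousLinearMap.ext fun v => ?_⟩
      simp [h2 _ (hNr x hx v), h1]
  have hdisj : ¬ (Ω ∩ (F ∩ G)).Nonempty := by
    rintro ⟨x, hx, h1, h2⟩
    obtain ⟨a, ha, ha0⟩ := hne x hx
    have h3 := h1.2.symm.trans h2.2
    obtain ⟨v, hv⟩ : ∃ v, N x v = a := by
      rw [hr x hx] at ha
      exact ha
    have h4 := congrArg (fun L : Euc n →L[ℝ] Euc n => L v) h3
    simp only [ContinuousLinearMap.comp_apply, _root_.neg_apply, hv] at h4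
    have h5 : N x a = 0 := by
      have h6 : (2 : ℝ) • N x a = 0 := by
        rw [two_smul]
        nth_rewrite 1 [h4]
        exact neg_add_cancel _
      simpa using h6
    have h6 := hN.norm_eq x hx a ha
    rw [h5, norm_zero] at h6
    exact ha0 (norm_eq_zero.1 h6.symm)
  have hpre := isPreconnected_closed_iff.1 hΩ.isConnected.isPreconnected F G hF hG hcov
  have hend : ∀ σ : ℝ, (∀ x ∈ Ω, J x ∘L N x = σ • (N x ∘L N x)) →
      ∀ x ∈ Ω, ∀ v ∈ tangentPlane Ω x, J x v = σ • N x v := by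
    intro σ h x hx v hv
    rw [hr x hx] at hv
    obtain ⟨z, rfl⟩ := hv
    exact congrArg (fun L : Euc n →L[ℝ] Euc n => L z) (h x hx)
  by_cases hFe : (Ω ∩ F).Nonempty
  · refine ⟨1, Or.inl rfl, hend 1 fun x hx => ?_⟩
    rcases hcov hx with h | h
    · rw [h.2, one_smul]
    · exact absurd (hpre hFe ⟨x, hx, h⟩) hdisj
  · refine ⟨-1, Or.inr rfl, hend (-1) fun x hx => ?_⟩
    rcases hcov hx with h | h
    · exact absurd ⟨x, hx, h⟩ hFe
    · rw [h.2]; exact (neg_one_smul ℝ _).symm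

/-! ### Linear vector fields as derivations of the polynomial ring -/

theorem polyFun_add (p q : MvPolynomial (Fin n) ℝ) (x : Euc n) :
    polyFun (p + q) x = polyFun p x + polyFun q x := map_add _ _ _

theorem polyFun_mul (p q : MvPolynomial (Fin n) ℝ) (x : Euc n) :
    polyFun (p * q) x = polyFun p x * polyFun q x := map_mul _ _ _

theorem polyFun_sub (p q : MvPolynomial (Fin n) ℝ) (x : Euc n) :
    polyFun (p - q) x = polyFun p x - polyFun q x := map_sub _ _ _

theorem polyFun_neg (q : MvPolynomial (Fin n) ℝ) (x : Euc n) :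
    polyFun (-q) x = -polyFun q x := map_neg _ _

theorem polyFun_sum {ι : Type*} (s : Finset ι) (q : ι → MvPolynomial (Fin n) ℝ) (x : Euc n) :
    polyFun (∑ j ∈ s, q j) x = ∑ j ∈ s, polyFun (q j) x := map_sum _ _ _

theorem polyFun_C (a : ℝ) (x : Euc n) : polyFun (MvPolynomial.C a) x = a :=
  MvPolynomial.eval_C _

theorem polyFun_X (i : Fin n) (x : Euc n) : polyFun (MvPolynomial.X i) x = x i :=
  MvPolynomial.eval_X _

/-- The derivative along the linear vector field `x ↦ A x`, as a derivation of the polynomial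
ring. -/
noncomputable def polyDeriv (A : Euc n →L[ℝ] Euc n) :
    Derivation ℝ (MvPolynomial (Fin n) ℝ) (MvPolynomial (Fin n) ℝ) :=
  MvPolynomial.mkDerivation ℝ fun i =>
    ∑ k, MvPolynomial.C (A (EuclideanSpace.single k 1) i) * MvPolynomial.X k

theorem polyDeriv_X (A : Euc n →L[ℝ] Euc n) (i : Fin n) :
    polyDeriv A (MvPolynomial.X i) =
      ∑ k, MvPolynomial.C (A (EuclideanSpace.single k 1) i) * MvPolynomial.X k :=
  MvPolynomial.mkDerivation_X _ _ _

theorem polyFun_polyDeriv (A : Euc n →L[ℝ] Euc n) (q : MvPolynomial (Fin n) ℝ) (x : Euc n) :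
    polyFun (polyDeriv A q) x = fderiv ℝ (polyFun q) x (A x) := by
  have hd : ∀ q : MvPolynomial (Fin n) ℝ, DifferentiableAt ℝ (polyFun q) x := fun q =>
    (contDiff_polyFun q).differentiable (by simp) x
  induction q using MvPolynomial.induction_on with
  | C a =>
    have h1 : polyFun (MvPolynomial.C a : MvPolynomial (Fin n) ℝ) = fun _ => a :=
      funext fun z => polyFun_C a z
    rw [MvPolynomial.derivation_C, h1]
    simp [polyFun]
  | add p q hp hq =>
    have h1 : polyFun (p + q) = fun z => polyFun p z + polyFun q z := funext (polyFun_add p q)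
    rw [map_add, polyFun_add, hp, hq, h1, fderiv_fun_add (hd p) (hd q), _root_.add_apply]
  | mul_X p i hp =>
    have h1 : polyFun (p * MvPolynomial.X i) = fun z => polyFun p z * z i := funext fun z => by
      rw [polyFun_mul, polyFun_X]
    have h2 : HasFDerivAt (fun z : Euc n => z i) (EuclideanSpace.proj i : Euc n →L[ℝ] ℝ) x :=
      (EuclideanSpace.proj i : Euc n →L[ℝ] ℝ).hasFDerivAt
    have h3 : A x i = ∑ k, A (EuclideanSpace.single k 1) i * x k := by
      conv_lhs => rw [← (EuclideanSpace.basisFun (Fin n) ℝ).sum_repr x]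
      simp [mul_comm]
    rw [Derivation.leibniz, smul_eq_mul, smul_eq_mul, polyFun_add, polyFun_mul, polyFun_mul, hp,
      polyFun_X, polyDeriv_X, polyFun_sum, h1, ((hd p).hasFDerivAt.fun_mul h2).fderiv]
    simp [polyFun_mul, polyFun_C, polyFun_X, h3]

/-- The polynomials of degree at most `m`, as the `m`-th power of the space of affine functions. -/
noncomputable def polyLe (n m : ℕ) : Submodule ℝ (MvPolynomial (Fin n) ℝ) :=
  Submodule.span ℝ (insert 1 (Set.range MvPolynomial.X)) ^ m

theorem one_mem_polyLe_one : (1 : MvPolynomial (Fin n) ℝ) ∈ polyLe n 1 := by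
  rw [polyLe, pow_one]
  exact Submodule.subset_span (mem_insert _ _)

theorem X_mem_polyLe_one (i : Fin n) : (MvPolynomial.X i : MvPolynomial (Fin n) ℝ) ∈ polyLe n 1 := by
  rw [polyLe, pow_one]
  exact Submodule.subset_span (mem_insert_of_mem _ (mem_range_self i))

theorem mul_mem_polyLe {p q : MvPolynomial (Fin n) ℝ} {k l : ℕ} (hp : p ∈ polyLe n k)
    (hq : q ∈ polyLe n l) : p * q ∈ polyLe n (k + l) := by
  rw [polyLe, pow_add]
  exact Submodule.mul_mem_mul hp hq

theorem polyLe_mono {k l : ℕ} (h : k ≤ l) : polyLe n k ≤ polyLe n l := by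
  induction l, h using Nat.le_induction with
  | base => exact le_rfl
  | succ l _ ih =>
    refine ih.trans fun p hp => ?_
    simpa using mul_mem_polyLe hp one_mem_polyLe_one

theorem one_mem_polyLe (m : ℕ) : (1 : MvPolynomial (Fin n) ℝ) ∈ polyLe n m := by
  refine polyLe_mono (Nat.zero_le m) ?_
  rw [polyLe, pow_zero]
  exact Submodule.mem_one.2 ⟨1, map_one _⟩

instance finite_polyLe (m : ℕ) : FiniteDimensional ℝ (polyLe n m) := by
  have h1 : (Submodule.span ℝ (insert 1 (Set.range MvPolynomial.X)) :
      Submodule ℝ (MvPolynomial (Fin n) ℝ)).FG :=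
    Submodule.fg_span ((finite_range _).insert _)
  exact Module.Finite.iff_fg.2 (h1.pow m)

theorem exists_mem_polyLe (q : MvPolynomial (Fin n) ℝ) : ∃ m, q ∈ polyLe n m := by
  induction q using MvPolynomial.induction_on with
  | C a =>
    refine ⟨0, ?_⟩
    rw [polyLe, pow_zero]
    exact Submodule.mem_one.2 ⟨a, rfl⟩
  | add p q hp hq =>
    obtain ⟨k, hk⟩ := hp
    obtain ⟨l, hl⟩ := hq
    exact ⟨max k l, Submodule.add_mem _ (polyLe_mono (le_max_left k l) hk)
      (polyLe_mono (le_max_right k l) hl)⟩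
  | mul_X p i hp =>
    obtain ⟨k, hk⟩ := hp
    exact ⟨k + 1, mul_mem_polyLe hk (X_mem_polyLe_one i)⟩

/-- Derivatives along linear vector fields do not raise the degree. -/
theorem polyDeriv_mem_polyLe (A : Euc n →L[ℝ] Euc n) {m : ℕ} {q : MvPolynomial (Fin n) ℝ}
    (hq : q ∈ polyLe n m) : polyDeriv A q ∈ polyLe n m := by
  have h1 : ∀ p ∈ polyLe n 1, polyDeriv A p ∈ polyLe n 1 := by
    intro p hp
    rw [polyLe, pow_one] at hp
    refine Submodule.span_induction ?_ ?_ (fun a b _ _ ha hb => ?_) (fun c a _ ha => ?_) hp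
    · rintro _ (rfl | ⟨i, rfl⟩)
      · rw [Derivation.map_one_eq_zero]
        exact Submodule.zero_mem _
      · rw [polyDeriv_X]
        refine Submodule.sum_mem _ fun k _ => ?_
        rw [← MvPolynomial.smul_eq_C_mul]
        exact Submodule.smul_mem _ _ (X_mem_polyLe_one k)
    · rw [map_zero]
      exact Submodule.zero_mem _
    · rw [map_add]
      exact Submodule.add_mem _ ha hb
    · rw [Derivation.map_smul]
      exact Submodule.smul_mem _ _ ha
  induction m generalizing q with
  | zero =>
    rw [polyLe, pow_zero] at hq
    obtain ⟨a, rfl⟩ := Submodule.mem_one.1 hq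
    rw [Derivation.map_algebraMap]
    exact Submodule.zero_mem _
  | succ m ih =>
    rw [polyLe, pow_succ] at hq
    refine Submodule.mul_induction_on hq (fun a ha b hb => ?_) fun a b ha hb => ?_
    · rw [Derivation.leibniz, smul_eq_mul, smul_eq_mul]
      have hb' : b ∈ polyLe n 1 := by rwa [polyLe, pow_one]
      refine Submodule.add_mem _ (mul_mem_polyLe ha (h1 b hb')) ?_
      rw [mul_comm]
      exact mul_mem_polyLe (ih ha) hb'
    · rw [map_add]
      exact Submodule.add_mem _ ha hb

/-! ### Weakly harmonic functions on surfaces with enough symmetries -/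

/-- The linear map taking a polynomial to its class in `L²(Ω)`. -/
theorem IsClosedSurface.exists_polyL2 (hΩ : IsClosedSurface Ω) :
    ∃ L : MvPolynomial (Fin n) ℝ →ₗ[ℝ] L2 Ω, ∀ q, ∀ᵐ x ∂area Ω, L q x = polyFun q x := by
  have hm : ∀ q : MvPolynomial (Fin n) ℝ, MemLp (polyFun q) 2 (area Ω) := fun q =>
    hΩ.memLp_of_continuousOn (contDiff_polyFun q).continuous.continuousOn
  refine ⟨{ toFun := fun q => (hm q).toLp _, map_add' := fun p q => ?_, map_smul' := fun c q => ?_ },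
    fun q => (hm q).coeFn_toLp⟩
  · rw [← MemLp.toLp_add]
    congr 1
    exact funext fun x => polyFun_add p q x
  · rw [RingHom.id_apply, ← MemLp.toLp_const_smul]
    congr 1
    funext x
    rw [MvPolynomial.smul_eq_C_mul, polyFun_mul, polyFun_C]
    rfl

theorem inner_eq_integral_mul {f g : L2 Ω} {φ : Euc n → ℝ} (hg : ∀ᵐ x ∂area Ω, g x = φ x) :
    inner ℝ f g = ∫ x, f x * φ x ∂area Ω := by
  rw [inner_L2_eq]
  refine integral_congr_ae ?_
  filter_upwards [hg] with x hx
  rw [hx]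

/-- **Weyl's lemma** for the operator `Δ = ∑ Kⱼ²`, where the `Kⱼ` are Killing fields induced by
rotations of the ambient space which span the tangent planes: a square integrable function
orthogonal to `Δq` for all polynomials `q` is constant. As `Δ` does not raise the degree, the
projection of the function onto the polynomials of degree at most `m` is again weakly harmonic,
and there the energy identity `∫ q Δq = -∑ ∫ (Kⱼ q)²` applies. -/
theorem IsClosedSurface.isConst_of_weakly_harmonic (hΩ : IsClosedSurface Ω) {ι : Type*} [Fintype ι]
    {A : ι → Euc n →L[ℝ] Euc n} (hA : ∀ j v, inner ℝ (A j v) v = (0 : ℝ))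
    (hspan : ∀ x ∈ Ω, Submodule.span ℝ (Set.range fun j => A j x) = tangentPlane Ω x) {f : L2 Ω}
    (hf : ∀ q, ∫ x, f x * polyFun (∑ j, polyDeriv (A j) (polyDeriv (A j) q)) x ∂area Ω = 0) :
    IsConst f := by
  obtain ⟨L, hL⟩ := hΩ.exists_polyL2
  have hT : ∀ j, ∀ x ∈ Ω, A j x ∈ tangentPlane Ω x := fun j x hx => by
    rw [← hspan x hx]
    exact Submodule.subset_span ⟨j, rfl⟩
  have hint : ∀ p : MvPolynomial (Fin n) ℝ, Integrable (polyFun p) (area Ω) := fun p =>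
    hΩ.integrable_of_continuousOn (contDiff_polyFun p).continuous.continuousOn
  have hinner : ∀ p q, inner ℝ (L p) (L q) = ∫ x, polyFun (p * q) x ∂area Ω := by
    intro p q
    rw [inner_eq_integral_mul (hL q)]
    refine integral_congr_ae ?_
    filter_upwards [hL p] with x hx
    rw [hx, polyFun_mul]
  have hparts : ∀ j p q, inner ℝ (L p) (L (polyDeriv (A j) q)) =
      -(inner ℝ (L (polyDeriv (A j) p)) (L q) : ℝ) := by
    intro j p q
    have h1 := hΩ.integral_fderiv_skew (hA j) (hT j) (contDiff_polyFun (p * q))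
    simp only [← polyFun_polyDeriv, Derivation.leibniz, smul_eq_mul, polyFun_add] at h1
    rw [integral_add (hint _) (hint _), ← hinner, mul_comm q, ← hinner] at h1
    linarith
  -- The projection onto the polynomials of degree at most `m` is constant.
  have hconst : ∀ m, ∃ c : ℝ, ∀ q ∈ polyLe n m, inner ℝ f (L q) = c * inner ℝ (L 1) (L q) := by
    intro m
    let W : Submodule ℝ (L2 Ω) := (polyLe n m).map L
    have hproj : ∀ q ∈ polyLe n m, inner ℝ f (L q) = (inner ℝ (W.starProjection f) (L q) : ℝ) := by
      intro q hq
      have h1 := Submodule.inner_left_of_mem_orthogonal (K := W) (u := L q) ⟨q, hq, rfl⟩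
        (Submodule.sub_starProjection_mem_orthogonal (K := W) f)
      rw [inner_sub_left, sub_eq_zero] at h1
      exact h1
    obtain ⟨p, hp, hpf⟩ := W.starProjection_apply_mem f
    have h1 : ∑ j, inner ℝ (L (polyDeriv (A j) p)) (L (polyDeriv (A j) p)) = (0 : ℝ) := by
      have h2 := hf p
      rw [← inner_eq_integral_mul (hL _), hproj _ (Submodule.sum_mem _ fun j _ =>
        polyDeriv_mem_polyLe _ (polyDeriv_mem_polyLe _ hp)), ← hpf, map_sum, inner_sum] at h2
      simp only [fun j => hparts j p (polyDeriv (A j) p), Finset.sum_neg_distrib, neg_eq_zero] at h2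
      exact h2
    have h2 : ∀ j, L (polyDeriv (A j) p) = 0 := fun j => inner_self_eq_zero.1
      ((Finset.sum_eq_zero_iff_of_nonneg fun j _ => real_inner_self_nonneg).1 h1 j (Finset.mem_univ j))
    have h3 : ∀ᵐ x ∂area Ω, ∀ j, fderiv ℝ (polyFun p) x (A j x) = 0 := by
      rw [ae_all_iff]
      intro j
      filter_upwards [hL (polyDeriv (A j) p), Lp.coeFn_zero ℝ 2 (area Ω)] with x h3 h4
      rw [← polyFun_polyDeriv, ← h3, h2 j, h4, Pi.zero_apply]
    have h4 : HasWeakGrad (L p) 0 := by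
      obtain ⟨w, hw, hwp⟩ := hΩ.exists_hasWeakGrad (contDiff_polyFun p) (hL p)
      have h5 : inner ℝ w w = (0 : ℝ) := by
        rw [hwp w hw.1]
        refine integral_eq_zero_of_ae ?_
        filter_upwards [h3, hw.1, ae_area_mem hΩ.measurableSet] with x h5 h6 hx
        rw [← hspan x hx] at h6
        refine Submodule.span_induction ?_ (map_zero _) (fun a b _ _ ha hb => ?_)
          (fun c a _ ha => ?_) h6
        · rintro _ ⟨j, rfl⟩
          exact h5 j
        · rw [map_add, ha, hb, Pi.zero_apply, add_zero]
        · rw [map_smul, ha, Pi.zero_apply, smul_zero]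
      rwa [inner_self_eq_zero.1 h5] at hw
    obtain ⟨c, hc⟩ := hΩ.isConst_of_hasWeakGrad_zero h4
    refine ⟨c, fun q hq => ?_⟩
    have h5 : L p = c • L 1 := by
      refine Lp.ext ?_
      filter_upwards [hc, hL 1, Lp.coeFn_smul c (L 1)] with x h5 h6 h7
      rw [h5, h7, Pi.smul_apply, h6, ← map_one MvPolynomial.C, polyFun_C, smul_eq_mul, mul_one]
    rw [hproj q hq, ← hpf, h5, real_inner_smul_left]
  -- The constants for different degrees agree, as is seen by testing with `q = 1`.
  obtain ⟨c, hc⟩ := hconst 0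
  have hL1 : inner ℝ (L 1) (L 1) ≠ (0 : ℝ) := by
    obtain ⟨e, he0, he1, -⟩ := hΩ.exists_one
    have h1 : L 1 = e := by
      refine Lp.ext ?_
      filter_upwards [hL 1, he1] with x h1 h2
      rw [h1, h2, ← map_one MvPolynomial.C, polyFun_C]
    rw [h1]
    exact inner_self_ne_zero.2 he0
  have h0 : ∀ q, ∫ x, (f - c • L 1 : L2 Ω) x * polyFun q x ∂area Ω = 0 := by
    intro q
    obtain ⟨m, hm⟩ := exists_mem_polyLe q
    obtain ⟨d, hd⟩ := hconst m
    have h1 : c = d := mul_right_cancel₀ hL1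
      ((hc 1 (one_mem_polyLe 0)).symm.trans (hd 1 (one_mem_polyLe m)))
    rw [← inner_eq_integral_mul (hL q), inner_sub_left, real_inner_smul_left, hd q hm, h1, sub_self]
  refine ⟨c, ?_⟩
  filter_upwards [hΩ.ae_eq_zero_of_integral_polyFun_eq_zero (hΩ.integrable_of_memLp _) h0,
    Lp.coeFn_sub f (c • L 1), Lp.coeFn_smul c (L 1), hL 1] with x h1 h2 h3 h4
  rw [h2, Pi.sub_apply, h3, Pi.smul_apply, h4, ← map_one MvPolynomial.C, polyFun_C, smul_eq_mul,
    mul_one] at h1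
  linarith

/-! ### Patches with a smooth left inverse -/

/-- A smooth left inverse on the ambient space makes a parametrization an immersion and a
homeomorphism onto its image. -/
theorem isSurfacePatch_of_leftInverse {W : Set (Euc n)} {U : Set (Euc 2)} {p : Euc 2 → Euc n}
    {g : Euc n → Euc 2} (hW : IsOpen W) (hU : IsOpen U) (hp : ContDiffOn ℝ ∞ p U)
    (hg : ContDiff ℝ ∞ g) (hpU : ∀ y ∈ U, p y ∈ Ω ∩ W) (hgp : ∀ y ∈ U, g (p y) = y)
    (hpg : ∀ z ∈ Ω ∩ W, g z ∈ U ∧ p (g z) = z) : IsSurfacePatch Ω U p where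
  isOpen := hU
  smooth := hp
  immersion := by
    intro y hy
    have hUy := hU.mem_nhds hy
    have h1 : HasFDerivAt p (fderiv ℝ p y) y :=
      ((hp.contDiffAt hUy).differentiableAt (by simp)).hasFDerivAt
    have h2 := ((hg.differentiable (by simp) (p y)).hasFDerivAt).comp y h1
    have h3 : HasFDerivAt (g ∘ p) (ContinuousLinearMap.id ℝ (Euc 2)) y :=
      (hasFDerivAt_id y).congr_of_eventuallyEq (by
        filter_upwards [hUy] with z hz using hgp z hz)
    have h4 := h2.unique h3
    exact Function.LeftInverse.injective (g := fderiv ℝ g (p y)) fun v =>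
      congrArg (fun L : Euc 2 →L[ℝ] Euc 2 => L v) h4
  injOn := fun y hy z hz h => by rw [← hgp y hy, h, hgp z hz]
  relOpen := by
    intro U' hU' hoU'
    refine ⟨W ∩ g ⁻¹' U', hW.inter (hoU'.preimage hg.continuous), ?_⟩
    ext z
    constructor
    · rintro ⟨y, hy, rfl⟩
      obtain ⟨h1, h2⟩ := hpU y (hU' hy)
      exact ⟨h1, h2, by rw [mem_preimage, hgp y (hU' hy)]; exact hy⟩
    · rintro ⟨h1, h2, h3⟩
      exact ⟨g z, h3, (hpg z ⟨h1, h2⟩).2⟩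

/-- Tangent vectors annihilate the differentials of defining functions. -/
theorem fderiv_eq_zero_of_mem_tangentPlane {F : Euc n → ℝ} {F' : Euc n →L[ℝ] ℝ} {x v : Euc n}
    (hF : HasFDerivAt F F' x) {c : ℝ} (hc : ∀ z ∈ Ω, F z = c) (hx : x ∈ Ω)
    (hv : v ∈ tangentPlane Ω x) : F' v = 0 := by
  have h1 : HasFDerivWithinAt F (0 : Euc n →L[ℝ] ℝ) Ω x :=
    (hasFDerivWithinAt_const c x Ω).congr (fun z hz => hc z hz) (hc x hx)
  exact hF.hasFDerivWithinAt.eq_of_mem_tangentPlane h1 hv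

/-! ### The doubly periodic plane is a closed surface -/

section Torus

variable {r s : ℝ}

/-- Coordinates on a half circle: the component `d` orthogonal to the midpoint `(a, b)`. -/
theorem circle_coordinates (hr : 0 < r) {a b u v d : ℝ} (hab : a ^ 2 + b ^ 2 = r ^ 2)
    (huv : u ^ 2 + v ^ 2 = r ^ 2) (hpos : 0 < a * u + b * v) (hd : d = (a * v - b * u) / r) :
    d ^ 2 < r ^ 2 ∧ (√(r ^ 2 - d ^ 2) * a - d * b) / r = u ∧
      (√(r ^ 2 - d ^ 2) * b + d * a) / r = v := by
  have hr0 := hr.ne'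
  have hc : r ^ 2 - d ^ 2 = ((a * u + b * v) / r) ^ 2 := by
    rw [hd]
    field_simp
    linear_combination (-r ^ 2) * hab - (a ^ 2 + b ^ 2) * huv
  have hc0 : 0 < (a * u + b * v) / r := div_pos hpos hr
  refine ⟨by nlinarith [pow_pos hc0 2], ?_, ?_⟩
  · rw [hc, Real.sqrt_sq hc0.le, hd]
    field_simp
    linear_combination u * hab
  · rw [hc, Real.sqrt_sq hc0.le, hd]
    field_simp
    linear_combination v * hab

theorem isCompact_flatTorus : IsCompact (flatTorus r s) := by
  refine Metric.isCompact_of_isClosed_isBounded ?_ ?_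
  · have h1 : Continuous fun x : Euc 4 => x 0 ^ 2 + x 1 ^ 2 := by fun_prop
    have h2 : Continuous fun x : Euc 4 => x 2 ^ 2 + x 3 ^ 2 := by fun_prop
    exact (isClosed_eq h1 continuous_const).inter (isClosed_eq h2 continuous_const)
  · refine isBounded_iff_forall_norm_le.2 ⟨√(r ^ 2 + s ^ 2), fun x hx => ?_⟩
    rw [EuclideanSpace.norm_eq]
    refine Real.sqrt_le_sqrt ?_
    simp only [Fin.sum_univ_four, Real.norm_eq_abs, sq_abs]
    linarith [hx.1, hx.2]

theorem exists_angle (hr : 0 < r) {a b : ℝ} (h : a ^ 2 + b ^ 2 = r ^ 2) :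
    ∃ t : ℝ, r * Real.cos t = a ∧ r * Real.sin t = b := by
  have h1 : ‖(⟨a, b⟩ : ℂ)‖ = r := by
    rw [Complex.norm_eq_sqrt_sq_add_sq, h, Real.sqrt_sq hr.le]
  have h2 := Complex.norm_mul_cos_arg (⟨a, b⟩ : ℂ)
  have h3 := Complex.norm_mul_sin_arg (⟨a, b⟩ : ℂ)
  rw [h1] at h2 h3
  exact ⟨_, h2, h3⟩

theorem isConnected_flatTorus (hr : 0 < r) (hs : 0 < s) : IsConnected (flatTorus r s) := by
  have h1 : Continuous fun t : ℝ × ℝ =>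
      (!₂[r * Real.cos t.1, r * Real.sin t.1, s * Real.cos t.2, s * Real.sin t.2] : Euc 4) := by
    fun_prop
  convert isConnected_univ.image _ h1.continuousOn using 1
  ext x
  constructor
  · rintro ⟨hx1, hx2⟩
    obtain ⟨α, h2, h3⟩ := exists_angle hr hx1
    obtain ⟨β, h4, h5⟩ := exists_angle hs hx2
    refine ⟨(α, β), mem_univ _, ?_⟩
    ext i
    fin_cases i <;> simpa
  · rintro ⟨t, -, rfl⟩
    constructor
    · simp only [Matrix.cons_val]
      linear_combination r ^ 2 * Real.sin_sq_add_cos_sq t.1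
    · simp only [Matrix.cons_val]
      linear_combination s ^ 2 * Real.sin_sq_add_cos_sq t.2

theorem isClosedSurface_flatTorus (hr : 0 < r) (hs : 0 < s) : IsClosedSurface (flatTorus r s) where
  isCompact := isCompact_flatTorus
  isConnected := isConnected_flatTorus hr hs
  exists_patch := by
    intro x hx
    have hr0 := hr.ne'
    have hs0 := hs.ne'
    -- On each factor, the half circle around `x` is a graph over its tangent line at `x`.
    let W : Set (Euc 4) := {z | 0 < x 0 * z 0 + x 1 * z 1 ∧ 0 < x 2 * z 2 + x 3 * z 3}
    let U : Set (Euc 2) := {y | y 0 ^ 2 < r ^ 2 ∧ y 1 ^ 2 < s ^ 2}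
    let p : Euc 2 → Euc 4 := fun y => !₂[(√(r ^ 2 - y 0 ^ 2) * x 0 - y 0 * x 1) / r,
      (√(r ^ 2 - y 0 ^ 2) * x 1 + y 0 * x 0) / r, (√(s ^ 2 - y 1 ^ 2) * x 2 - y 1 * x 3) / s,
      (√(s ^ 2 - y 1 ^ 2) * x 3 + y 1 * x 2) / s]
    let g : Euc 4 → Euc 2 := fun z => !₂[(x 0 * z 1 - x 1 * z 0) / r, (x 2 * z 3 - x 3 * z 2) / s]
    have hW : IsOpen W := by
      have h1 : Continuous fun z : Euc 4 => x 0 * z 0 + x 1 * z 1 := by fun_prop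
      have h2 : Continuous fun z : Euc 4 => x 2 * z 2 + x 3 * z 3 := by fun_prop
      exact (isOpen_lt continuous_const h1).inter (isOpen_lt continuous_const h2)
    have hU : IsOpen U := by
      have h1 : Continuous fun z : Euc 2 => z 0 ^ 2 := by fun_prop
      have h2 : Continuous fun z : Euc 2 => z 1 ^ 2 := by fun_prop
      exact (isOpen_lt h1 continuous_const).inter (isOpen_lt h2 continuous_const)
    have hpg : ∀ z ∈ flatTorus r s ∩ W, g z ∈ U ∧ p (g z) = z := by
      rintro z ⟨⟨hz1, hz2⟩, hz3, hz4⟩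
      obtain ⟨a1, a2, a3⟩ := circle_coordinates hr hx.1 hz1 hz3 rfl
      obtain ⟨b1, b2, b3⟩ := circle_coordinates hs hx.2 hz2 hz4 rfl
      refine ⟨⟨a1, b1⟩, ?_⟩
      ext i
      fin_cases i
      exacts [a2, a3, b2, b3]
    refine ⟨U, p, isSurfacePatch_of_leftInverse (W := W) (g := g) hW hU ?_ ?_ ?_ ?_ hpg, ?_⟩
    · have hc : ∀ i, ContDiffOn ℝ ∞ (fun y : Euc 2 => y i) U := fun i =>
        (EuclideanSpace.proj i : Euc 2 →L[ℝ] ℝ).contDiff.contDiffOn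
      have h1 : ContDiffOn ℝ ∞ (fun y : Euc 2 => √(r ^ 2 - y 0 ^ 2)) U :=
        (contDiffOn_const.sub ((hc 0).pow 2)).sqrt fun y hy => (sub_pos.2 hy.1).ne'
      have h2 : ContDiffOn ℝ ∞ (fun y : Euc 2 => √(s ^ 2 - y 1 ^ 2)) U :=
        (contDiffOn_const.sub ((hc 1).pow 2)).sqrt fun y hy => (sub_pos.2 hy.2).ne'
      rw [contDiffOn_euclidean]
      intro i
      fin_cases i
      · exact ((h1.mul contDiffOn_const).sub ((hc 0).mul contDiffOn_const)).div_const r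
      · exact ((h1.mul contDiffOn_const).add ((hc 0).mul contDiffOn_const)).div_const r
      · exact ((h2.mul contDiffOn_const).sub ((hc 1).mul contDiffOn_const)).div_const s
      · exact ((h2.mul contDiffOn_const).add ((hc 1).mul contDiffOn_const)).div_const s
    · have hc : ∀ i, ContDiff ℝ ∞ (fun y : Euc 4 => y i) := fun i =>
        (EuclideanSpace.proj i : Euc 4 →L[ℝ] ℝ).contDiff
      rw [contDiff_euclidean]
      intro i
      fin_cases i
      · exact ((contDiff_const.mul (hc 1)).sub (contDiff_const.mul (hc 0))).div_const r
      · exact ((contDiff_const.mul (hc 3)).sub (contDiff_const.mul (hc 2))).div_const s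
    · rintro y ⟨hy1, hy2⟩
      have e1 := Real.sq_sqrt (sub_pos.2 hy1).le
      have e2 := Real.sq_sqrt (sub_pos.2 hy2).le
      have e3 := Real.sqrt_pos.2 (sub_pos.2 hy1)
      have e4 := Real.sqrt_pos.2 (sub_pos.2 hy2)
      refine ⟨⟨?_, ?_⟩, ?_, ?_⟩
      · simp only [p, Matrix.cons_val]
        field_simp
        linear_combination (x 0 ^ 2 + x 1 ^ 2) * e1 + r ^ 2 * hx.1
      · simp only [p, Matrix.cons_val]
        field_simp
        linear_combination (x 2 ^ 2 + x 3 ^ 2) * e2 + s ^ 2 * hx.2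
      · simp only [p, Matrix.cons_val]
        have h1 : x 0 * ((√(r ^ 2 - y 0 ^ 2) * x 0 - y 0 * x 1) / r) +
            x 1 * ((√(r ^ 2 - y 0 ^ 2) * x 1 + y 0 * x 0) / r) = √(r ^ 2 - y 0 ^ 2) * r := by
          field_simp
          linear_combination √(r ^ 2 - y 0 ^ 2) * hx.1
        rw [h1]
        positivity
      · simp only [p, Matrix.cons_val]
        have h1 : x 2 * ((√(s ^ 2 - y 1 ^ 2) * x 2 - y 1 * x 3) / s) +
            x 3 * ((√(s ^ 2 - y 1 ^ 2) * x 3 + y 1 * x 2) / s) = √(s ^ 2 - y 1 ^ 2) * s := by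
          field_simp
          linear_combination √(s ^ 2 - y 1 ^ 2) * hx.2
        rw [h1]
        positivity
    · rintro y -
      ext i
      fin_cases i
      · simp only [p, g, Fin.zero_eta, Matrix.cons_val]
        field_simp
        linear_combination y 0 * hx.1
      · simp only [p, g, Fin.mk_one, Matrix.cons_val]
        field_simp
        linear_combination y 1 * hx.2
    · have hxW : x ∈ W := by
        constructor
        · rw [← sq, ← sq, hx.1]
          positivity
        · rw [← sq, ← sq, hx.2]
          positivity
      obtain ⟨h1, h2⟩ := hpg x ⟨hx, hxW⟩
      exact ⟨g x, h1, h2⟩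

end Torus

/-! ### Harmonic fields on the doubly periodic plane -/

section Torus

variable {r s : ℝ}

theorem constantField_eq (a b : ℝ) (x : Euc 4) :
    constantField r s a b x = a • constantField r s 1 0 x + b • constantField r s 0 1 x := by
  ext i
  fin_cases i <;> simp [constantField] <;> ring

theorem inner_constantField (hr : 0 < r) (hs : 0 < s) {x : Euc 4} (hx : x ∈ flatTorus r s)
    (a b c d : ℝ) :
    inner ℝ (constantField r s a b x) (constantField r s c d x) = a * c + b * d := by
  have hr0 := hr.ne'
  have hs0 := hs.ne'
  simp only [constantField, PiLp.inner_apply, Fin.sum_univ_four, Matrix.cons_val,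
    RCLike.inner_apply, conj_trivial]
  field_simp
  linear_combination (s ^ 2 * a * c) * hx.1 + (r ^ 2 * b * d) * hx.2

/-- The constant fields extend to linear vector fields on `ℝ⁴`, generators of rotations in the two
coordinate planes. -/
noncomputable def torusGenerator (r s a b : ℝ) : Euc 4 →L[ℝ] Euc 4 :=
  LinearMap.toContinuousLinearMap
    { toFun := constantField r s a b
      map_add' := fun x y => by
        ext i
        fin_cases i <;> simp [constantField] <;> ring
      map_smul' := fun c x => by
        ext i
        fin_cases i <;> simp [constantField] <;> ring }

theorem torusGenerator_apply (a b : ℝ) (x : Euc 4) :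
    torusGenerator r s a b x = constantField r s a b x := rfl

theorem torusGenerator_skew (a b : ℝ) (x : Euc 4) :
    inner ℝ (torusGenerator r s a b x) x = (0 : ℝ) := by
  rw [torusGenerator_apply]
  simp only [constantField, PiLp.inner_apply, Fin.sum_univ_four, Matrix.cons_val,
    RCLike.inner_apply, conj_trivial]
  ring

theorem mem_tangentPlane_flatTorus (hr : 0 < r) (hs : 0 < s) {x : Euc 4} (hx : x ∈ flatTorus r s)
    {v : Euc 4} : v ∈ tangentPlane (flatTorus r s) x ↔ ∃ a b, v = constantField r s a b x := by
  have hr0 := hr.ne'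
  have hs0 := hs.ne'
  have hc : ∀ i, HasFDerivAt (fun y : Euc 4 => y i) (EuclideanSpace.proj i : Euc 4 →L[ℝ] ℝ) x :=
    fun i => (EuclideanSpace.proj i : Euc 4 →L[ℝ] ℝ).hasFDerivAt
  have hle : ∀ v ∈ tangentPlane (flatTorus r s) x, ∃ a b, v = constantField r s a b x := by
    intro v hv
    have h1 := fderiv_eq_zero_of_mem_tangentPlane (((hc 0).pow 2).add ((hc 1).pow 2))
      (c := r ^ 2) (fun z hz => hz.1) hx hv
    have h2 := fderiv_eq_zero_of_mem_tangentPlane (((hc 2).pow 2).add ((hc 3).pow 2))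
      (c := s ^ 2) (fun z hz => hz.2) hx hv
    simp at h1 h2
    refine ⟨(x 0 * v 1 - x 1 * v 0) / r, (x 2 * v 3 - x 3 * v 2) / s, ?_⟩
    ext i
    fin_cases i
    · simp [constantField]
      field_simp
      linear_combination (-v 0) * hx.1 + (x 0 / 2) * h1
    · simp [constantField]
      field_simp
      linear_combination (-v 1) * hx.1 + (x 1 / 2) * h1
    · simp [constantField]
      field_simp
      linear_combination (-v 2) * hx.2 + (x 2 / 2) * h2
    · simp [constantField]
      field_simp
      linear_combination (-v 3) * hx.2 + (x 3 / 2) * h2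
  have h0 : ∀ a b, constantField r s a b x ∈
      Submodule.span ℝ (Set.range ![constantField r s 1 0 x, constantField r s 0 1 x]) := by
    intro a b
    have h1 : constantField r s 1 0 x ∈
        Submodule.span ℝ (Set.range ![constantField r s 1 0 x, constantField r s 0 1 x]) :=
      Submodule.subset_span ⟨0, rfl⟩
    have h2 : constantField r s 0 1 x ∈
        Submodule.span ℝ (Set.range ![constantField r s 1 0 x, constantField r s 0 1 x]) :=
      Submodule.subset_span ⟨1, rfl⟩
    rw [constantField_eq a b]
    exact Submodule.add_mem _ (Submodule.smul_mem _ _ h1) (Submodule.smul_mem _ _ h2)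
  have hspan : tangentPlane (flatTorus r s) x =
      Submodule.span ℝ (Set.range ![constantField r s 1 0 x, constantField r s 0 1 x]) := by
    refine Submodule.eq_of_le_of_finrank_le ?_ ?_
    · intro v hv
      obtain ⟨a, b, rfl⟩ := hle v hv
      exact h0 a b
    · rw [(isClosedSurface_flatTorus hr hs).finrank_tangentPlane hx]
      exact (finrank_range_le_card _).trans (by simp)
  refine ⟨hle v, ?_⟩
  rintro ⟨a, b, rfl⟩
  rw [hspan]
  exact h0 a b

/-- The rotation of the tangent planes which takes the constant field with components `(a, b)` to
the one with components `(-b, a)`. -/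
noncomputable def torusRotation (r s : ℝ) (x : Euc 4) : Euc 4 →L[ℝ] Euc 4 :=
  (innerSL ℝ (constantField r s 1 0 x)).smulRight (constantField r s 0 1 x) -
    (innerSL ℝ (constantField r s 0 1 x)).smulRight (constantField r s 1 0 x)

theorem torusRotation_apply (x v : Euc 4) : torusRotation r s x v =
    constantField r s (-inner ℝ (constantField r s 0 1 x) v)
      (inner ℝ (constantField r s 1 0 x) v) x := by
  rw [constantField_eq]
  simp only [torusRotation, _root_.sub_apply, ContinuousLinearMap.smulRight_apply, innerSL_apply_apply]
  module

theorem torusRotation_constantField (hr : 0 < r) (hs : 0 < s) {x : Euc 4}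
    (hx : x ∈ flatTorus r s) (a b : ℝ) :
    torusRotation r s x (constantField r s a b x) = constantField r s (-b) a x := by
  rw [torusRotation_apply, inner_constantField hr hs hx, inner_constantField hr hs hx]
  congr 1 <;> ring

theorem range_torusRotation (hr : 0 < r) (hs : 0 < s) {x : Euc 4} (hx : x ∈ flatTorus r s) :
    tangentPlane (flatTorus r s) x = LinearMap.range (torusRotation r s x : Euc 4 →ₗ[ℝ] Euc 4) := by
  ext v
  rw [mem_tangentPlane_flatTorus hr hs hx]
  constructor
  · rintro ⟨a, b, rfl⟩
    refine ⟨constantField r s b (-a) x, ?_⟩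
    exact (torusRotation_constantField hr hs hx b (-a)).trans (by rw [neg_neg])
  · rintro ⟨w, rfl⟩
    exact ⟨_, _, torusRotation_apply x w⟩

theorem isRotationField_torusRotation (hr : 0 < r) (hs : 0 < s) :
    IsRotationField (flatTorus r s) (torusRotation r s) where
  continuousOn := by
    have h1 : ∀ a b, Continuous (constantField r s a b) := fun a b =>
      (torusGenerator r s a b).continuous
    refine (continuous_clm_apply.2 fun v => ?_).continuousOn
    simp only [torusRotation, _root_.sub_apply, ContinuousLinearMap.smulRight_apply,
      innerSL_apply_apply]
    exact (((h1 1 0).inner (𝕜 := ℝ) continuous_const).smul (h1 0 1)).sub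
      (((h1 0 1).inner (𝕜 := ℝ) continuous_const).smul (h1 1 0))
  mapsTo := fun x hx v hv => by
    rw [range_torusRotation hr hs hx]
    exact ⟨v, rfl⟩
  norm_eq := fun x hx v hv => by
    obtain ⟨a, b, rfl⟩ := (mem_tangentPlane_flatTorus hr hs hx).1 hv
    rw [torusRotation_constantField hr hs hx, norm_eq_sqrt_real_inner, norm_eq_sqrt_real_inner,
      inner_constantField hr hs hx, inner_constantField hr hs hx]
    congr 1
    ring
  orthogonal := fun x hx v hv => by
    obtain ⟨a, b, rfl⟩ := (mem_tangentPlane_flatTorus hr hs hx).1 hv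
    rw [torusRotation_constantField hr hs hx, inner_constantField hr hs hx]
    ring

/-- The two coordinate rotations commute. -/
theorem torusGenerator_comm (q : MvPolynomial (Fin 4) ℝ) :
    polyDeriv (torusGenerator r s 1 0) (polyDeriv (torusGenerator r s 0 1) q) =
      polyDeriv (torusGenerator r s 0 1) (polyDeriv (torusGenerator r s 1 0) q) := by
  have h : ⁅polyDeriv (torusGenerator r s 1 0), polyDeriv (torusGenerator r s 0 1)⁆ = 0 := by
    refine MvPolynomial.derivation_ext fun i => ?_
    rw [Derivation.commutator_apply, polyDeriv_X, polyDeriv_X]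
    fin_cases i <;>
      simp [torusGenerator_apply, constantField, Fin.sum_univ_four, polyDeriv_X]
  have h1 := congrArg (fun D : Derivation ℝ (MvPolynomial (Fin 4) ℝ) (MvPolynomial (Fin 4) ℝ) => D q) h
  simp only [Derivation.commutator_apply] at h1
  exact sub_eq_zero.1 h1

theorem isConst_of_harmonic_flatTorus (hr : 0 < r) (hs : 0 < s) {f : L2 (flatTorus r s)}
    (hf : ∀ q, ∫ x, f x * polyFun (polyDeriv (torusGenerator r s 1 0)
      (polyDeriv (torusGenerator r s 1 0) q)) x ∂area (flatTorus r s) +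
      ∫ x, f x * polyFun (polyDeriv (torusGenerator r s 0 1)
      (polyDeriv (torusGenerator r s 0 1) q)) x ∂area (flatTorus r s) = 0) : IsConst f := by
  have hΩ := isClosedSurface_flatTorus hr hs
  refine hΩ.isConst_of_weakly_harmonic (A := ![torusGenerator r s 1 0, torusGenerator r s 0 1])
    (fun j v => ?_) (fun x hx => ?_) fun q => ?_
  · fin_cases j
    · exact torusGenerator_skew 1 0 v
    · exact torusGenerator_skew 0 1 v
  · apply le_antisymm
    · rw [Submodule.span_le]
      rintro _ ⟨j, rfl⟩
      fin_cases j
      · exact (mem_tangentPlane_flatTorus hr hs hx).2 ⟨1, 0, rfl⟩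
      · exact (mem_tangentPlane_flatTorus hr hs hx).2 ⟨0, 1, rfl⟩
    · intro v hv
      obtain ⟨a, b, rfl⟩ := (mem_tangentPlane_flatTorus hr hs hx).1 hv
      rw [constantField_eq]
      exact Submodule.add_mem _ (Submodule.smul_mem _ _ (Submodule.subset_span ⟨(0 : Fin 2), rfl⟩))
        (Submodule.smul_mem _ _ (Submodule.subset_span ⟨(1 : Fin 2), rfl⟩))
  · have hint : ∀ p, Integrable (fun x => f x * polyFun p x) (area (flatTorus r s)) := fun p =>
      hΩ.integrable_mul_of_continuousOn (hΩ.integrable_of_memLp f)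
        (contDiff_polyFun p).continuous.continuousOn
    refine Eq.trans ?_ (hf q)
    rw [← integral_add (hint _) (hint _)]
    simp only [Fin.sum_univ_two, polyFun_add, mul_add, Matrix.cons_val_zero, Matrix.cons_val_one]

/-- On the doubly periodic plane the components of a harmonic field are harmonic functions, hence
constant. Conversely, constant fields and their rotations are Killing fields. -/
theorem mem_harmonicFields_flatTorus (hr : 0 < r) (hs : 0 < s)
    {J : Euc 4 → Euc 4 →L[ℝ] Euc 4} (hJ : IsRotationField (flatTorus r s) J)
    (u : L2Vec (flatTorus r s)) : u ∈ harmonicFields (flatTorus r s) J ↔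
      ∃ a b : ℝ, ∀ᵐ x ∂area (flatTorus r s), u x = constantField r s a b x := by
  have hΩ := isClosedSurface_flatTorus hr hs
  have hT : ∀ a b, ∀ x ∈ flatTorus r s, constantField r s a b x ∈ tangentPlane (flatTorus r s) x :=
    fun a b x hx => (mem_tangentPlane_flatTorus hr hs hx).2 ⟨a, b, rfl⟩
  obtain ⟨σ, hσ, hJσ⟩ := hΩ.rotation_eq_or_neg hJ (isRotationField_torusRotation hr hs)
    fun x hx => range_torusRotation hr hs hx
  have hJc : ∀ a b, ∀ x ∈ flatTorus r s,
      J x (constantField r s a b x) = σ • constantField r s (-b) a x := by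
    intro a b x hx
    rw [hJσ x hx _ (hT a b x hx), torusRotation_constantField hr hs hx]
  constructor
  · intro hu
    have hcoef : ∀ c d, ∃ f : L2 (flatTorus r s), ∀ᵐ x ∂area (flatTorus r s),
        f x = inner ℝ (constantField r s c d x) (u x) := by
      intro c d
      have h1 : MemLp (fun x => (inner ℝ (constantField r s c d x) (u x) : ℝ)) 2
          (area (flatTorus r s)) := by
        refine (Lp.memLp u).of_le_mul (c := √(c * c + d * d)) ?_ ?_
        · exact (torusGenerator r s c d).continuous.aestronglyMeasurable.inner
            (Lp.aestronglyMeasurable u)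
        · filter_upwards [ae_area_mem hΩ.measurableSet] with x hx
          refine (norm_inner_le_norm _ _).trans (le_of_eq ?_)
          rw [norm_eq_sqrt_real_inner (constantField r s c d x), inner_constantField hr hs hx]
      exact ⟨h1.toLp _, h1.coeFn_toLp⟩
    obtain ⟨a, ha⟩ := hcoef 1 0
    obtain ⟨b, hb⟩ := hcoef 0 1
    have hab : ∀ᵐ x ∂area (flatTorus r s), u x = constantField r s (a x) (b x) x := by
      filter_upwards [ha, hb, hu.1.1, ae_area_mem hΩ.measurableSet] with x h1 h2 h3 hx
      obtain ⟨c, d, hcd⟩ := (mem_tangentPlane_flatTorus hr hs hx).1 h3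
      rw [h1, h2, hcd, inner_constantField hr hs hx, inner_constantField hr hs hx]
      congr 1 <;> ring
    have hint : ∀ (f : L2 (flatTorus r s)) (p), Integrable (fun x => f x * polyFun p x)
        (area (flatTorus r s)) := fun f p =>
      hΩ.integrable_mul_of_continuousOn (hΩ.integrable_of_memLp f)
        (contDiff_polyFun p).continuous.continuousOn
    have hfd : ∀ (q : MvPolynomial (Fin 4) ℝ) (c d : ℝ) (x : Euc 4),
        fderiv ℝ (polyFun q) x (constantField r s c d x) =
          c * polyFun (polyDeriv (torusGenerator r s 1 0) q) x +
            d * polyFun (polyDeriv (torusGenerator r s 0 1) q) x := by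
      intro q c d x
      rw [constantField_eq, map_add, map_smul, map_smul, polyFun_polyDeriv, polyFun_polyDeriv]
      rfl
    -- With `∂₁`, `∂₂` the derivatives along the unit constant fields: `∂₁a + ∂₂b = 0` weakly.
    have key1 : ∀ q, ∫ x, a x * polyFun (polyDeriv (torusGenerator r s 1 0) q) x
        ∂area (flatTorus r s) + ∫ x, b x * polyFun (polyDeriv (torusGenerator r s 0 1) q) x
        ∂area (flatTorus r s) = 0 := by
      intro q
      refine Eq.trans ?_ (hΩ.integral_fderiv_harmonic hJ hu (contDiff_polyFun q)).1
      rw [← integral_add (hint _ _) (hint _ _)]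
      refine integral_congr_ae ?_
      filter_upwards [hab] with x hx
      rw [hx, hfd]
    -- The rotated field gives the weak Cauchy–Riemann equation `∂₂a - ∂₁b = 0`.
    have key2 : ∀ q, ∫ x, a x * polyFun (polyDeriv (torusGenerator r s 0 1) q) x
        ∂area (flatTorus r s) - ∫ x, b x * polyFun (polyDeriv (torusGenerator r s 1 0) q) x
        ∂area (flatTorus r s) = 0 := by
      intro q
      have h1 := (hΩ.integral_fderiv_harmonic hJ hu (contDiff_polyFun q)).2
      have h2 : (fun x => fderiv ℝ (polyFun q) x (J x (u x))) =ᵐ[area (flatTorus r s)] fun x =>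
          σ * (a x * polyFun (polyDeriv (torusGenerator r s 0 1) q) x -
            b x * polyFun (polyDeriv (torusGenerator r s 1 0) q) x) := by
        filter_upwards [hab, ae_area_mem hΩ.measurableSet] with x hx hxΩ
        rw [hx, hJc _ _ x hxΩ, map_smul, hfd, smul_eq_mul]
        ring
      have hσ0 : σ ≠ 0 := by rcases hσ with h | h <;> simp [h]
      rw [integral_congr_ae h2, integral_const_mul, mul_eq_zero, or_iff_right hσ0,
        integral_sub (hint _ _) (hint _ _)] at h1
      exact h1
    obtain ⟨c, hc⟩ := isConst_of_harmonic_flatTorus hr hs (f := a) fun q => by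
      have h1 := key1 (polyDeriv (torusGenerator r s 1 0) q)
      have h2 := key2 (polyDeriv (torusGenerator r s 0 1) q)
      rw [← torusGenerator_comm] at h1
      linarith
    obtain ⟨d, hd⟩ := isConst_of_harmonic_flatTorus hr hs (f := b) fun q => by
      have h1 := key1 (polyDeriv (torusGenerator r s 0 1) q)
      have h2 := key2 (polyDeriv (torusGenerator r s 1 0) q)
      rw [← torusGenerator_comm] at h2
      linarith
    refine ⟨c, d, ?_⟩
    filter_upwards [hab, hc, hd] with x h1 h2 h3
    rw [h1, h2, h3]
  · rintro ⟨a, b, hab⟩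
    have huT : IsTangential u := by
      filter_upwards [hab, ae_area_mem hΩ.measurableSet] with x h1 h2
      rw [h1]
      exact hT a b x h2
    refine ⟨⟨huT, fun φ hφ => ⟨(HasWeakDiv.zero.2 φ hφ).1,
      hΩ.integrable_fderiv_apply hφ (hΩ.integrable_of_memLp u), ?_⟩⟩, ?_⟩
    · have h1 : (fun x => (0 : L2 (flatTorus r s)) x * φ x) =ᵐ[area (flatTorus r s)] fun _ => 0 := by
        filter_upwards [Lp.coeFn_zero ℝ 2 (area (flatTorus r s))] with x hx
        rw [hx, Pi.zero_apply, zero_mul]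
      have h2 : (fun x => fderiv ℝ φ x (u x)) =ᵐ[area (flatTorus r s)]
          fun x => fderiv ℝ φ x (torusGenerator r s a b x) := by
        filter_upwards [hab] with x hx
        rw [hx, torusGenerator_apply]
      rw [integral_congr_ae h1, integral_congr_ae h2,
        hΩ.integral_fderiv_skew (torusGenerator_skew a b) (hT a b) hφ]
      simp
    · rintro ψ - c ⟨w, hw, hc⟩
      have h1 := (hw.2 (torusGenerator r s (-b) a) (torusGenerator r s (-b) a).contDiff
        (hT (-b) a)).2.2
      have h2 : (fun x => ψ x * surfaceDiv (flatTorus r s) (torusGenerator r s (-b) a) x)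
          =ᵐ[area (flatTorus r s)] fun _ => 0 := by
        filter_upwards [ae_area_mem hΩ.measurableSet] with x hx
        rw [hΩ.surfaceDiv_skew (torusGenerator_skew (-b) a) hx, mul_zero]
      rw [integral_congr_ae h2, integral_zero, eq_comm, neg_eq_zero] at h1
      have h3 : (fun x => (inner ℝ (u x) (c x) : ℝ)) =ᵐ[area (flatTorus r s)]
          fun x => -σ * inner ℝ (w x) (torusGenerator r s (-b) a x) := by
        filter_upwards [hab, hc, hw.1, ae_area_mem hΩ.measurableSet] with x h4 h5 h6 hx
        rw [h4, h5, real_inner_comm, rotation_skew (hJ.orthogonal x hx) h6 (hT a b x hx),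
          hJc a b x hx, real_inner_smul_left, real_inner_comm, torusGenerator_apply, neg_mul]
      rw [L2.inner_def, integral_congr_ae h3, integral_const_mul, h1, mul_zero]

theorem finrank_harmonicFields_flatTorus (hr : 0 < r) (hs : 0 < s)
    {J : Euc 4 → Euc 4 →L[ℝ] Euc 4} (hJ : IsRotationField (flatTorus r s) J) :
    finrank ℝ (harmonicFields (flatTorus r s) J) = 2 := by
  have hΩ := isClosedSurface_flatTorus hr hs
  have hm : ∀ c d, MemLp (constantField r s c d) 2 (area (flatTorus r s)) := fun c d =>
    hΩ.memLp_of_continuousOn (torusGenerator r s c d).continuous.continuousOn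
  let L : ℝ × ℝ →ₗ[ℝ] L2Vec (flatTorus r s) :=
    (LinearMap.fst ℝ ℝ ℝ).smulRight ((hm 1 0).toLp _) +
      (LinearMap.snd ℝ ℝ ℝ).smulRight ((hm 0 1).toLp _)
  have hL : ∀ a b, ∀ᵐ x ∂area (flatTorus r s), L (a, b) x = constantField r s a b x := by
    intro a b
    filter_upwards [Lp.coeFn_add (a • (hm 1 0).toLp _) (b • (hm 0 1).toLp _),
      Lp.coeFn_smul a ((hm 1 0).toLp _), Lp.coeFn_smul b ((hm 0 1).toLp _), (hm 1 0).coeFn_toLp,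
      (hm 0 1).coeFn_toLp] with x h1 h2 h3 h4 h5
    change (a • (hm 1 0).toLp _ + b • (hm 0 1).toLp _ : L2Vec (flatTorus r s)) x = _
    rw [h1, Pi.add_apply, h2, h3, Pi.smul_apply, Pi.smul_apply, h4, h5, ← constantField_eq]
  have hrange : harmonicFields (flatTorus r s) J = LinearMap.range L := by
    ext u
    rw [mem_harmonicFields_flatTorus hr hs hJ]
    constructor
    · rintro ⟨a, b, hab⟩
      refine ⟨(a, b), Lp.ext ?_⟩
      filter_upwards [hab, hL a b] with x h1 h2
      rw [h1, h2]
    · rintro ⟨⟨a, b⟩, rfl⟩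
      exact ⟨a, b, hL a b⟩
  have hinj : Function.Injective L := by
    rw [injective_iff_map_eq_zero]
    rintro ⟨a, b⟩ h0
    obtain ⟨x₀, hx₀⟩ := hΩ.isConnected.nonempty
    have : NeZero (area (flatTorus r s)) := ⟨fun h => by
      have h1 := hΩ.area_pos hx₀ univ_mem
      simp [h] at h1⟩
    have h1 : ∀ᵐ x ∂area (flatTorus r s), a * a + b * b = 0 := by
      filter_upwards [hL a b, Lp.coeFn_zero (Euc 4) 2 (area (flatTorus r s)),
        ae_area_mem hΩ.measurableSet] with x h1 h2 hx
      rw [← inner_constantField hr hs hx, ← h1, h0, h2, Pi.zero_apply, inner_zero_left]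
    obtain ⟨-, h2⟩ := h1.exists
    have ha : a = 0 := by nlinarith [mul_self_nonneg a, mul_self_nonneg b]
    have hb : b = 0 := by nlinarith [mul_self_nonneg a, mul_self_nonneg b]
    rw [ha, hb]
    rfl
  rw [hrange, LinearMap.finrank_range_of_inj hinj]
  simp

end Torus

/-! ### The sphere is a closed surface -/

section Sphere

variable {R : ℝ}

theorem inner_Euc_three (x y : Euc 3) : inner ℝ x y = x 0 * y 0 + x 1 * y 1 + x 2 * y 2 := by
  simp only [PiLp.inner_apply, Fin.sum_univ_three, RCLike.inner_apply, conj_trivial]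
  ring

theorem isClosedSurface_sphere (hR : 0 < R) : IsClosedSurface (sphere (0 : Euc 3) R) where
  isCompact := isCompact_sphere _ _
  isConnected := isConnected_sphere
    (by rw [rank_eq_card_basis (EuclideanSpace.basisFun (Fin 3) ℝ).toBasis]; simp) _ hR.le
  exists_patch := by
    intro x hx
    have hxn : ‖x‖ = R := mem_sphere_zero_iff_norm.1 hx
    have hx0 : x ≠ 0 := norm_ne_zero_iff.1 (hxn ▸ hR.ne')
    have : Fact (finrank ℝ (Euc 3) = 2 + 1) := ⟨by simp⟩
    let K : Submodule ℝ (Euc 3) := (ℝ ∙ x)ᗮ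
    let e : K ≃ₗᵢ[ℝ] Euc 2 := (OrthonormalBasis.fromOrthogonalSpanSingleton (𝕜 := ℝ) 2 hx0).repr
    -- Orthographic projection onto the plane orthogonal to `x`.
    let g : Euc 3 → Euc 2 := fun z => e (K.orthogonalProjectionOnto z)
    let p : Euc 2 → Euc 3 := fun y => (e.symm y : Euc 3) + (√(R ^ 2 - ‖y‖ ^ 2) / R) • x
    have hsymm : ∀ y : Euc 2, inner ℝ x (e.symm y : Euc 3) = (0 : ℝ) := fun y =>
      Submodule.mem_orthogonal_singleton_iff_inner_right.1 (e.symm y).2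
    have hnorm : ∀ (k : K) (t : ℝ), ‖(k : Euc 3) + t • x‖ ^ 2 = ‖k‖ ^ 2 + t ^ 2 * R ^ 2 := by
      intro k t
      have h1 : inner ℝ x (k : Euc 3) = (0 : ℝ) :=
        Submodule.mem_orthogonal_singleton_iff_inner_right.1 k.2
      rw [norm_add_sq_real, real_inner_smul_right, real_inner_comm, h1, norm_smul, mul_pow, hxn,
        Real.norm_eq_abs, sq_abs]
      simp
    have hgp : ∀ (k : K) (t : ℝ), g ((k : Euc 3) + t • x) = e k := by
      intro k t
      have h1 : K.orthogonalProjectionOnto x = 0 :=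
        Submodule.orthogonalProjectionOnto_orthogonal_apply_eq_zero (Submodule.mem_span_singleton_self x)
      simp only [g, map_add, map_smul, h1, smul_zero, add_zero,
        Submodule.orthogonalProjectionOnto_mem_subspace_eq_self]
    have hpg : ∀ z ∈ sphere (0 : Euc 3) R ∩ {z | 0 < inner ℝ x z}, g z ∈ ball (0 : Euc 2) R ∧
        p (g z) = z := by
      rintro z ⟨hz, hzx⟩
      have hzn : ‖z‖ = R := mem_sphere_zero_iff_norm.1 hz
      have h1 : z = (K.orthogonalProjectionOnto z : Euc 3) + (inner ℝ x z / R ^ 2) • x := by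
        have h2 := (ℝ ∙ x).starProjection_add_starProjection_orthogonal z
        rw [Submodule.starProjection_singleton, hxn] at h2
        rw [add_comm]
        exact h2.symm
      have hg : ‖g z‖ ^ 2 = R ^ 2 - (inner ℝ x z / R) ^ 2 := by
        have h2 := hnorm (K.orthogonalProjectionOnto z) (inner ℝ x z / R ^ 2)
        rw [← h1, hzn] at h2
        simp only [g, LinearIsometryEquiv.norm_map]
        rw [h2]
        have := hR.ne'
        field_simp
        ring
      have hpos : 0 < inner ℝ x z / R := div_pos hzx hR
      constructor
      · rw [mem_ball_zero_iff]
        exact lt_of_pow_lt_pow_left₀ 2 hR.le (by rw [hg]; nlinarith [pow_pos hpos 2])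
      · simp only [p]
        rw [hg, sub_sub_cancel, Real.sqrt_sq hpos.le, div_div, ← sq]
        simp only [g, LinearIsometryEquiv.symm_apply_apply]
        exact h1.symm
    refine ⟨ball 0 R, p, isSurfacePatch_of_leftInverse (W := {z | 0 < inner ℝ x z}) (g := g)
      (isOpen_lt continuous_const (by fun_prop)) isOpen_ball ?_ ?_ ?_ ?_ hpg, ?_⟩
    · refine ContDiffOn.add (K.subtypeL.contDiff.comp e.symm.contDiff).contDiffOn
        (ContDiffOn.smul (ContDiffOn.div_const (ContDiffOn.sqrt
          (contDiffOn_const.sub (contDiff_norm_sq ℝ).contDiffOn) fun y hy => ?_) _)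
          contDiffOn_const)
      rw [mem_ball_zero_iff] at hy
      exact (sub_pos.2 (pow_lt_pow_left₀ hy (norm_nonneg _) two_ne_zero)).ne'
    · exact e.contDiff.comp K.orthogonalProjectionOnto.contDiff
    · intro y hy
      rw [mem_ball_zero_iff] at hy
      have h1 : 0 < R ^ 2 - ‖y‖ ^ 2 := sub_pos.2 (pow_lt_pow_left₀ hy (norm_nonneg _) two_ne_zero)
      constructor
      · rw [mem_sphere_zero_iff_norm, ← sq_eq_sq₀ (norm_nonneg _) hR.le, hnorm,
          LinearIsometryEquiv.norm_map, div_pow, Real.sq_sqrt h1.le]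
        have := hR.ne'
        field_simp
        ring
      · simp only [p, mem_ofPred_eq, inner_add_right, hsymm, real_inner_smul_right, zero_add,
          real_inner_self_eq_norm_sq, hxn]
        have := Real.sqrt_pos.2 h1
        positivity
    · intro y _
      exact (hgp _ _).trans (e.apply_symm_apply y)
    · obtain ⟨h1, h2⟩ := hpg x ⟨hx, by
        rw [mem_ofPred_eq, real_inner_self_eq_norm_sq, hxn]; positivity⟩
      exact ⟨g x, h1, h2⟩

theorem tangentPlane_sphere (hR : 0 < R) {x : Euc 3} (hx : x ∈ sphere (0 : Euc 3) R) :
    tangentPlane (sphere (0 : Euc 3) R) x = (ℝ ∙ x)ᗮ := by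
  have hxn : ‖x‖ = R := mem_sphere_zero_iff_norm.1 hx
  have hx0 : x ≠ 0 := norm_ne_zero_iff.1 (hxn ▸ hR.ne')
  have : Fact (finrank ℝ (Euc 3) = 2 + 1) := ⟨by simp⟩
  refine Submodule.eq_of_le_of_finrank_le (fun v hv => ?_) ?_
  · have h1 := fderiv_eq_zero_of_mem_tangentPlane (hasStrictFDerivAt_norm_sq x).hasFDerivAt
      (c := R ^ 2) (fun z hz => by rw [mem_sphere_zero_iff_norm.1 hz]) hx hv
    rw [Submodule.mem_orthogonal_singleton_iff_inner_right]
    simpa using h1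
  · rw [Submodule.finrank_orthogonal_span_singleton (n := 2) hx0,
      (isClosedSurface_sphere hR).finrank_tangentPlane hx]

/-! ### Harmonic fields on the sphere -/

/-- The cross product with `a`, as a linear vector field on `ℝ³`: the generator of the rotations
around the axis `a`. -/
noncomputable def crossL (a : Euc 3) : Euc 3 →L[ℝ] Euc 3 :=
  LinearMap.toContinuousLinearMap
    { toFun := fun v => !₂[a 1 * v 2 - a 2 * v 1, a 2 * v 0 - a 0 * v 2, a 0 * v 1 - a 1 * v 0]
      map_add' := fun x y => by
        ext i
        fin_cases i <;> simp <;> ring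
      map_smul' := fun c x => by
        ext i
        fin_cases i <;> simp <;> ring }

theorem crossL_apply (a v : Euc 3) : crossL a v =
    !₂[a 1 * v 2 - a 2 * v 1, a 2 * v 0 - a 0 * v 2, a 0 * v 1 - a 1 * v 0] := rfl

theorem inner_crossL_self (a v : Euc 3) : inner ℝ (crossL a v) v = (0 : ℝ) := by
  rw [inner_Euc_three, crossL_apply]
  simp only [Matrix.cons_val]
  ring

theorem inner_self_crossL (a v : Euc 3) : inner ℝ a (crossL a v) = (0 : ℝ) := by
  rw [inner_Euc_three, crossL_apply]
  simp only [Matrix.cons_val]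
  ring

theorem crossL_crossL (a v : Euc 3) :
    crossL a (crossL a v) = (inner ℝ a v : ℝ) • a - (inner ℝ a a : ℝ) • v := by
  rw [inner_Euc_three, inner_Euc_three, crossL_apply, crossL_apply]
  ext i
  fin_cases i <;> simp <;> ring

theorem inner_crossL_crossL (a v : Euc 3) : inner ℝ (crossL a v) (crossL a v) =
    inner ℝ a a * inner ℝ v v - (inner ℝ a v : ℝ) ^ 2 := by
  simp only [inner_Euc_three, crossL_apply, Matrix.cons_val]
  ring

/-- The rotation `v ↦ k × v` for the outer unit normal `k = x / R`. -/
noncomputable def sphereRotation (R : ℝ) (x : Euc 3) : Euc 3 →L[ℝ] Euc 3 := R⁻¹ • crossL x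

theorem sphereRotation_apply (x v : Euc 3) : sphereRotation R x v = R⁻¹ • crossL x v := rfl

theorem mem_tangentPlane_sphere (hR : 0 < R) {x : Euc 3} (hx : x ∈ sphere (0 : Euc 3) R)
    {v : Euc 3} : v ∈ tangentPlane (sphere (0 : Euc 3) R) x ↔ inner ℝ x v = (0 : ℝ) := by
  rw [tangentPlane_sphere hR hx, Submodule.mem_orthogonal_singleton_iff_inner_right]

theorem crossL_crossL_of_mem_tangentPlane (hR : 0 < R) {x : Euc 3} (hx : x ∈ sphere (0 : Euc 3) R) {v : Euc 3}
    (hv : v ∈ tangentPlane (sphere (0 : Euc 3) R) x) :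
    crossL x (crossL x v) = (-R ^ 2) • v := by
  rw [mem_tangentPlane_sphere hR hx] at hv
  rw [crossL_crossL, hv, real_inner_self_eq_norm_sq, mem_sphere_zero_iff_norm.1 hx, zero_smul,
    zero_sub, neg_smul]

theorem range_sphereRotation (hR : 0 < R) {x : Euc 3} (hx : x ∈ sphere (0 : Euc 3) R) :
    tangentPlane (sphere (0 : Euc 3) R) x =
      LinearMap.range (sphereRotation R x : Euc 3 →ₗ[ℝ] Euc 3) := by
  have hR0 := hR.ne'
  ext v
  constructor
  · intro hv
    refine ⟨(-R⁻¹) • crossL x v, ?_⟩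
    change R⁻¹ • crossL x ((-R⁻¹) • crossL x v) = v
    rw [map_smul, crossL_crossL_of_mem_tangentPlane hR hx hv, smul_smul, smul_smul]
    have h1 : R⁻¹ * (-R⁻¹ * -R ^ 2) = 1 := by field_simp
    rw [← mul_assoc] at h1
    rw [h1, one_smul]
  · rintro ⟨w, rfl⟩
    rw [mem_tangentPlane_sphere hR hx]
    change inner ℝ x (R⁻¹ • crossL x w) = (0 : ℝ)
    rw [real_inner_smul_right, inner_self_crossL, mul_zero]

theorem isRotationField_sphereRotation (hR : 0 < R) :
    IsRotationField (sphere (0 : Euc 3) R) (sphereRotation R) where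
  continuousOn := by
    refine (continuous_clm_apply.2 fun v => ?_).continuousOn
    simp only [sphereRotation_apply, crossL_apply]
    fun_prop
  mapsTo := fun x hx v _ => by
    rw [range_sphereRotation hR hx]
    exact ⟨v, rfl⟩
  norm_eq := fun x hx v hv => by
    rw [mem_tangentPlane_sphere hR hx] at hv
    have h1 : ‖crossL x v‖ ^ 2 = (R * ‖v‖) ^ 2 := by
      rw [← real_inner_self_eq_norm_sq, inner_crossL_crossL, hv, real_inner_self_eq_norm_sq,
        real_inner_self_eq_norm_sq, mem_sphere_zero_iff_norm.1 hx]
      ring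
    rw [sq_eq_sq₀ (norm_nonneg _) (by positivity)] at h1
    rw [sphereRotation_apply, norm_smul, h1, norm_inv, Real.norm_of_nonneg hR.le,
      inv_mul_cancel_left₀ hR.ne']
  orthogonal := fun x _ v _ => by
    rw [sphereRotation_apply, real_inner_smul_left, inner_crossL_self, mul_zero]

/-- The derivative along the rotation around the `j`-th coordinate axis, i.e. the `j`-th component
of the operator `x × ∇`. -/
noncomputable def axisDeriv (j : Fin 3) :
    Derivation ℝ (MvPolynomial (Fin 3) ℝ) (MvPolynomial (Fin 3) ℝ) :=
  polyDeriv (crossL (EuclideanSpace.single j 1))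

/-- For `L = x × ∇`, this is `a · L q = -dq(x × a)`. -/
theorem sum_axisDeriv (q : MvPolynomial (Fin 3) ℝ) (x a : Euc 3) :
    a 0 * polyFun (axisDeriv 0 q) x + a 1 * polyFun (axisDeriv 1 q) x +
      a 2 * polyFun (axisDeriv 2 q) x = -fderiv ℝ (polyFun q) x (crossL x a) := by
  have h1 : -crossL x a = a 0 • crossL (EuclideanSpace.single 0 1) x +
      a 1 • crossL (EuclideanSpace.single 1 1) x + a 2 • crossL (EuclideanSpace.single 2 1) x := by
    ext i
    fin_cases i <;> simp [crossL_apply] <;> ring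
  rw [← map_neg, h1, map_add, map_add, map_smul, map_smul, map_smul]
  simp only [axisDeriv, polyFun_polyDeriv, smul_eq_mul]

/-- The components of `x × ∇` satisfy the commutation relations of angular momentum. -/
theorem axisDeriv_comm (q : MvPolynomial (Fin 3) ℝ) :
    axisDeriv 0 (axisDeriv 1 q) - axisDeriv 1 (axisDeriv 0 q) = -axisDeriv 2 q ∧
    axisDeriv 1 (axisDeriv 2 q) - axisDeriv 2 (axisDeriv 1 q) = -axisDeriv 0 q ∧
    axisDeriv 2 (axisDeriv 0 q) - axisDeriv 0 (axisDeriv 2 q) = -axisDeriv 1 q := by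
  have key : ∀ i j k : Fin 3, ⁅axisDeriv i, axisDeriv j⁆ = -axisDeriv k →
      axisDeriv i (axisDeriv j q) - axisDeriv j (axisDeriv i q) = -axisDeriv k q := by
    intro i j k h
    rw [← Derivation.commutator_apply, h]
    rfl
  refine ⟨key 0 1 2 ?_, key 1 2 0 ?_, key 2 0 1 ?_⟩ <;>
    refine MvPolynomial.derivation_ext fun i => ?_ <;>
    rw [Derivation.commutator_apply, Derivation.neg_apply, axisDeriv, axisDeriv, axisDeriv,
      polyDeriv_X, polyDeriv_X, polyDeriv_X] <;>
    fin_cases i <;>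
    simp [crossL_apply, polyDeriv_X]

theorem axisDeriv_X (j a : Fin 3) : polyFun (axisDeriv j (MvPolynomial.X a)) =
    fun x => crossL (EuclideanSpace.single j 1) x a := by
  funext x
  have h1 : polyFun (MvPolynomial.X a : MvPolynomial (Fin 3) ℝ) = fun x => x a :=
    funext (polyFun_X a)
  rw [axisDeriv, polyFun_polyDeriv, h1]
  have h2 : HasFDerivAt (fun z : Euc 3 => z a) (EuclideanSpace.proj a : Euc 3 →L[ℝ] ℝ) x :=
    (EuclideanSpace.proj a : Euc 3 →L[ℝ] ℝ).hasFDerivAt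
  rw [h2.fderiv]
  rfl

/-- The polynomial `i`-th component of `x × (x × ∇) q`. -/
noncomputable def crossDeriv (q : MvPolynomial (Fin 3) ℝ) : Fin 3 → MvPolynomial (Fin 3) ℝ :=
  ![MvPolynomial.X 1 * axisDeriv 2 q - MvPolynomial.X 2 * axisDeriv 1 q,
    MvPolynomial.X 2 * axisDeriv 0 q - MvPolynomial.X 0 * axisDeriv 2 q,
    MvPolynomial.X 0 * axisDeriv 1 q - MvPolynomial.X 1 * axisDeriv 0 q]

/-- With `L = x × ∇` and a tangent vector `v` at a point `x`, this expresses the multiple `vᵢ L² q`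
of the Laplacian through first derivatives along `v` and along `x × v`. -/
theorem mul_laplacian_eq (q : MvPolynomial (Fin 3) ℝ) {x v : Euc 3} (hx : x ≠ 0)
    (hv : inner ℝ x v = (0 : ℝ)) (i : Fin 3) :
    v i * polyFun (∑ j, axisDeriv j (axisDeriv j q)) x =
      -fderiv ℝ (polyFun (crossDeriv q i)) x v -
        fderiv ℝ (polyFun (axisDeriv i q)) x (crossL x v) := by
  have hxx0 : (inner ℝ x x : ℝ) ≠ 0 := inner_self_ne_zero.2 hx
  have hψ : fderiv ℝ (polyFun (crossDeriv q i)) x v * inner ℝ x x =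
      crossL x v 0 * polyFun (axisDeriv 0 (crossDeriv q i)) x +
      crossL x v 1 * polyFun (axisDeriv 1 (crossDeriv q i)) x +
      crossL x v 2 * polyFun (axisDeriv 2 (crossDeriv q i)) x := by
    rw [sum_axisDeriv, crossL_crossL, hv, zero_smul, zero_sub, map_neg, map_smul, smul_eq_mul,
      neg_neg, mul_comm]
  refine mul_left_cancel₀ hxx0 ?_
  rw [mul_sub, mul_neg, mul_comm _ (fderiv ℝ (polyFun (crossDeriv q i)) x v), hψ,
    ← neg_eq_iff_eq_neg.2 (sum_axisDeriv (axisDeriv i q) x v)]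
  have hxx : crossL x x = 0 := by
    ext i
    fin_cases i <;> simp [crossL_apply] <;> ring
  have hsum : ∀ p, x 0 * polyFun (axisDeriv 0 p) x + x 1 * polyFun (axisDeriv 1 p) x +
      x 2 * polyFun (axisDeriv 2 p) x = 0 := fun p => by
    rw [sum_axisDeriv, hxx, map_zero, neg_zero]
  obtain ⟨hc2, hc0, hc1⟩ := axisDeriv_comm q
  replace hc0 := congrArg (fun p => polyFun p x) hc0
  replace hc1 := congrArg (fun p => polyFun p x) hc1
  replace hc2 := congrArg (fun p => polyFun p x) hc2
  simp only [polyFun_sub, polyFun_neg] at hc0 hc1 hc2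
  have hQ0 := hsum (axisDeriv 0 q)
  have hQ1 := hsum (axisDeriv 1 q)
  have hQ2 := hsum (axisDeriv 2 q)
  rw [inner_Euc_three] at hv ⊢
  simp only [Fin.sum_univ_three, polyFun_add]
  have hX : ∀ (j a : Fin 3) (p), polyFun (axisDeriv j (MvPolynomial.X a * p)) x =
      x a * polyFun (axisDeriv j p) x + polyFun p x * crossL (EuclideanSpace.single j 1) x a := by
    intro j a p
    rw [Derivation.leibniz, smul_eq_mul, smul_eq_mul, polyFun_add, polyFun_mul, polyFun_mul,
      polyFun_X, axisDeriv_X]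
  -- The difference of the two sides lies in the ideal generated by the relations above.
  fin_cases i
  · simp only [crossDeriv, Fin.zero_eta, Matrix.cons_val, map_sub,
      polyFun_sub, hX, crossL_apply, PiLp.single_apply, Fin.reduceEq, if_true, if_false]
    linear_combination
      (-polyFun (axisDeriv 2 q) x * x 1 -
        polyFun (axisDeriv 0 (axisDeriv 1 q)) x * x 1 + polyFun (axisDeriv 1 (axisDeriv 1 q)) x * x 0 -
        polyFun (axisDeriv 2 (axisDeriv 0 q)) x * x 2 + polyFun (axisDeriv 2 (axisDeriv 2 q)) x * x 0) *
        hv +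
      (v 0 * x 1 - v 1 * x 0) * hQ1 +
      (v 0 * x 2 - v 2 * x 0) * hQ2 +
      (v 1 * x 0 ^ 2 + v 1 * x 1 ^ 2 + v 1 * x 2 ^ 2) * hc2 +
      (v 0 * x 0 * x 2 + v 1 * x 1 * x 2 - v 2 * x 0 ^ 2 - v 2 * x 1 ^ 2) * hc1
  · simp only [crossDeriv, Fin.mk_one, Matrix.cons_val, map_sub,
      polyFun_sub, hX, crossL_apply, PiLp.single_apply, Fin.reduceEq, if_true, if_false]
    linear_combination
      (polyFun (axisDeriv 2 q) x * x 0 +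
        polyFun (axisDeriv 0 (axisDeriv 0 q)) x * x 1 - polyFun (axisDeriv 1 (axisDeriv 0 q)) x * x 0 -
        polyFun (axisDeriv 2 (axisDeriv 1 q)) x * x 2 + polyFun (axisDeriv 2 (axisDeriv 2 q)) x * x 1) *
        hv +
      (-v 0 * x 1 + v 1 * x 0) * hQ0 +
      (v 1 * x 2 - v 2 * x 1) * hQ2 +
      (-v 0 * x 0 ^ 2 - v 0 * x 1 ^ 2 - v 0 * x 2 ^ 2) * hc2 +
      (-v 0 * x 0 * x 2 - v 1 * x 1 * x 2 + v 2 * x 0 ^ 2 + v 2 * x 1 ^ 2) * hc0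
  · simp only [crossDeriv, Fin.reduceFinMk, Matrix.cons_val, map_sub,
      polyFun_sub, hX, crossL_apply, PiLp.single_apply, Fin.reduceEq, if_true, if_false]
    linear_combination
      (polyFun (axisDeriv 0 q) x * x 1 -
        polyFun (axisDeriv 1 q) x * x 0 + polyFun (axisDeriv 0 (axisDeriv 0 q)) x * x 2 +
        polyFun (axisDeriv 1 (axisDeriv 1 q)) x * x 2 - polyFun (axisDeriv 2 (axisDeriv 0 q)) x * x 0 -
        polyFun (axisDeriv 2 (axisDeriv 1 q)) x * x 1) *
        hv +
      (-v 0 * x 2 + v 2 * x 0) * hQ0 +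
      (-v 1 * x 2 + v 2 * x 1) * hQ1 +
      (-v 1 * x 0 ^ 2 - v 1 * x 1 ^ 2 - v 1 * x 2 ^ 2) * hc0 +
      (v 0 * x 0 ^ 2 + v 0 * x 1 ^ 2 + v 0 * x 2 ^ 2) * hc1

/-- On the sphere the Cartesian components of a rotated harmonic field `v` are harmonic functions, so
`v` is a constant vector of `ℝ³`, which is tangential only if it vanishes. -/
theorem harmonicFields_sphere (hR : 0 < R) {J : Euc 3 → Euc 3 →L[ℝ] Euc 3}
    (hJ : IsRotationField (sphere (0 : Euc 3) R) J) :
    harmonicFields (sphere (0 : Euc 3) R) J = ⊥ := by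
  have hΩ := isClosedSurface_sphere hR
  have hR0 := hR.ne'
  have hN := isRotationField_sphereRotation hR
  obtain ⟨σ, hσ, hJσ⟩ := hΩ.rotation_eq_or_neg hJ hN fun x hx => range_sphereRotation hR hx
  have hσ0 : σ ≠ 0 := by rcases hσ with h | h <;> simp [h]
  rw [Submodule.eq_bot_iff]
  intro u hu
  obtain ⟨v, hv⟩ := hΩ.exists_rotated hN hu.1.1
  have hv1 : ∀ φ : Euc 3 → ℝ, ContDiff ℝ ∞ φ →
      ∫ x, fderiv ℝ φ x (v x) ∂area (sphere (0 : Euc 3) R) = 0 := by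
    intro φ hφ
    have h1 := (hΩ.integral_fderiv_harmonic hJ hu hφ).2
    have h2 : (fun x => fderiv ℝ φ x (J x (u x))) =ᵐ[area (sphere (0 : Euc 3) R)]
        fun x => σ * fderiv ℝ φ x (v x) := by
      filter_upwards [hv, hu.1.1, ae_area_mem hΩ.measurableSet] with x h3 h4 hx
      rw [h3, hJσ x hx _ h4, map_smul, smul_eq_mul]
    rw [integral_congr_ae h2, integral_const_mul, mul_eq_zero, or_iff_right hσ0] at h1
    exact h1
  have hvT : ∀ᵐ x ∂area (sphere (0 : Euc 3) R), inner ℝ x (v x) = (0 : ℝ) := by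
    filter_upwards [hv] with x h1
    rw [h1, sphereRotation_apply, real_inner_smul_right, inner_self_crossL, mul_zero]
  have hvu : ∀ᵐ x ∂area (sphere (0 : Euc 3) R), crossL x (v x) = (-R) • u x := by
    filter_upwards [hv, hu.1.1, ae_area_mem hΩ.measurableSet] with x h1 h2 hx
    rw [h1, sphereRotation_apply, map_smul, crossL_crossL_of_mem_tangentPlane hR hx h2, smul_smul]
    congr 1
    field_simp
  have hspan : ∀ x ∈ sphere (0 : Euc 3) R, Submodule.span ℝ
      (Set.range fun j : Fin 3 => crossL (EuclideanSpace.single j 1) x) =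
      tangentPlane (sphere (0 : Euc 3) R) x := by
    intro x hx
    apply le_antisymm
    · rw [Submodule.span_le]
      rintro _ ⟨j, rfl⟩
      rw [SetLike.mem_coe, mem_tangentPlane_sphere hR hx, real_inner_comm]
      exact inner_crossL_self _ _
    · intro w hw
      rw [range_sphereRotation hR hx] at hw
      obtain ⟨a, rfl⟩ := hw
      have h1 : sphereRotation R x a = ∑ j, (-R⁻¹ * a j) • crossL (EuclideanSpace.single j 1) x := by
        rw [sphereRotation_apply, Fin.sum_univ_three]
        ext i
        fin_cases i <;> simp [crossL_apply] <;> ring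
      change sphereRotation R x a ∈ _
      rw [h1]
      exact Submodule.sum_mem _ fun j _ => Submodule.smul_mem _ _ (Submodule.subset_span ⟨j, rfl⟩)
  -- The two terms in `mul_laplacian_eq` integrate to zero, as `v` and `u` are divergence-free.
  have hcomp : ∀ i : Fin 3, ∃ c : ℝ, ∀ᵐ x ∂area (sphere (0 : Euc 3) R), v x i = c := by
    intro i
    have hf := (EuclideanSpace.proj i : Euc 3 →L[ℝ] ℝ).coeFn_compLp v
    obtain ⟨c, hc⟩ := hΩ.isConst_of_weakly_harmonic
      (A := fun j : Fin 3 => crossL (EuclideanSpace.single j 1))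
      (fun j w => inner_crossL_self _ _) hspan
      (f := (EuclideanSpace.proj i : Euc 3 →L[ℝ] ℝ).compLp v) fun q => by
        have h1 := hv1 _ (contDiff_polyFun (crossDeriv q i))
        have h2 := (hΩ.integral_fderiv_harmonic hJ hu (contDiff_polyFun (axisDeriv i q))).1
        have h3 : (fun x => ((EuclideanSpace.proj i : Euc 3 →L[ℝ] ℝ).compLp v) x *
            polyFun (∑ j, axisDeriv j (axisDeriv j q)) x) =ᵐ[area (sphere (0 : Euc 3) R)]
            fun x => -fderiv ℝ (polyFun (crossDeriv q i)) x (v x) +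
              R * fderiv ℝ (polyFun (axisDeriv i q)) x (u x) := by
          filter_upwards [hf, hvT, hvu, ae_area_mem hΩ.measurableSet] with x h4 h5 h6 hx
          have hx0 : x ≠ 0 := norm_ne_zero_iff.1 (by rwa [mem_sphere_zero_iff_norm.1 hx])
          rw [h4, PiLp.proj_apply, mul_laplacian_eq q hx0 h5, h6, map_smul, smul_eq_mul]
          ring
        change ∫ x, ((EuclideanSpace.proj i : Euc 3 →L[ℝ] ℝ).compLp v) x *
            polyFun (∑ j, axisDeriv j (axisDeriv j q)) x ∂area (sphere (0 : Euc 3) R) = 0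
        rw [integral_congr_ae h3, integral_add
          (f := fun x => -fderiv ℝ (polyFun (crossDeriv q i)) x (v x))
          (hΩ.integrable_fderiv_apply (contDiff_polyFun _) (hΩ.integrable_of_memLp v)).neg
          ((hΩ.integrable_fderiv_apply (contDiff_polyFun _) (hΩ.integrable_of_memLp u)).const_mul R),
          integral_neg, integral_const_mul, h1, h2]
        simp
    refine ⟨c, ?_⟩
    filter_upwards [hc, hf] with x h1 h2
    rw [← h1, h2, PiLp.proj_apply]
  choose c hc using hcomp
  set c' : Euc 3 := WithLp.toLp 2 c
  have hvc : ∀ᵐ x ∂area (sphere (0 : Euc 3) R), v x = c' := by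
    filter_upwards [ae_all_iff.2 hc] with x hx
    ext i
    exact hx i
  -- A nonzero constant vector is not tangential near the point of the sphere in its direction.
  have hc0 : c' = 0 := by
    by_contra hne
    have hn : 0 < ‖c'‖ := norm_pos_iff.2 hne
    have hmem : (R / ‖c'‖) • c' ∈ sphere (0 : Euc 3) R := by
      rw [mem_sphere_zero_iff_norm, norm_smul, Real.norm_of_nonneg (by positivity),
        div_mul_cancel₀ _ hn.ne']
    have hopen : IsOpen {x : Euc 3 | 0 < (inner ℝ x c' : ℝ)} :=
      isOpen_lt continuous_const (by fun_prop)
    have h1 := hΩ.area_pos hmem (hopen.mem_nhds (by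
      rw [mem_ofPred_eq, real_inner_smul_left, real_inner_self_eq_norm_sq]
      positivity))
    refine h1.ne' (measure_eq_zero_iff_ae_notMem.2 ?_)
    filter_upwards [hvc, hvT] with x h2 h3 h4
    rw [h2] at h3
    exact h4.ne' h3
  refine Lp.eq_zero_iff_ae_eq_zero.2 ?_
  filter_upwards [hvc, hv, hu.1.1, ae_area_mem hΩ.measurableSet] with x h1 h2 h3 hx
  rw [Pi.zero_apply, ← norm_eq_zero, ← hN.norm_eq x hx _ h3, ← h2, h1, hc0, norm_zero]

end Sphere

end MixedFE

theorem mainTheorem2 :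
    -- closed surfaces
    (∀ (n : ℕ) (Ω : Set (Euc n)) (J : Euc n → Euc n →L[ℝ] Euc n)
      (E : Submodule ℝ (L2 Ω)) (S : Submodule ℝ (L2Vec Ω))
      (V : Submodule ℝ (L2 Ω)),
      IsClosedSurface Ω → IsRotationField Ω J → IsCompatible J E S V →
      -- `∇^⊥ : E → S`, `∇· : S → V` and `D : V → S` are well-defined maps
      ((∀ ψ ∈ E, ∃! u, HasCurl J ψ u) ∧ (∀ u ∈ S, ∃! d, HasWeakDiv u d) ∧
        (∀ φ ∈ V, ∃! w, IsDiscreteGrad S φ w)) ∧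
      -- the kernels of `∇^⊥` and `D` are the constants
      (∀ ψ ∈ E, HasCurl J ψ 0 ↔ IsConst ψ) ∧
      (∀ φ ∈ V, IsDiscreteGrad S φ 0 ↔ IsConst φ) ∧
      -- orthogonal decomposition
      (curlImage J E ⟂ gradImage S V ∧
        curlImage J E ⟂ discreteHarmonic J E S ∧
        gradImage S V ⟂ discreteHarmonic J E S ∧
        curlImage J E ⊔ gradImage S V ⊔ discreteHarmonic J E S = S) ∧
      -- dimension count with the discrete harmonic fields
      (finrank ℝ S : ℤ) = (finrank ℝ E - 1) + (finrank ℝ V - 1) +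
        finrank ℝ (discreteHarmonic J E S) ∧
      -- dimension count with the harmonic fields
      (HasSuitableProjections J E S V →
        FiniteDimensional ℝ (harmonicFields Ω J) ∧
        finrank ℝ (discreteHarmonic J E S) =
          finrank ℝ (harmonicFields Ω J) ∧
        (finrank ℝ S : ℤ) = (finrank ℝ E - 1) + (finrank ℝ V - 1) +
          finrank ℝ (harmonicFields Ω J) ∧
        (finrank ℝ E : ℤ) = finrank ℝ S - finrank ℝ V + 2 -
          finrank ℝ (harmonicFields Ω J) ∧
        (finrank ℝ S = 2 * finrank ℝ V →
          (finrank ℝ E : ℤ) =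
            finrank ℝ V + 2 - finrank ℝ (harmonicFields Ω J)) ∧
        (2 * finrank ℝ V < finrank ℝ S ↔
          (finrank ℝ V : ℤ) + (2 - finrank ℝ (harmonicFields Ω J)) <
            finrank ℝ E) ∧
        (finrank ℝ S < 2 * finrank ℝ V ↔
          (finrank ℝ E : ℤ) <
            finrank ℝ V + (2 - finrank ℝ (harmonicFields Ω J))))) ∧
    -- the doubly periodic plane
    (∀ (r s : ℝ) (J : Euc 4 → Euc 4 →L[ℝ] Euc 4), 0 < r → 0 < s →
      IsRotationField (flatTorus r s) J →
      (∀ u : L2Vec (flatTorus r s),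
        u ∈ harmonicFields (flatTorus r s) J ↔
          ∃ a b : ℝ, ∀ᵐ x ∂area (flatTorus r s),
            u x = constantField r s a b x) ∧
      finrank ℝ (harmonicFields (flatTorus r s) J) = 2 ∧
      ∀ (E : Submodule ℝ (L2 (flatTorus r s)))
        (S : Submodule ℝ (L2Vec (flatTorus r s)))
        (V : Submodule ℝ (L2 (flatTorus r s))),
        IsCompatible J E S V → HasSuitableProjections J E S V →
        finrank ℝ S = 2 * finrank ℝ V →
        finrank ℝ E = finrank ℝ V) ∧
    -- the sphere
    (∀ (R : ℝ) (J : Euc 3 → Euc 3 →L[ℝ] Euc 3), 0 < R →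
      IsRotationField (Metric.sphere (0 : Euc 3) R) J →
      harmonicFields (Metric.sphere (0 : Euc 3) R) J = ⊥ ∧
      ∀ (E : Submodule ℝ (L2 (Metric.sphere (0 : Euc 3) R)))
        (S : Submodule ℝ (L2Vec (Metric.sphere (0 : Euc 3) R)))
        (V : Submodule ℝ (L2 (Metric.sphere (0 : Euc 3) R))),
        IsCompatible J E S V → HasSuitableProjections J E S V →
        finrank ℝ S = 2 * finrank ℝ V →
        finrank ℝ E = finrank ℝ V + 2) := by
  refine ⟨fun n Ω J E S V hΩ hJ hC => ?_, fun r s J hr hs hJ => ?_, fun R J hR hJ => ?_⟩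
  · have := hC.finite_S
    have := hC.finite_V
    obtain ⟨d, hd⟩ := exists_divMap hΩ hC
    have hcount := finrank_eq_discrete hΩ hJ hC
    refine ⟨⟨fun ψ hψ => hΩ.existsUnique_hasCurl hJ (hC.E_le hψ),
      fun u hu => existsUnique_hasWeakDiv hΩ hC hu, fun φ hφ => ?_⟩,
      fun ψ _ => hΩ.hasCurl_zero_iff hJ, fun φ hφ => isDiscreteGrad_zero_iff hΩ hC hφ,
      discrete_decomposition hΩ hJ hC, by omega, fun hP => ?_⟩
    · exact ⟨_, (isDiscreteGrad_iff hd ⟨φ, hφ⟩ _).2 rfl,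
        fun w hw => (isDiscreteGrad_iff hd ⟨φ, hφ⟩ w).1 hw⟩
    · obtain ⟨hfin, hdim⟩ := finrank_harmonicFields hΩ hJ hC hP
      rw [hdim] at hcount
      exact ⟨hfin, hdim, by omega, by omega, by omega, by omega, by omega⟩
  · have hΩ := isClosedSurface_flatTorus hr hs
    have h2 := finrank_harmonicFields_flatTorus hr hs hJ
    refine ⟨mem_harmonicFields_flatTorus hr hs hJ, h2, fun E S V hC hP hSV => ?_⟩
    have hcount := finrank_eq_discrete hΩ hJ hC
    rw [(finrank_harmonicFields hΩ hJ hC hP).2, h2] at hcount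
    omega
  · have hΩ := isClosedSurface_sphere hR
    have h0 := harmonicFields_sphere hR hJ
    refine ⟨h0, fun E S V hC hP hSV => ?_⟩
    have hcount := finrank_eq_discrete hΩ hJ hC
    rw [(finrank_harmonicFields hΩ hJ hC hP).2, h0, finrank_bot] at hcount
    omega
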